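/- Let $A$ and $G$ be finite groups such that $A$ acts on $G$ by automorphisms and $\gcd(|G|,|A|)=1$, and let $N\trianglelefteq G$ be $A$-stable. (a) Let $\theta\in\operatorname{Irr}(N)$ be $A$-invariant and $G$-invariant, so that $(G,N,\theta)$ is a character triple. Then there exist a character triple $(G^*,N^*,\theta^*)$ with $G^*$ finite, an action of $A$ on $G^*$ by automorphisms stabilizing $N^*$ and $\theta^*$, and an isomorphism of character triples $(\iota,\sigma):(G,N,\theta)\to(G^*,N^*,\theta^*)$ such that $N^*\subseteq \mathbf Z(G^*)$ and both $\iota: G/N\to G^*/N^*$ and $\sigma_G:\operatorname{Irr}(G\mid\theta)\to\operatorname{Irr}(G^*\mid\theta^*)$ (more generally $\sigma_G$ on $\operatorname{Ch}(G\mid\theta)$) are $A$-equivariant. (b) Let $p$ be a prime, and let Brauer characters be defined with respect to a maximal ideal $M\ni p$ of the ring $\mathbf R$ of algebraic integers in $\mathbb C$: the Brauer character of a representation over $\mathbf R/M$ takes at a $p$-regular element the sum of the lifts of its eigenvalues to complex roots of unity of order prime to $p$. Let $\theta\in\operatorname{IBr}(N)$ be $A$-invariant and $G$-invariant, so that $(G,N,\theta)$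 is a modular character triple. Then there exist a modular character triple $(G^*,N^*,\theta^*)$ with $G^*$ finite, an action of $A$ on $G^*$ by automorphisms stabilizing $N^*$ and $\theta^*$, and an isomorphism of modular character triples $(\iota,\sigma):(G,N,\theta)\to(G^*,N^*,\theta^*)$ such that $N^*\subseteq \mathbf Z(G^*)$ is a $p'$-group and both $\iota: G/N\to G^*/N^*$ and $\sigma_G:\operatorname{IBr}(G\mid\theta)\to\operatorname{IBr}(G^*\mid\theta^*)$ (more generally $\sigma_G$ on $\operatorname{Ch}(G\mid\theta)$) are $A$-equivariant. Here, for $N\le H\le G$, $\operatorname{Ch}(H\mid\theta)$ denotes the set of ordinary (in (b): Brauer) characters of $H$, possibly reducible, whose restriction to $N$ is a multiple of $\theta$, and $\operatorname{Irr}(H\mid\theta)$ (in (b): $\operatorname{IBr}(H\mid\theta)$) the set of irreducible ones among them. An isomorphism $(\iota,\sigma)$ of (modular) character triples consists of a group isomorphism $\iota:G/N\to G^*/N^*$ and, for every $N\le H\le G$ and the subgroup $H^\iota$ with $N^*\le H^\iota\le G^*$ and $H^\iota/N^*=\iota(H/N)$, of a map $\sigma_H:\operatorname{Ch}(H\mid\theta)\to\operatorname{Ch}(H^\iota\mid\theta^*)$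 that restricts to a bijection between the irreducible elements and satisfies $\sigma_H(\chi+\psi)=\sigma_H(\chi)+\sigma_H(\psi)$; in (a) $[\sigma_H(\chi),\sigma_H(\psi)]=[\chi,\psi]$; $\sigma_K(\chi_K)=\sigma_H(\chi)_{K^\iota}$ for $N\le K\le H$; and $\sigma_H(\chi\beta)=\sigma_H(\chi)\beta^\iota$ for every irreducible (Brauer) character $\beta$ of $H/N$, where $\beta^\iota$ is the character of $H^\iota/N^*$ corresponding to $\beta$ under $\iota$. -/

import Mathlib

universe u v w

noncomputable section

namespace CharTriple

/-! ### Groups acting on groups, and subgroups over a normal subgroup -/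

section Groups

variable {G : Type u} [Group G]

/-- The automorphism `h ↦ a • h` of an `A`-stable subgroup `H` of `G`. -/
def actHom {A : Type v} [Group A] [MulDistribMulAction A G] (H : Subgroup G)
    (hH : ∀ (a : A), ∀ h ∈ H, a • h ∈ H) (a : A) : H →* H :=
  ((MulDistribMulAction.toMonoidHom G a).comp H.subtype).codRestrict H
    (fun h => hH a h h.2)

/-- The automorphism `gN ↦ (a • g)N` of `G ⧸ N` for an `A`-stable normal subgroup `N`. -/
def quotAct {A : Type v} [Group A] [MulDistribMulAction A G] (N : Subgroup G) [N.Normal]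
    (hN : ∀ (a : A), ∀ n ∈ N, a • n ∈ N) (a : A) : G ⧸ N →* G ⧸ N :=
  QuotientGroup.map N N (MulDistribMulAction.toMonoidHom G a) (fun n hn => hN a n hn)

/-- The image `H/N` of a subgroup `H` of `G` in `G ⧸ N`. -/
abbrev quot (N : Subgroup G) [N.Normal] (H : Subgroup G) : Subgroup (G ⧸ N) :=
  H.map (QuotientGroup.mk' N)

/-- The canonical projection `H → H/N`. -/
def toQuot (N : Subgroup G) [N.Normal] (H : Subgroup G) : H →* quot N H :=
  (QuotientGroup.mk' N).subgroupMap H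

variable {G' : Type w} [Group G'] {N : Subgroup G} [N.Normal] {N' : Subgroup G'} [N'.Normal]

/-- The subgroup `H'` of `G'` with `N' ≤ H'` and `H'/N' = ι(H/N)`, that is, the full preimage
of `ι(H/N)` in `G'`. -/
def corr (ι : G ⧸ N ≃* G' ⧸ N') (H : Subgroup G) : Subgroup G' :=
  (quot N H).comap (ι.symm.toMonoidHom.comp (QuotientGroup.mk' N'))

/-- The composite `H' → H'/N' = ι(H/N) → H/N` of the canonical projection with `ι⁻¹`. -/
def corrToQuot (ι : G ⧸ N ≃* G' ⧸ N') (H : Subgroup G) : corr ι H →* quot N H :=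
  (ι.symm.toMonoidHom.comp (QuotientGroup.mk' N')).subgroupComap (quot N H)

theorem mem_corr_iff (ι : G ⧸ N ≃* G' ⧸ N') (H : Subgroup G) (x : G') :
    x ∈ corr ι H ↔ (x : G' ⧸ N') ∈ (quot N H).map ι.toMonoidHom := by
  constructor
  · intro h
    exact ⟨_, h, ι.apply_symm_apply _⟩
  · rintro ⟨y, hy, hyx⟩
    have h2 : ι.symm (x : G' ⧸ N') = y := by rw [← hyx]; exact ι.symm_apply_apply y
    change ι.symm (x : G' ⧸ N') ∈ quot N H
    rw [h2]; exact hy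

theorem le_corr (ι : G ⧸ N ≃* G' ⧸ N') (H : Subgroup G) : N' ≤ corr ι H := by
  intro x hx
  have h2 : (x : G' ⧸ N') = 1 := (QuotientGroup.eq_one_iff x).2 hx
  change ι.symm (x : G' ⧸ N') ∈ quot N H
  rw [h2, map_one]
  exact one_mem _

theorem corr_mono (ι : G ⧸ N ≃* G' ⧸ N') {K H : Subgroup G} (h : K ≤ H) :
    corr ι K ≤ corr ι H :=
  Subgroup.comap_mono (Subgroup.map_mono h)

theorem mem_corr_top (ι : G ⧸ N ≃* G' ⧸ N') (x : G') : x ∈ corr ι (⊤ : Subgroup G) := by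
  change ι.symm (x : G' ⧸ N') ∈ quot N ⊤
  obtain ⟨g, hg⟩ := QuotientGroup.mk_surjective (ι.symm (x : G' ⧸ N'))
  exact ⟨g, Subgroup.mem_top g, hg⟩

end Groups

/-! ### Ordinary characters -/

section Ordinary

/-- `χ` is a (complex, possibly reducible) character of `G`. -/
def IsChar {G : Type u} [Group G] (χ : G → ℂ) : Prop :=
  ∃ (n : ℕ) (ρ : Representation ℂ G (Fin n → ℂ)), 0 < n ∧ χ = ρ.character

/-- `χ ∈ Irr(G)`. -/
def IsIrr {G : Type u} [Group G] (χ : G → ℂ) : Prop :=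
  ∃ (n : ℕ) (ρ : Representation ℂ G (Fin n → ℂ)), ρ.IsIrreducible ∧ χ = ρ.character

/-- The inner product `[χ, ψ] = |G|⁻¹ ∑ χ(g) conj(ψ(g))` of class functions. -/
def charInner {G : Type u} [Group G] (χ ψ : G → ℂ) : ℂ :=
  (Nat.card G : ℂ)⁻¹ * ∑ᶠ g : G, χ g * star (ψ g)

variable {G : Type u} [Group G]

/-- `Ch(H | θ)` for `N ≤ H`: the characters of `H` whose restriction to `N` is a multiple
of `θ`. -/
def ChOver {N H : Subgroup G} (hNH : N ≤ H) (θ : N → ℂ) : Set (H → ℂ) :=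
  {χ | IsChar χ ∧ ∃ e : ℕ, ∀ n : N, χ (Subgroup.inclusion hNH n) = e * θ n}

/-- `Irr(H | θ)` for `N ≤ H` and `θ` an `H`-invariant irreducible character of `N`: then, by
Clifford, lying over `θ` means that the restriction to `N` is a multiple of `θ`. -/
def IrrOver {N H : Subgroup G} (hNH : N ≤ H) (θ : N → ℂ) : Set (H → ℂ) :=
  {χ | IsIrr χ ∧ χ ∈ ChOver hNH θ}

/-- `(G, N, θ)` is a character triple: `N` is normal in `G` and `θ ∈ Irr(N)` is
`G`-invariant. -/
structure IsTriple (N : Subgroup G) [N.Normal] (θ : N → ℂ) : Prop where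
  irr : IsIrr θ
  inv : ∀ (g : G) (n : N), θ (MulAut.conjNormal g n) = θ n

/-- An isomorphism `(ι, σ) : (G, N, θ) → (G', N', θ')` of character triples. For each `H` with
`N ≤ H ≤ G`, the map `σ H` is relevant on `Ch(H | θ)` only. -/
structure TripleIso {G' : Type w} [Group G'] (N : Subgroup G) [N.Normal] (θ : N → ℂ)
    (N' : Subgroup G') [N'.Normal] (θ' : N' → ℂ) where
  ι : G ⧸ N ≃* G' ⧸ N'
  σ : ∀ H : Subgroup G, N ≤ H → (H → ℂ) → (corr ι H → ℂ)
  mapsTo : ∀ (H : Subgroup G) (hH : N ≤ H),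
    Set.MapsTo (σ H hH) (ChOver hH θ) (ChOver (le_corr ι H) θ')
  bijOn_irr : ∀ (H : Subgroup G) (hH : N ≤ H),
    Set.BijOn (σ H hH) (IrrOver hH θ) (IrrOver (le_corr ι H) θ')
  add : ∀ (H : Subgroup G) (hH : N ≤ H), ∀ χ ∈ ChOver hH θ, ∀ ψ ∈ ChOver hH θ,
    σ H hH (χ + ψ) = σ H hH χ + σ H hH ψ
  inner : ∀ (H : Subgroup G) (hH : N ≤ H), ∀ χ ∈ ChOver hH θ, ∀ ψ ∈ ChOver hH θ,
    charInner (σ H hH χ) (σ H hH ψ) = charInner χ ψ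
  res : ∀ (K H : Subgroup G) (hK : N ≤ K) (hKH : K ≤ H), ∀ χ ∈ ChOver (hK.trans hKH) θ,
    σ K hK (χ ∘ Subgroup.inclusion hKH) =
      σ H (hK.trans hKH) χ ∘ Subgroup.inclusion (corr_mono ι hKH)
  /-- `σ_H(χβ) = σ_H(χ)β^ι` for `β ∈ Irr(H/N)` (characters of quotients are inflated). -/
  mul : ∀ (H : Subgroup G) (hH : N ≤ H), ∀ χ ∈ ChOver hH θ, ∀ β : quot N H → ℂ, IsIrr β →
    σ H hH (χ * (β ∘ toQuot N H)) = σ H hH χ * (β ∘ corrToQuot ι H)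

end Ordinary

/-! ### Brauer characters -/

section Modular

/-- The ring of all algebraic integers in `ℂ`. -/
abbrev AlgInt : Type := integralClosure ℤ ℂ

/-- The set of `p`-regular elements of a group. -/
abbrev PReg (p : ℕ) (G : Type u) [Group G] : Type u := {g : G // ¬ p ∣ orderOf g}

/-- The map on `p`-regular elements that a homomorphism induces. -/
def PReg.map {p : ℕ} {G : Type u} {H : Type v} [Group G] [Group H] (f : G →* H)
    (g : PReg p G) : PReg p H :=
  ⟨f g, fun h => g.2 (h.trans (orderOf_map_dvd f (g : G)))⟩

variable (p : ℕ) (M : Ideal AlgInt) [M.IsMaximal]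

attribute [local instance] Ideal.Quotient.field

/-- `φ` is the Brauer character afforded by a representation `ρ` over the residue field
`AlgInt ⧸ M`: on a `p`-regular element `g`, it is the sum of the lifts of the eigenvalues of `ρ g`
(with multiplicity) to complex roots of unity of order prime to `p`. -/
def Affords {G : Type u} [Group G] {n : ℕ}
    (ρ : Representation (AlgInt ⧸ M) G (Fin n → AlgInt ⧸ M)) (φ : PReg p G → ℂ) : Prop :=
  ∀ g : PReg p G, ∃ s : Multiset AlgInt,
    (∀ ξ ∈ s, ∃ m : ℕ, 0 < m ∧ ¬ p ∣ m ∧ ξ ^ m = 1) ∧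
    s.map (Ideal.Quotient.mk M) = (LinearMap.charpoly (ρ g)).roots ∧
    φ g = (s.map (fun ξ => (ξ : ℂ))).sum

/-- `φ` is a (possibly reducible) Brauer character of `G`. -/
def IsBrauerChar {G : Type u} [Group G] (φ : PReg p G → ℂ) : Prop :=
  ∃ (n : ℕ) (ρ : Representation (AlgInt ⧸ M) G (Fin n → AlgInt ⧸ M)),
    0 < n ∧ Affords p M ρ φ

/-- `φ ∈ IBr(G)`. -/
def IsIBr {G : Type u} [Group G] (φ : PReg p G → ℂ) : Prop :=
  ∃ (n : ℕ) (ρ : Representation (AlgInt ⧸ M) G (Fin n → AlgInt ⧸ M)),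
    ρ.IsIrreducible ∧ Affords p M ρ φ

variable {G : Type u} [Group G]

/-- The Brauer characters of `H` whose restriction to `N` is a multiple of `θ`. -/
def BChOver {N H : Subgroup G} (hNH : N ≤ H) (θ : PReg p N → ℂ) : Set (PReg p H → ℂ) :=
  {χ | IsBrauerChar p M χ ∧
    ∃ e : ℕ, ∀ n : PReg p N, χ (PReg.map (Subgroup.inclusion hNH) n) = e * θ n}

/-- `IBr(H | θ)` for `N ≤ H` and `θ` an `H`-invariant irreducible Brauer character of `N`: then,
by Clifford, lying over `θ` means that the restriction to `N` is a multiple of `θ`. -/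
def IBrOver {N H : Subgroup G} (hNH : N ≤ H) (θ : PReg p N → ℂ) : Set (PReg p H → ℂ) :=
  {χ | IsIBr p M χ ∧ χ ∈ BChOver p M hNH θ}

/-- `(G, N, θ)` is a modular character triple: `N` is normal in `G` and `θ ∈ IBr(N)` is
`G`-invariant. -/
structure IsModTriple (N : Subgroup G) [N.Normal] (θ : PReg p N → ℂ) : Prop where
  irr : IsIBr p M θ
  inv : ∀ (g : G) (n : PReg p N),
    θ (PReg.map (MulAut.conjNormal g : N ≃* N).toMonoidHom n) = θ n

/-- An isomorphism `(ι, σ) : (G, N, θ) → (G', N', θ')` of modular character triples. For each `H`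
with `N ≤ H ≤ G`, the map `σ H` is relevant only on the Brauer characters of `H` whose restriction
to `N` is a multiple of `θ`. -/
structure ModTripleIso {G' : Type w} [Group G'] (N : Subgroup G) [N.Normal] (θ : PReg p N → ℂ)
    (N' : Subgroup G') [N'.Normal] (θ' : PReg p N' → ℂ) where
  ι : G ⧸ N ≃* G' ⧸ N'
  σ : ∀ H : Subgroup G, N ≤ H → (PReg p H → ℂ) → (PReg p (corr ι H) → ℂ)
  mapsTo : ∀ (H : Subgroup G) (hH : N ≤ H),
    Set.MapsTo (σ H hH) (BChOver p M hH θ) (BChOver p M (le_corr ι H) θ')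
  bijOn_irr : ∀ (H : Subgroup G) (hH : N ≤ H),
    Set.BijOn (σ H hH) (IBrOver p M hH θ) (IBrOver p M (le_corr ι H) θ')
  add : ∀ (H : Subgroup G) (hH : N ≤ H), ∀ χ ∈ BChOver p M hH θ, ∀ ψ ∈ BChOver p M hH θ,
    σ H hH (χ + ψ) = σ H hH χ + σ H hH ψ
  res : ∀ (K H : Subgroup G) (hK : N ≤ K) (hKH : K ≤ H), ∀ χ ∈ BChOver p M (hK.trans hKH) θ,
    σ K hK (χ ∘ PReg.map (Subgroup.inclusion hKH)) =
      σ H (hK.trans hKH) χ ∘ PReg.map (Subgroup.inclusion (corr_mono ι hKH))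
  /-- `σ_H(χβ) = σ_H(χ)β^ι` for `β ∈ IBr(H/N)` (characters of quotients are inflated). -/
  mul : ∀ (H : Subgroup G) (hH : N ≤ H), ∀ χ ∈ BChOver p M hH θ,
    ∀ β : PReg p (quot N H) → ℂ, IsIBr p M β →
      σ H hH (χ * (β ∘ PReg.map (toQuot N H))) =
        σ H hH χ * (β ∘ PReg.map (corrToQuot ι H))

end Modular

end CharTriple

end

noncomputable section

namespace CharTriple

open Module

/-! ### Lifting eigenvalues to characteristic zero -/

/-! Both parts are one theorem about an algebraically closed field `k` of characteristic `p`, where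
`p` is zero or a prime, together with a multiplicative lift of `k` into a subring of `ℂ`. The Brauer
character of a representation sums the lifted eigenvalues at `p`-regular elements. For `k = ℂ`, `p =
0` and the identity lift it is the ordinary character, every element of a finite group being
`0`-regular; for `k = AlgInt ⧸ M` the lift sends a nonzero element to the root of unity of order
prime to `p` above it.

Let `ρ` on `X` afford `θ`. Invariance under `g` makes `ρ` isomorphic to its conjugate by `g`, so
there are pairs `(g, P)` with `P` intertwining the two. Those with `det P ^ |N| = 1` form a group
`cover ρ`. It is finite, maps onto `G` with a kernel of scalars, contains a copy of `N` through `n ↦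
(n, ρ n)`, and carries a representation `W` that extends `ρ`. Put `G* = cover ρ / N` and let `N*` be
the image of the scalars. It is central, and a `p'`-group because `k` has no nontrivial `p`-th roots
of unity. Both `G/N` and `G*/N*` are the quotient of the cover by `N` times the scalars.

Inflate everything to the preimage `E` of `H` in the cover. Then `χ` corresponds to `u` when `χ = W
· u`. For irreducibles this is `U ↦ W ⊗ U` with inverse `V ↦ Hom_N(X, V)`; Burnside's theorem shows
that tensoring with `W` preserves and reflects irreducibility and determines `U`
(`isIrreducible_tprod`, `nonempty_equiv_of_tprod_equiv`, `nonempty_tprod_equiv`). Reducible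
characters are handled by the `ℤ`-linear independence of irreducible Brauer characters
(`eq_zero_of_sum_brauer_eq_zero`), so the relation determines `u` (`Rel.injective`). The value of
`σ` is thus recognised by a product formula, and compatibility with sums, restrictions and products
can be read off.

For `a` in `A` choose an intertwiner `Q a` from `ρ` to `ρ` twisted by `a`. It is unique up to a
scalar, so conjugation by it does not depend on the choice, and `(g, P) ↦ (a • g, Q a P (Q a)⁻¹)` is
a true action on the cover. It fixes the scalars, and it leaves the character of `W` unchanged since
it only conjugates `W`; hence it preserves the product formula, which is the equivariance of `σ`. -/

/-- A multiplicative section `lift` of a ring homomorphism `red` from a subring of `ℂ` to `k`. -/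
structure CharLift (k : Type) [Field k] where
  ring : Subring ℂ
  red : ring →+* k
  lift : k →* ring
  red_lift : ∀ x, red (lift x) = x

section Eigenvalues

variable {k : Type} [Field k] {V V' : Type} [AddCommGroup V] [Module k V] [FiniteDimensional k V]
  [AddCommGroup V'] [Module k V'] [FiniteDimensional k V']

/-- In a basis of `V` that extends one of `S`, the matrix of `f` is block upper triangular. -/
theorem charpoly_eq_mul_of_invariant (f : End k V) (S : Submodule k V) (hS : S ≤ S.comap f) :
    f.charpoly = (f.restrict hS).charpoly * (S.mapQ S f hS).charpoly := by
  classical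
  let bS := Module.finBasis k S
  let bQ := Module.finBasis k (V ⧸ S)
  let b := Basis.sumQuot bS bQ
  suffices h : LinearMap.toMatrix b b f = Matrix.fromBlocks
      (LinearMap.toMatrix bS bS (f.restrict hS))
      (Matrix.of fun i l => b.repr (f (b (Sum.inr l))) (Sum.inl i)) 0
      (LinearMap.toMatrix bQ bQ (S.mapQ S f hS)) by
    rw [← LinearMap.charpoly_toMatrix f b, h, Matrix.charpoly_fromBlocks_zero₂₁,
      LinearMap.charpoly_toMatrix, LinearMap.charpoly_toMatrix]
  ext s t
  cases s with
  | inl i =>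
    cases t with
    | inl j =>
      simp only [b, Basis.sumQuot_inl, Matrix.fromBlocks_apply₁₁, LinearMap.toMatrix_apply]
      apply Basis.sumQuot_repr_inl_of_mem
    | inr l => simp [b, LinearMap.toMatrix_apply, Matrix.fromBlocks_apply₁₂]
  | inr j =>
    cases t with
    | inl i =>
      suffices S.mkQ (f (bS i)) = 0 by simp [LinearMap.toMatrix_apply, b, this]
      rw [← LinearMap.mem_ker, Submodule.ker_mkQ]
      exact hS (Submodule.coe_mem (bS i))
    | inr l =>
      simp only [LinearMap.toMatrix_apply, Basis.sumQuot_repr_inr, Matrix.fromBlocks_apply₂₂, b]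
      rw [← Basis.sumQuot_inr bS bQ l, S.mapQ_apply]
      simp

theorem roots_charpoly_of_eigenbasis {ι : Type} [Fintype ι] (f : End k V) (b : Basis ι k V)
    (μ : ι → k) (h : ∀ i, f (b i) = μ i • b i) :
    f.charpoly.roots = Finset.univ.val.map μ := by
  classical
  have hm : LinearMap.toMatrix b b f = Matrix.diagonal μ := by
    ext i j
    rw [LinearMap.toMatrix_apply, h, map_smul, Basis.repr_self, Matrix.diagonal_apply]
    by_cases hij : i = j
    · subst hij; simp
    · rw [if_neg hij]; simp [Finsupp.single_eq_of_ne hij]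
  rw [← LinearMap.charpoly_toMatrix f b, hm, Matrix.charpoly_diagonal]
  have := Polynomial.roots_multiset_prod_X_sub_C (Finset.univ.val.map μ)
  rwa [Multiset.map_map] at this

/-- `X ^ m - 1` is separable when `m` is invertible in `k`, so `f` is semisimple. This applies to
`p`-regular elements, whose order is invertible in `k`. -/
theorem exists_eigenbasis [IsAlgClosed k] (f : End k V) {m : ℕ} (hm : (m : k) ≠ 0)
    (hf : f ^ m = 1) :
    ∃ (ι : Type) (_ : Fintype ι) (b : Basis ι k V) (μ : ι → k), ∀ i, f (b i) = μ i • b i := by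
  classical
  have hss : f.IsSemisimple := by
    apply End.isSemisimple_of_squarefree_aeval_eq_zero (p := Polynomial.X ^ m - 1)
    · exact ((Polynomial.separable_X_pow_sub_C (1 : k) hm one_ne_zero)).squarefree
    · simp [hf]
  have hint : DirectSum.IsInternal (fun μ : k => f.eigenspace μ) := by
    rw [DirectSum.isInternal_submodule_iff_iSupIndep_and_iSup_eq_top]
    exact ⟨End.eigenspaces_iSupIndep f, hss.iSup_eigenspace_eq_top⟩
  let b := hint.collectedBasis (fun μ => Module.finBasis k (f.eigenspace μ))
  have : Fintype (Σ μ : k, Fin (finrank k (f.eigenspace μ))) :=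
    FiniteDimensional.fintypeBasisIndex b
  exact ⟨_, this, b, fun i => i.1, fun i =>
    End.mem_eigenspace_iff.1 (hint.collectedBasis_mem _ i)⟩

namespace CharLift

variable (Λ : CharLift k)

/-- The sum of the lifts of the eigenvalues of `f`. -/
def trLift (f : End k V) : Λ.ring := (f.charpoly.roots.map Λ.lift).sum

/-- The link between Brauer characters and representation theory over `k`: reduction recovers the
trace. -/
theorem red_trLift [IsAlgClosed k] (f : End k V) : Λ.red (Λ.trLift f) = LinearMap.trace k V f := by
  rw [trLift, map_multiset_sum, Multiset.map_map,
    End.trace_eq_sum_roots_charpoly_of_splits (IsAlgClosed.splits _)]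
  congr 1
  conv_rhs => rw [← Multiset.map_id f.charpoly.roots]
  exact Multiset.map_congr rfl fun x _ => Λ.red_lift x

theorem trLift_of_eigenbasis {ι : Type} [Fintype ι] (f : End k V) (b : Basis ι k V)
    (μ : ι → k) (h : ∀ i, f (b i) = μ i • b i) : Λ.trLift f = ∑ i, Λ.lift (μ i) := by
  rw [trLift, roots_charpoly_of_eigenbasis f b μ h, Multiset.map_map]
  rfl

theorem trLift_smul_one (c : k) : Λ.trLift (c • (1 : End k V)) = finrank k V * Λ.lift c := by
  rw [Λ.trLift_of_eigenbasis _ (Module.finBasis k V) (fun _ => c) (by simp)]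
  simp

theorem trLift_one : Λ.trLift (1 : End k V) = finrank k V := by
  simpa using Λ.trLift_smul_one (V := V) 1

theorem trLift_conj (e : V ≃ₗ[k] V') (f : End k V) (f' : End k V') (h : ∀ v, e (f v) = f' (e v)) :
    Λ.trLift f = Λ.trLift f' := by
  have : f' = e.conj f := by
    ext v
    simp [LinearEquiv.conj_apply, h]
  rw [trLift, trLift, this, LinearEquiv.charpoly_conj]

theorem trLift_eq_add [IsAlgClosed k] (f : End k V) (S : Submodule k V) (hS : S ≤ S.comap f) :
    Λ.trLift f = Λ.trLift (f.restrict hS) + Λ.trLift (S.mapQ S f hS) := by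
  rw [trLift, charpoly_eq_mul_of_invariant f S hS, Polynomial.roots_mul, Multiset.map_add,
    Multiset.sum_add]
  · rfl
  · exact mul_ne_zero (LinearMap.charpoly_monic _).ne_zero (LinearMap.charpoly_monic _).ne_zero

/-- The lift is multiplicative but need not be additive, so the eigenvalues themselves must be
multiplied; a common exponent prime to the characteristic provides eigenbases on both factors. -/
theorem trLift_map [IsAlgClosed k] (f : End k V) (f' : End k V') {m : ℕ} (hm : (m : k) ≠ 0)
    (hf : f ^ m = 1) (hf' : f' ^ m = 1) :
    Λ.trLift (TensorProduct.map f f') = Λ.trLift f * Λ.trLift f' := by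
  obtain ⟨ι, _, b, μ, h⟩ := exists_eigenbasis f hm hf
  obtain ⟨ι', _, b', μ', h'⟩ := exists_eigenbasis f' hm hf'
  rw [Λ.trLift_of_eigenbasis f b μ h, Λ.trLift_of_eigenbasis f' b' μ' h',
    Λ.trLift_of_eigenbasis _ (b.tensorProduct b') (fun i => μ i.1 * μ' i.2),
    Finset.sum_mul_sum, ← Finset.univ_product_univ, Finset.sum_product]
  · simp
  · intro i
    rw [Basis.tensorProduct_apply', TensorProduct.map_tmul, h, h', TensorProduct.smul_tmul_smul]

end CharLift

end Eigenvalues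

end CharTriple

end

noncomputable section

namespace CharTriple

open Module Representation

open scoped MonoidAlgebra TensorProduct

/-! ### Density and linear independence of traces -/

section Density

variable {k : Type} [Field k] {G : Type u} [Group G]

theorem nontrivial_of_isIrreducible {V : Type} [AddCommGroup V] [Module k V]
    {ρ : Representation k G V} (hirr : ρ.IsIrreducible) : Nontrivial V := by
  by_contra hn
  rw [not_nontrivial_iff_subsingleton] at hn
  have : Nontrivial (Subrepresentation ρ) := hirr.toNontrivial
  obtain ⟨S, S', hS⟩ := exists_pair_ne (Subrepresentation ρ)
  exact hS (Subrepresentation.toSubmodule_injective (Subsingleton.elim _ _))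

variable [IsAlgClosed k]

/-- The group algebra maps onto the product of the endomorphism rings of pairwise non-isomorphic
irreducible representations. -/
theorem exists_asAlgebraHom_eq {ι : Type} [Fintype ι] {V : ι → Type}
    [∀ i, AddCommGroup (V i)] [∀ i, Module k (V i)] [∀ i, FiniteDimensional k (V i)]
    (ρ : ∀ i, Representation k G (V i)) (hirr : ∀ i, (ρ i).IsIrreducible)
    (hne : ∀ i j, i ≠ j → IsEmpty ((ρ i).Equiv (ρ j))) (i : ι) (T : End k (V i)) :
    ∃ r : k[G], (ρ i).asAlgebraHom r = T ∧ ∀ j, j ≠ i → (ρ j).asAlgebraHom r = 0 := by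
  classical
  let M := ∀ j, (ρ j).asModule
  -- By Schur's lemma an endomorphism of the product has no off-diagonal components, and its
  -- diagonal components are scalars.
  have key : ∀ (φ : End k[G] M) (j : ι), ∃ c : k, ∀ m : M, φ m j = c • m j := by
    intro φ j
    have h1 : ∀ l, l ≠ j → ∀ x, φ (Pi.single l x) j = 0 := by
      intro l hl x
      have := hne l j hl
      have hs : Subsingleton ((ρ l).asModule →ₗ[k[G]] (ρ j).asModule) :=
        (IntertwiningMap.equivLinearMapAsModule (ρ l) (ρ j)).symm.toEquiv.subsingleton
      exact congrArg (fun f : (ρ l).asModule →ₗ[k[G]] (ρ j).asModule => f x)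
        (Subsingleton.elim ((LinearMap.proj j).comp (φ.comp (LinearMap.single k[G] _ l))) 0)
    obtain ⟨c, hc⟩ := (IsSimpleModule.algebraMap_end_bijective_of_isAlgClosed k
      (A := k[G]) (V := (ρ j).asModule)).2
      ((LinearMap.proj j).comp (φ.comp (LinearMap.single k[G] _ j)))
    refine ⟨c, fun m => ?_⟩
    have hm : m = ∑ l, Pi.single l (m l) := (Finset.univ_sum_single m).symm
    have h2 : φ m j = ∑ l, φ (Pi.single l (m l)) j := by
      conv_lhs => rw [hm]
      rw [map_sum, Finset.sum_apply]
    rw [h2, Finset.sum_eq_single j (fun l _ hl => h1 l hl _) (by simp)]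
    exact (LinearMap.congr_fun hc (m j)).symm
  let T' : (ρ i).asModule → (ρ i).asModule := fun x =>
    (ρ i).asModuleEquiv.symm (T ((ρ i).asModuleEquiv x))
  have hadd : ∀ x y, T' (x + y) = T' x + T' y := fun x y => by
    simp only [T', map_add]
  have hsmul : ∀ (c : k) (x), T' (c • x) = c • T' x := fun c x => map_smul T c _
  have hsymm : ∀ x, T' ((ρ i).asModuleEquiv.symm x) = (ρ i).asModuleEquiv.symm (T x) := fun x =>
    congrArg (fun y => (ρ i).asModuleEquiv.symm (T y)) ((ρ i).asModuleEquiv.apply_symm_apply x)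
  -- `T` on the factor `i` and zero elsewhere commutes with all these diagonal scalars, so Jacobson
  -- density realises it by an element of `k[G]` on the finitely many basis vectors.
  let f : End (End k[G] M) M :=
    { toFun := fun m => Pi.single i (T' (m i))
      map_add' := fun m m' => by
        rw [← Pi.single_add, ← hadd]
        rfl
      map_smul' := fun φ m => by
        funext j
        simp only [RingHom.id_apply, End.smul_def]
        obtain ⟨c, hc⟩ := key φ j
        rw [hc]
        by_cases hj : j = i
        · cases hj
          rw [Pi.single_eq_same, Pi.single_eq_same, hc, hsmul]
        · rw [Pi.single_eq_of_ne hj, Pi.single_eq_of_ne hj, smul_zero] }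
  obtain ⟨r, hr⟩ := jacobson_density f (Finset.univ.image
    fun x : Σ j, Fin (finrank k (V j)) =>
      (Pi.single x.1 ((ρ x.1).asModuleEquiv.symm (Module.finBasis k (V x.1) x.2)) : M))
  have hr' : ∀ j t, f (Pi.single j ((ρ j).asModuleEquiv.symm (Module.finBasis k (V j) t))) j =
      (ρ j).asModuleEquiv.symm ((ρ j).asAlgebraHom r (Module.finBasis k (V j) t)) := by
    intro j t
    rw [hr _ (Finset.mem_image.2 ⟨⟨j, t⟩, Finset.mem_univ _, rfl⟩)]
    change r • (Pi.single j _ : M) j = _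
    rw [Pi.single_eq_same]
    rfl
  refine ⟨r, (Module.finBasis k (V i)).ext fun t => ?_,
    fun j hj => (Module.finBasis k (V j)).ext fun t => ?_⟩
  · have := hr' i t
    change (Pi.single i (T' ((Pi.single i _ : M) i)) : M) i = _ at this
    rw [Pi.single_eq_same, Pi.single_eq_same, hsymm] at this
    exact ((ρ i).asModuleEquiv.symm.injective this).symm
  · have := hr' j t
    change (Pi.single i (T' ((Pi.single j _ : M) i)) : M) j = _ at this
    rw [Pi.single_eq_of_ne hj] at this
    exact (ρ j).asModuleEquiv.symm.injective (this.symm.trans (map_zero _).symm)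

/-- **Burnside's theorem** on irreducible representations. -/
theorem span_range_eq_top {V : Type} [AddCommGroup V] [Module k V] [FiniteDimensional k V]
    (ρ : Representation k G V) (hirr : ρ.IsIrreducible) :
    Submodule.span k (Set.range ρ) = ⊤ := by
  refine eq_top_iff.2 fun T _ => ?_
  obtain ⟨r, hr, -⟩ := exists_asAlgebraHom_eq (ι := Unit) (V := fun _ => V) (fun _ => ρ)
    (fun _ => hirr) (fun i j h => absurd (Subsingleton.elim i j) h) () T
  rw [← hr, asAlgebraHom_def, MonoidAlgebra.lift_apply]
  exact Submodule.sum_mem _ fun g _ => Submodule.smul_mem _ _ (Submodule.subset_span ⟨g, rfl⟩)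

theorem eq_zero_of_sum_trace_eq_zero {ι : Type} [Fintype ι] {V : ι → Type}
    [∀ i, AddCommGroup (V i)] [∀ i, Module k (V i)] [∀ i, FiniteDimensional k (V i)]
    (ρ : ∀ i, Representation k G (V i)) (hirr : ∀ i, (ρ i).IsIrreducible)
    (hne : ∀ i j, i ≠ j → IsEmpty ((ρ i).Equiv (ρ j))) (c : ι → k)
    (h : ∀ g, ∑ i, c i * LinearMap.trace k _ (ρ i g) = 0) (i : ι) : c i = 0 := by
  classical
  have h' : ∀ r : k[G], ∑ i, c i * LinearMap.trace k _ ((ρ i).asAlgebraHom r) = 0 := by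
    intro r
    induction r using MonoidAlgebra.induction_on with
    | of g => simpa using h g
    | add x y hx hy => simp [mul_add, Finset.sum_add_distrib, hx, hy]
    | smul a x hx =>
      have : ∀ i, c i * LinearMap.trace k _ ((ρ i).asAlgebraHom (a • x)) =
        a * (c i * LinearMap.trace k _ ((ρ i).asAlgebraHom x)) := fun i => by
          rw [map_smul, map_smul, smul_eq_mul]; ring
      simp only [this, ← Finset.mul_sum, hx, mul_zero]
  have hnt := nontrivial_of_isIrreducible (hirr i)
  obtain ⟨v, hv⟩ := exists_ne (0 : V i)
  obtain ⟨l, hl⟩ := Projective.exists_dual_eq_one k hv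
  -- With `l v = 1`, the rank-one map `l ⊗ v` has trace one. An element acting as this map on `V i`
  -- and as zero on the other factors isolates `c i`.
  obtain ⟨r, hr, hr'⟩ := exists_asAlgebraHom_eq ρ hirr hne i (dualTensorHom k (V i) (V i) (l ⊗ₜ v))
  have := h' r
  rw [Finset.sum_eq_single i (fun j _ hj => by rw [hr' j hj, map_zero, mul_zero]) (by simp), hr,
    LinearMap.trace_eq_contract_apply, contractLeft_apply, hl, mul_one] at this
  exact this

end Density

end CharTriple

end

noncomputable section

namespace CharTriple

open Module Representation

/-! ### Brauer characters with respect to a lift -/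

/-! ### Traces of `p`-power powers -/

section FrobeniusTrace

variable {k : Type} [Field k]

/-- With `q = p ^ a`, the identity `(X - M) ^ q = X ^ q - M ^ q` holds in characteristic `p`; taking
determinants compares the two sides after `X` is replaced by `X ^ q`. -/
theorem charpoly_pow_char_pow {n : Type} [Fintype n] [DecidableEq n] (p : ℕ) [Fact p.Prime]
    [CharP k p] (M : Matrix n n k) (a : ℕ) :
    (M ^ p ^ a).charpoly = M.charpoly.map (iterateFrobenius k p a) := by
  cases (isEmpty_or_nonempty n).symm
  · apply Polynomial.expand_injective (pow_pos (Nat.Prime.pos Fact.out) a : 0 < p ^ a)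
    rw [← Polynomial.map_expand, Polynomial.map_iterateFrobenius_expand]
    unfold Matrix.charpoly
    rw [AlgHom.map_det, ← Matrix.coe_detMonoidHom,
      ← (Matrix.detMonoidHom : Matrix n n (Polynomial k) →* Polynomial k).map_pow]
    apply congr_arg Matrix.det
    refine matPolyEquiv.injective ?_
    rw [map_pow, Matrix.matPolyEquiv_charmatrix, sub_pow_char_pow_of_commute, ← Polynomial.C_pow]
    · exact (id (matPolyEquiv_eq_X_pow_sub_C (p ^ a) M) :)
    · exact ((Polynomial.C M).commute_X)
  · simp [Matrix.charpoly]

theorem trace_pow_char_pow (p : ℕ) [Fact p.Prime] [CharP k p] {V : Type} [AddCommGroup V]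
    [Module k V] [FiniteDimensional k V] (f : End k V) (a : ℕ) :
    LinearMap.trace k V (f ^ p ^ a) = LinearMap.trace k V f ^ p ^ a := by
  let b := Module.finBasis k V
  rw [LinearMap.trace_eq_matrix_trace k b, LinearMap.trace_eq_matrix_trace k b,
    ← LinearMap.toMatrix_pow, Matrix.trace_eq_neg_charpoly_nextCoeff,
    Matrix.trace_eq_neg_charpoly_nextCoeff, charpoly_pow_char_pow,
    Polynomial.nextCoeff_map (RingHom.injective _), ← iterateFrobenius_def,
    map_neg]

/-- Some power of a group element is `p`-regular, and the trace of this power is a function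
of the trace. -/
theorem exists_pow_preg (p : ℕ) [CharP k p] {G : Type u} [Group G] [Finite G] (g : G) :
    ∃ (Q : ℕ) (F : k →+* k), ¬ p ∣ orderOf (g ^ Q) ∧
      ∀ (V : Type) [AddCommGroup V] [Module k V] [FiniteDimensional k V] (f : End k V),
        LinearMap.trace k V (f ^ Q) = F (LinearMap.trace k V f) := by
  rcases CharP.char_is_prime_or_zero k p with hp | rfl
  · have : Fact p.Prime := ⟨hp⟩
    obtain ⟨n, m, hm, hg⟩ := Nat.exists_eq_pow_mul_and_not_dvd (orderOf_pos g).ne' p hp.ne_one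
    refine ⟨p ^ n, iterateFrobenius k p n, ?_, fun V _ _ _ f => ?_⟩
    · rw [orderOf_pow_of_dvd (pow_ne_zero _ hp.ne_zero) ⟨m, hg⟩, hg,
        Nat.mul_div_cancel_left _ (pow_pos hp.pos n)]
      exact hm
    · rw [trace_pow_char_pow, iterateFrobenius_def]
  -- In characteristic zero every element is `0`-regular, as zero divides no positive order; no
  -- power is needed.
  · refine ⟨1, RingHom.id k, ?_, fun V _ _ _ f => by simp⟩
    rw [zero_dvd_iff]
    exact (orderOf_pos _).ne'

end FrobeniusTrace

/-! ### Lifting `p`-regular elements along surjections -/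

section PReg

variable {p : ℕ} {G : Type u} {H : Type v} {K : Type w} [Group G] [Group H] [Group K]

@[simp] theorem PReg.coe_map (f : G →* H) (g : PReg p G) : (PReg.map f g : H) = f g := rfl

/-- `1` as a `p`-regular element. -/
def PReg.one (hp : p ≠ 1) : PReg p G := ⟨1, by simpa using hp⟩

/-- Raising a preimage to the `p`-part of its order makes it `p`-regular. This power is coprime to
the order of the image, so a further power undoes its effect on the image. -/
theorem PReg.map_surjective [Finite G] (hp : p = 0 ∨ p.Prime) {f : G →* H}
    (hf : Function.Surjective f) : Function.Surjective (PReg.map (p := p) f) := by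
  rintro ⟨h, hh⟩
  obtain ⟨g, rfl⟩ := hf h
  rcases hp with rfl | hp
  · refine ⟨⟨g, ?_⟩, rfl⟩
    rw [zero_dvd_iff]
    exact (orderOf_pos _).ne'
  · obtain ⟨n, m, hm, hg⟩ := Nat.exists_eq_pow_mul_and_not_dvd (orderOf_pos g).ne' p hp.ne_one
    have hcop : Nat.Coprime (p ^ n) (orderOf (f g)) :=
      Nat.Coprime.pow_left _ ((Nat.Prime.coprime_iff_not_dvd hp).2 hh)
    obtain ⟨t, ht⟩ := exists_pow_eq_self_of_coprime hcop
    refine ⟨⟨(g ^ p ^ n) ^ t, fun hd => hm ?_⟩, Subtype.ext ?_⟩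
    · have : orderOf (g ^ p ^ n) = m := by
        rw [orderOf_pow_of_dvd (pow_ne_zero _ hp.ne_zero) ⟨m, hg⟩, hg,
          Nat.mul_div_cancel_left _ (pow_pos hp.pos n)]
      rw [← this]
      exact hd.trans (orderOf_pow_dvd t)
    · simpa using ht

end PReg

namespace CharLift

variable {k : Type} [Field k] (Λ : CharLift k) {G : Type u} [Group G] {p : ℕ}
  {V V' : Type} [AddCommGroup V'] [Module k V'] [FiniteDimensional k V']
  [AddCommGroup V] [Module k V] [FiniteDimensional k V]

/-- The Brauer character of a representation. -/
def brauer (p : ℕ) (ρ : Representation k G V) (g : PReg p G) : ℂ := (Λ.trLift (ρ g) : ℂ)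

theorem brauer_congr {ρ : Representation k G V} {ρ' : Representation k G V'} (e : ρ.Equiv ρ') :
    Λ.brauer p ρ = Λ.brauer p ρ' := by
  funext g
  rw [brauer, brauer, Λ.trLift_conj e.toLinearEquiv (ρ g) (ρ' g)]
  exact fun v => e.toIntertwiningMap.isIntertwining' g |> fun h => LinearMap.congr_fun h v

theorem cast_orderOf_ne_zero [CharP k p] (g : PReg p G) : (orderOf (g : G) : k) ≠ 0 := by
  rw [Ne, CharP.cast_eq_zero_iff k p]
  exact g.2

variable [IsAlgClosed k]

theorem brauer_eq_add (ρ : Representation k G V) (S : Submodule k V)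
    (hS : ∀ g, S ≤ S.comap (ρ g)) :
    Λ.brauer p ρ = Λ.brauer p (ρ.subrepresentation S hS) + Λ.brauer p (ρ.quotient S hS) := by
  funext g
  rw [Pi.add_apply, brauer, Λ.trLift_eq_add (ρ g) S (hS g)]
  rfl

theorem brauer_tprod [CharP k p] (ρ : Representation k G V) (ρ' : Representation k G V') :
    Λ.brauer p (ρ.tprod ρ') = Λ.brauer p ρ * Λ.brauer p ρ' := by
  funext g
  rw [Pi.mul_apply, brauer, Representation.tprod_apply, Λ.trLift_map _ _ (cast_orderOf_ne_zero g)
    (by rw [← map_pow, pow_orderOf_eq_one, map_one])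
    (by rw [← map_pow, pow_orderOf_eq_one, map_one])]
  rfl

theorem intCast_eq_zero_of_sum_brauer_eq_zero [CharP k p] [Finite G] {ι : Type} [Fintype ι]
    {V : ι → Type} [∀ i, AddCommGroup (V i)] [∀ i, Module k (V i)]
    [∀ i, FiniteDimensional k (V i)] (ρ : ∀ i, Representation k G (V i))
    (hirr : ∀ i, (ρ i).IsIrreducible) (hne : ∀ i j, i ≠ j → IsEmpty ((ρ i).Equiv (ρ j)))
    (c : ι → ℤ) (h : ∑ i, c i • Λ.brauer p (ρ i) = 0) (i : ι) : (c i : k) = 0 := by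
  refine eq_zero_of_sum_trace_eq_zero ρ hirr hne (fun i => (c i : k)) (fun g => ?_) i
  -- The relation is known at `p`-regular elements only. The trace at `g ^ Q` is the image under `F`
  -- of the trace at `g`, and `F` is injective and fixes integers, so the relation between traces
  -- holds at every `g`.
  obtain ⟨Q, F, hQ, hF⟩ := exists_pow_preg (k := k) p g
  apply F.injective
  have h1 : ∑ i, c i • Λ.trLift (ρ i (g ^ Q)) = 0 := by
    apply Subtype.val_injective
    have := congrFun h ⟨g ^ Q, hQ⟩
    simpa [brauer] using this
  have h2 := congrArg Λ.red h1
  simp only [map_sum, map_zsmul, red_trLift, map_zero, map_pow, hF] at h2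
  simpa using h2

/-- The Brauer characters of pairwise non-isomorphic irreducible representations are linearly
independent over `ℤ`. -/
theorem eq_zero_of_sum_brauer_eq_zero [CharP k p] [Finite G] {ι : Type} [Fintype ι]
    {V : ι → Type} [∀ i, AddCommGroup (V i)] [∀ i, Module k (V i)]
    [∀ i, FiniteDimensional k (V i)] (ρ : ∀ i, Representation k G (V i))
    (hirr : ∀ i, (ρ i).IsIrreducible) (hne : ∀ i j, i ≠ j → IsEmpty ((ρ i).Equiv (ρ j)))
    (c : ι → ℤ) (h : ∑ i, c i • Λ.brauer p (ρ i) = 0) (i : ι) : c i = 0 := by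
  have hdvd : ∀ c : ι → ℤ, ∑ i, c i • Λ.brauer p (ρ i) = 0 → ∀ i, (p : ℤ) ∣ c i :=
    fun c h i => (CharP.intCast_eq_zero_iff k p _).1
      (Λ.intCast_eq_zero_of_sum_brauer_eq_zero ρ hirr hne c h i)
  rcases CharP.char_is_prime_or_zero k p with hp | rfl
  -- Reduction shows only that `p` divides every coefficient. The relation divided by `p` is again a
  -- relation, so by repetition every power of `p` divides every coefficient.
  · have key : ∀ n : ℕ, ∀ c : ι → ℤ, ∑ i, c i • Λ.brauer p (ρ i) = 0 →
        ∀ i, (p : ℤ) ^ n ∣ c i := by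
      intro n
      induction n with
      | zero => simp
      | succ n ih =>
        intro c hc i
        choose d hd using hdvd c hc
        have : ∑ i, d i • Λ.brauer p (ρ i) = 0 := by
          have h1 : (p : ℤ) • ∑ i, d i • Λ.brauer p (ρ i) = 0 := by
            rw [Finset.smul_sum, ← hc]
            exact Finset.sum_congr rfl fun i _ => by rw [hd i, smul_smul]
          exact (smul_eq_zero.1 h1).resolve_left (by exact_mod_cast hp.ne_zero)
        rw [hd i, pow_succ']
        exact mul_dvd_mul_left _ (ih d this i)
    by_contra hci
    have hfin : FiniteMultiplicity (p : ℤ) (c i) :=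
      Int.finiteMultiplicity_iff.2 ⟨by simpa using hp.ne_one, hci⟩
    obtain ⟨n, hn⟩ := hfin
    exact hn (key (n + 1) c h i)
  · simpa using hdvd c h i

end CharLift

end CharTriple

end

noncomputable section

namespace CharTriple

open Module Representation

/-! ### Decomposition into irreducible Brauer characters -/

section Representations

variable {k : Type} [Field k] {G : Type u} [Group G] {V V' : Type} [AddCommGroup V] [Module k V]
  [AddCommGroup V'] [Module k V']

theorem isIrreducible_iff (ρ : Representation k G V) :
    ρ.IsIrreducible ↔ Nontrivial V ∧
      ∀ S : Submodule k V, (∀ g, ∀ v ∈ S, ρ g v ∈ S) → S = ⊥ ∨ S = ⊤ := by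
  constructor
  · intro h
    refine ⟨nontrivial_of_isIrreducible h, fun S hS => ?_⟩
    rcases h.eq_bot_or_eq_top ⟨S, fun g v hv => hS g v hv⟩ with h' | h'
    · exact Or.inl (congrArg Subrepresentation.toSubmodule h')
    · exact Or.inr (congrArg Subrepresentation.toSubmodule h')
  · rintro ⟨hnt, h⟩
    have : Nontrivial (Subrepresentation ρ) := by
      refine ⟨⊥, ⊤, fun he => ?_⟩
      exact bot_ne_top (α := Submodule k V) (congrArg Subrepresentation.toSubmodule he)
    refine ⟨fun S => ?_⟩
    rcases h S.toSubmodule fun g v hv => S.apply_mem_toSubmodule g hv with h' | h'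
    · exact Or.inl (Subrepresentation.toSubmodule_injective h')
    · exact Or.inr (Subrepresentation.toSubmodule_injective h')

theorem isIrreducible_of_equiv {ρ : Representation k G V} {ρ' : Representation k G V'}
    (e : ρ.Equiv ρ') (h : ρ.IsIrreducible) : ρ'.IsIrreducible := by
  rw [isIrreducible_iff] at h ⊢
  obtain ⟨hnt, h⟩ := h
  refine ⟨e.toLinearEquiv.symm.toEquiv.nontrivial, fun S hS => ?_⟩
  have hcomap : S = (S.comap e.toLinearEquiv.toLinearMap).map e.toLinearEquiv.toLinearMap :=
    (Submodule.map_comap_eq_of_surjective e.toLinearEquiv.surjective S).symm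
  rcases h (S.comap e.toLinearEquiv.toLinearMap) fun g v hv => by
    rw [Submodule.mem_comap] at hv ⊢
    have := LinearMap.congr_fun (e.toIntertwiningMap.isIntertwining' g) v
    have h2 : e.toLinearEquiv.toLinearMap (ρ g v) = ρ' g (e.toLinearEquiv.toLinearMap v) := this
    rw [h2]
    exact hS g _ hv with h' | h'
  · left; rw [hcomap, h', Submodule.map_bot]
  · right; rw [hcomap, h', Submodule.map_top, LinearMap.range_eq_top]
    exact e.toLinearEquiv.surjective

/-- Transport of a representation along a linear equivalence. -/
def conjRep (ρ : Representation k G V) (e : V ≃ₗ[k] V') : Representation k G V' :=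
  MonoidHom.comp e.conjRingEquiv.toMonoidHom ρ

/-- The transported representation is equivalent to the original one. -/
def conjRepEquiv (ρ : Representation k G V) (e : V ≃ₗ[k] V') : ρ.Equiv (conjRep ρ e) :=
  Representation.Equiv.mk e fun g => by
    ext v
    simp [conjRep, LinearEquiv.conjRingEquiv]

theorem exists_irreducible_subrepresentation [FiniteDimensional k V] [Nontrivial V]
    (ρ : Representation k G V) :
    ∃ (S : Submodule k V) (hS : ∀ g, S ≤ S.comap (ρ g)),
      (ρ.subrepresentation S hS).IsIrreducible := by
  let P : Submodule k V → Prop := fun S => S ≠ ⊥ ∧ ∀ g, S ≤ S.comap (ρ g)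
  obtain ⟨S, hS, hmin⟩ := WellFounded.has_min (α := Submodule k V) wellFounded_lt {S | P S}
    ⟨⊤, top_ne_bot, fun g => le_top⟩
  refine ⟨S, hS.2, (isIrreducible_iff _).2
    ⟨Submodule.nontrivial_iff_ne_bot.2 hS.1, fun T hT => ?_⟩⟩
  by_contra! hne
  refine hmin (T.map S.subtype) ⟨fun h => hne.1 ?_, ?_⟩ (lt_of_le_of_ne ?_ fun h => hne.2 ?_)
  · exact Submodule.map_injective_of_injective S.injective_subtype (by rw [h, Submodule.map_bot])
  · rintro g _ ⟨v, hv, rfl⟩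
    exact ⟨_, hT g v hv, rfl⟩
  · exact Submodule.map_subtype_le S T
  · exact Submodule.map_injective_of_injective S.injective_subtype
      (by rw [h, Submodule.map_subtype_top])

end Representations

namespace CharLift

variable {k : Type} [Field k] (Λ : CharLift k) (p : ℕ) {G : Type u} [Group G]
  {V V' : Type} [AddCommGroup V'] [Module k V'] [FiniteDimensional k V']
  [AddCommGroup V] [Module k V] [FiniteDimensional k V]

/-- `φ` is a Brauer character. -/
def IsBrauer (φ : PReg p G → ℂ) : Prop :=
  ∃ (n : ℕ) (ρ : Representation k G (Fin n → k)), 0 < n ∧ φ = Λ.brauer p ρ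

/-- `φ` is an irreducible Brauer character. -/
def IsIrrBrauer (φ : PReg p G → ℂ) : Prop :=
  ∃ (n : ℕ) (ρ : Representation k G (Fin n → k)), ρ.IsIrreducible ∧ φ = Λ.brauer p ρ

variable {p}

theorem brauer_apply_one {g : PReg p G} (hg : (g : G) = 1) (ρ : Representation k G V) :
    Λ.brauer p ρ g = finrank k V := by
  rw [brauer, hg, map_one, trLift_one]
  simp

theorem isBrauer_brauer [Nontrivial V] (ρ : Representation k G V) :
    Λ.IsBrauer p (Λ.brauer p ρ) :=
  ⟨finrank k V, conjRep ρ (finBasis k V).equivFun, finrank_pos,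
    Λ.brauer_congr (conjRepEquiv ρ _)⟩

theorem isIrrBrauer_brauer {ρ : Representation k G V} (h : ρ.IsIrreducible) :
    Λ.IsIrrBrauer p (Λ.brauer p ρ) :=
  ⟨finrank k V, conjRep ρ (finBasis k V).equivFun, isIrreducible_of_equiv (conjRepEquiv ρ _) h,
    Λ.brauer_congr (conjRepEquiv ρ _)⟩

theorem IsIrrBrauer.isBrauer {Λ : CharLift k} {φ : PReg p G → ℂ} (h : Λ.IsIrrBrauer p φ) :
    Λ.IsBrauer p φ := by
  obtain ⟨n, ρ, hρ, rfl⟩ := h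
  have := nontrivial_of_isIrreducible hρ
  exact Λ.isBrauer_brauer ρ

theorem IsBrauer.comp {Λ : CharLift k} {H : Type v} [Group H] {φ : PReg p G → ℂ}
    (h : Λ.IsBrauer p φ) (f : H →* G) : Λ.IsBrauer p (φ ∘ PReg.map f) := by
  obtain ⟨n, ρ, hn, rfl⟩ := h
  exact ⟨n, ρ.comp f, hn, rfl⟩

theorem IsBrauer.add {Λ : CharLift k} [IsAlgClosed k] {φ ψ : PReg p G → ℂ}
    (h : Λ.IsBrauer p φ) (h' : Λ.IsBrauer p ψ) : Λ.IsBrauer p (φ + ψ) := by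
  obtain ⟨n, ρ, hn, rfl⟩ := h
  obtain ⟨m, ρ', hm, rfl⟩ := h'
  have := Fin.pos_iff_nonempty.1 hn
  have := Fin.pos_iff_nonempty.1 hm
  convert Λ.isBrauer_brauer (p := p) (ρ.prod ρ') using 1
  funext g
  rw [Pi.add_apply, brauer, brauer, brauer, trLift, trLift, trLift]
  have : (ρ.prod ρ') (g : G) = (ρ g).prodMap (ρ' g) := rfl
  rw [this, LinearMap.charpoly_prodMap, Polynomial.roots_mul, Multiset.map_add, Multiset.sum_add]
  · rfl
  · exact mul_ne_zero (LinearMap.charpoly_monic _).ne_zero (LinearMap.charpoly_monic _).ne_zero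

theorem IsBrauer.mul {Λ : CharLift k} [IsAlgClosed k] [CharP k p] {φ ψ : PReg p G → ℂ}
    (h : Λ.IsBrauer p φ) (h' : Λ.IsBrauer p ψ) : Λ.IsBrauer p (φ * ψ) := by
  obtain ⟨n, ρ, hn, rfl⟩ := h
  obtain ⟨m, ρ', hm, rfl⟩ := h'
  have := Fin.pos_iff_nonempty.1 hn
  have := Fin.pos_iff_nonempty.1 hm
  rw [← brauer_tprod]
  exact Λ.isBrauer_brauer (p := p) (ρ.tprod ρ')

theorem IsBrauer.multiset_sum {Λ : CharLift k} [IsAlgClosed k] (s : Multiset (PReg p G → ℂ))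
    (hs : s ≠ 0) (h : ∀ φ ∈ s, Λ.IsBrauer p φ) : Λ.IsBrauer p s.sum := by
  induction s using Multiset.induction_on with
  | empty => exact absurd rfl hs
  | cons a s ih =>
    rw [Multiset.sum_cons]
    rcases eq_or_ne s 0 with rfl | hs'
    · simpa using h a (by simp)
    · exact (h a (by simp)).add (ih hs' fun φ hφ => h φ (Multiset.mem_cons_of_mem hφ))

section

variable [IsAlgClosed k]

theorem exists_multiset_aux (d : ℕ) : ∀ (V : Type) [AddCommGroup V] [Module k V]
    [FiniteDimensional k V] (ρ : Representation k G V), finrank k V ≤ d →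
    ∃ s : Multiset (PReg p G → ℂ), (∀ φ ∈ s, Λ.IsIrrBrauer p φ) ∧ s.sum = Λ.brauer p ρ := by
  induction d with
  | zero =>
    intro V _ _ _ ρ hd
    refine ⟨0, by simp, ?_⟩
    funext g
    have : Subsingleton V := finrank_zero_iff.1 (Nat.le_zero.1 hd)
    rw [brauer, Λ.trLift_of_eigenbasis _ (finBasis k V) (fun _ => 0)
      (fun i => Subsingleton.elim _ _)]
    have : IsEmpty (Fin (finrank k V)) := by rw [Nat.le_zero.1 hd]; infer_instance
    simp
  | succ d ih =>
    intro V _ _ _ ρ hd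
    rcases subsingleton_or_nontrivial V with hV | hV
    · exact ih V ρ (by rw [finrank_zero_of_subsingleton]; exact Nat.zero_le _)
    · obtain ⟨S, hS, hirr⟩ := exists_irreducible_subrepresentation ρ
      have : Nontrivial S := nontrivial_of_isIrreducible hirr
      have h1 := S.finrank_quotient_add_finrank
      have h2 : 0 < finrank k S := finrank_pos
      obtain ⟨s, hs, hsum⟩ := ih (V ⧸ S) (ρ.quotient S hS) (by omega)
      refine ⟨Λ.brauer p (ρ.subrepresentation S hS) ::ₘ s, ?_, ?_⟩
      · intro φ hφ
        rcases Multiset.mem_cons.1 hφ with rfl | hφ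
        · exact Λ.isIrrBrauer_brauer hirr
        · exact hs φ hφ
      · rw [Multiset.sum_cons, hsum, ← Λ.brauer_eq_add]

theorem exists_multiset (ρ : Representation k G V) :
    ∃ s : Multiset (PReg p G → ℂ), (∀ φ ∈ s, Λ.IsIrrBrauer p φ) ∧ s.sum = Λ.brauer p ρ :=
  Λ.exists_multiset_aux _ V ρ le_rfl

theorem IsBrauer.exists_multiset {Λ : CharLift k} {φ : PReg p G → ℂ} (hp : p ≠ 1)
    (h : Λ.IsBrauer p φ) :
    ∃ s : Multiset (PReg p G → ℂ), (∀ φ ∈ s, Λ.IsIrrBrauer p φ) ∧ s.sum = φ ∧ s ≠ 0 := by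
  obtain ⟨n, ρ, hn, rfl⟩ := h
  obtain ⟨s, hs, hsum⟩ := Λ.exists_multiset (p := p) ρ
  refine ⟨s, hs, hsum, ?_⟩
  -- The value at `1` is the degree, which is positive, so the decomposition is not empty.
  rintro rfl
  have := congrFun hsum (PReg.one hp)
  rw [Λ.brauer_apply_one rfl] at this
  rw [finrank_fin_fun] at this
  exact hn.ne (by exact_mod_cast (show (0 : ℂ) = n from this))

variable [CharP k p] [Finite G]

/-- Distinct irreducible Brauer characters are linearly independent over `ℤ`. -/
theorem IsIrrBrauer.multiset_eq {Λ : CharLift k} {s t : Multiset (PReg p G → ℂ)}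
    (hs : ∀ φ ∈ s, Λ.IsIrrBrauer p φ) (ht : ∀ φ ∈ t, Λ.IsIrrBrauer p φ) (h : s.sum = t.sum) :
    s = t := by
  classical
  let F := (s + t).toFinset
  have hF : ∀ φ : F, Λ.IsIrrBrauer p φ.1 := fun φ => by
    rcases Multiset.mem_add.1 (Multiset.mem_toFinset.1 φ.2) with h | h
    · exact hs _ h
    · exact ht _ h
  -- The independence result is indexed by a type in `Type`, while `F` lies in the universe of `G`;
  -- hence the passage to `Fin`.
  let e := F.equivFin
  choose n ρ hρ hφ using hF
  have hsum : ∀ r : Multiset (PReg p G → ℂ), r ⊆ s + t →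
      r.sum = ∑ φ ∈ F, r.count φ • φ := fun r hr => by
    rw [Finset.sum_multiset_count_of_subset r F]
    intro x hx
    exact Multiset.mem_toFinset.2 (hr (Multiset.mem_toFinset.1 hx))
  have hzero : ∑ i, ((s.count (e.symm i).1 : ℤ) - t.count (e.symm i).1) •
      Λ.brauer p (ρ (e.symm i)) = 0 := by
    have h1 : ∑ φ : F, ((s.count φ.1 : ℤ) - t.count φ.1) • φ.1 = 0 := by
      rw [Finset.sum_coe_sort F fun φ => ((s.count φ : ℤ) - t.count φ) • φ]
      simp only [sub_smul, Finset.sum_sub_distrib, natCast_zsmul]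
      rw [← hsum s (Multiset.subset_of_le (Multiset.le_add_right _ _)),
        ← hsum t (Multiset.subset_of_le (Multiset.le_add_left _ _)), h, sub_self]
    rw [← h1, ← Equiv.sum_comp e.symm]
    exact Finset.sum_congr rfl fun i _ => by rw [← hφ]
  have key := Λ.eq_zero_of_sum_brauer_eq_zero (fun i => ρ (e.symm i)) (fun i => hρ _)
    (fun i j hij => ⟨fun f => hij ?_⟩) _ hzero
  · ext φ
    by_cases hmem : φ ∈ s + t
    · have := key (e ⟨φ, Multiset.mem_toFinset.2 hmem⟩)
      simp only [Equiv.symm_apply_apply] at this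
      omega
    · rw [Multiset.mem_add, not_or] at hmem
      rw [Multiset.count_eq_zero_of_notMem hmem.1, Multiset.count_eq_zero_of_notMem hmem.2]
  · apply e.symm.injective
    apply Subtype.ext
    rw [hφ, hφ]
    exact Λ.brauer_congr f

/-- If the representations were not isomorphic, the difference of their equal characters would be a
relation with coefficients `1` and `-1`. -/
theorem nonempty_equiv_of_brauer_eq {ρ : Representation k G V}
    {ρ' : Representation k G V'} (hρ : ρ.IsIrreducible) (hρ' : ρ'.IsIrreducible)
    (h : Λ.brauer p ρ = Λ.brauer p ρ') : Nonempty (ρ.Equiv ρ') := by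
  by_contra hne
  let e := (finBasis k V).equivFun
  let e' := (finBasis k V').equivFun
  let n : Bool → ℕ := fun b => cond b (finrank k V) (finrank k V')
  let r : ∀ b, Representation k G (Fin (n b) → k) := fun b =>
    match b with
    | true => conjRep ρ e
    | false => conjRep ρ' e'
  have key := Λ.eq_zero_of_sum_brauer_eq_zero (p := p) r ?_ ?_ (fun b => cond b 1 (-1)) ?_ true
  · simp at key
  · rintro (_ | _)
    · exact isIrreducible_of_equiv (conjRepEquiv ρ' e') hρ'
    · exact isIrreducible_of_equiv (conjRepEquiv ρ e) hρ
  · rintro (_ | _) (_ | _) hb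
    · exact absurd rfl hb
    · exact ⟨fun f => hne ⟨((conjRepEquiv ρ e).trans f.symm).trans (conjRepEquiv ρ' e').symm⟩⟩
    · exact ⟨fun f => hne ⟨((conjRepEquiv ρ e).trans f).trans (conjRepEquiv ρ' e').symm⟩⟩
    · exact absurd rfl hb
  · rw [Fintype.sum_bool]
    have h1 : Λ.brauer p (r true) = Λ.brauer p ρ := (Λ.brauer_congr (conjRepEquiv ρ e)).symm
    have h2 : Λ.brauer p (r false) = Λ.brauer p ρ' := (Λ.brauer_congr (conjRepEquiv ρ' e')).symm
    rw [h1, h2, h]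
    simp

end

end CharLift

end CharTriple

end

noncomputable section

namespace CharTriple

open Module Representation

open scoped TensorProduct

/-! ### Tensor products with an irreducible representation -/

section Slice

variable {k : Type} [Field k] {X Y Y' : Type} [AddCommGroup X] [Module k X]
  [AddCommGroup Y'] [Module k Y'] [AddCommGroup Y] [Module k Y]

/-- The contraction `x ⊗ y ↦ l x • y`. -/
def slice (Y : Type) [AddCommGroup Y] [Module k Y] (l : Dual k X) : X ⊗[k] Y →ₗ[k] Y :=
  (TensorProduct.lid k Y).toLinearMap ∘ₗ l.rTensor Y

@[simp] theorem slice_tmul (l : Dual k X) (x : X) (y : Y) : slice Y l (x ⊗ₜ y) = l x • y := by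
  simp [slice]

theorem rTensor_smulRight (l : Dual k X) (x : X) (s : X ⊗[k] Y) :
    (l.smulRight x).rTensor Y s = x ⊗ₜ slice Y l s := by
  induction s using TensorProduct.induction_on with
  | zero => simp
  | tmul x' y => simp [TensorProduct.smul_tmul]
  | add s t hs ht => rw [map_add, hs, ht, map_add, TensorProduct.tmul_add]

theorem slice_map (l : Dual k X) (f : Y →ₗ[k] Y') (s : X ⊗[k] Y) :
    slice Y' l (f.lTensor X s) = f (slice Y l s) := by
  induction s using TensorProduct.induction_on with
  | zero => simp
  | tmul x' y => simp
  | add s t hs ht => rw [map_add, map_add, hs, ht, map_add, map_add]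

theorem eq_zero_of_slice_eq_zero [FiniteDimensional k X] {s : X ⊗[k] Y}
    (h : ∀ l, slice Y l s = 0) : s = 0 := by
  have key : ∀ s : X ⊗[k] Y,
      s = ∑ i, (finBasis k X i) ⊗ₜ slice Y ((finBasis k X).coord i) s := by
    intro s
    induction s using TensorProduct.induction_on with
    | zero => simp
    | tmul x y =>
      simp only [slice_tmul, ← TensorProduct.smul_tmul, ← TensorProduct.sum_tmul]
      congr 1
      exact ((finBasis k X).sum_repr x).symm
    | add s t hs ht =>
      conv_lhs => rw [hs, ht]
      simp only [map_add, TensorProduct.tmul_add, Finset.sum_add_distrib]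
  rw [key s]
  simp [h]

variable [IsAlgClosed k] [FiniteDimensional k X] {N : Type u} [Group N]

/-- A map that commutes with an irreducible representation on the first tensor factor commutes
with every endomorphism of that factor. -/
theorem rTensor_comm {ρ : Representation k N X} (hρ : ρ.IsIrreducible)
    (f : X ⊗[k] Y →ₗ[k] X ⊗[k] Y') (hf : ∀ n s, f ((ρ n).rTensor Y s) = (ρ n).rTensor Y' (f s))
    (T : End k X) (s : X ⊗[k] Y) : f (T.rTensor Y s) = T.rTensor Y' (f s) := by
  have hT : T ∈ Submodule.span k (Set.range ρ) := by rw [span_range_eq_top ρ hρ]; trivial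
  induction hT using Submodule.span_induction with
  | mem T h => obtain ⟨n, rfl⟩ := h; exact hf n s
  | zero => simp
  | add T T' _ _ h h' => simp only [LinearMap.rTensor_add, LinearMap.add_apply, map_add, h, h']
  | smul c T _ h => simp only [LinearMap.rTensor_smul, LinearMap.smul_apply, map_smul, h]

/-- By Burnside's theorem the rank-one map `l(·) x` is a combination of the operators `ρ n`, so it
preserves `S` when applied to the first factor. Hence `S` has the form `X ⊗ Y₀`. -/
theorem tmul_slice_mem {ρ : Representation k N X} (hρ : ρ.IsIrreducible)
    (S : Submodule k (X ⊗[k] Y)) (hS : ∀ n, ∀ s ∈ S, (ρ n).rTensor Y s ∈ S) (l : Dual k X) (x : X)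
    {s : X ⊗[k] Y} (hs : s ∈ S) : x ⊗ₜ slice Y l s ∈ S := by
  rw [← rTensor_smulRight]
  have hT : l.smulRight x ∈ Submodule.span k (Set.range ρ) := by
    rw [span_range_eq_top ρ hρ]; trivial
  generalize l.smulRight x = T at hT
  induction hT using Submodule.span_induction with
  | mem T h => obtain ⟨n, rfl⟩ := h; exact hS n s hs
  | zero => simp
  | add T T' _ _ h h' =>
    rw [LinearMap.rTensor_add, LinearMap.add_apply]; exact S.add_mem h h'
  | smul c T _ h =>
    rw [LinearMap.rTensor_smul, LinearMap.smul_apply]; exact S.smul_mem _ h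

end Slice

/-! ### Irreducibility and cancellation for `W ⊗ U` when `N` acts trivially on `U` -/

section TensorIrreducible

variable {k : Type} [Field k] {X Y Y' : Type} [AddCommGroup X] [Module k X]
  [AddCommGroup Y] [Module k Y] [AddCommGroup Y'] [Module k Y']
  {N : Type u} [Group N] {E : Type v} [Group E]
  {W : Representation k E X} {U : Representation k E Y} {U' : Representation k E Y'} {c : N →* E}

theorem tprod_apply_of_eq_one (hU : ∀ n, U (c n) = 1) (n : N) (s : X ⊗[k] Y) :
    (W.tprod U) (c n) s = (W (c n)).rTensor Y s := by
  rw [Representation.tprod_apply, hU]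
  rfl

/-- An invariant subspace `S` of `Y` gives the invariant subspace `X ⊗ S`, and contraction with a
functional `l` such that `l w = 1` recovers `S` from it. -/
theorem isIrreducible_of_tprod (hX : Nontrivial X) (h : (W.tprod U).IsIrreducible) :
    U.IsIrreducible := by
  rw [isIrreducible_iff] at h ⊢
  obtain ⟨w, hw⟩ := exists_ne (0 : X)
  obtain ⟨l, hl⟩ := Projective.exists_dual_eq_one k hw
  refine ⟨?_, fun S hS => ?_⟩
  · by_contra hY
    rw [not_nontrivial_iff_subsingleton] at hY
    obtain ⟨s, hs⟩ := @exists_ne _ h.1 (0 : X ⊗[k] Y)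
    have hzero : ∀ s : X ⊗[k] Y, s = 0 := fun s => by
      induction s using TensorProduct.induction_on with
      | zero => rfl
      | tmul x y => rw [Subsingleton.elim y 0, TensorProduct.tmul_zero]
      | add s t hs ht => rw [hs, ht, add_zero]
    exact hs (hzero s)
  · have hinv : ∀ g, ∀ v ∈ LinearMap.range (S.subtype.lTensor X),
        (W.tprod U) g v ∈ LinearMap.range (S.subtype.lTensor X) := by
      rintro g _ ⟨t, rfl⟩
      induction t using TensorProduct.induction_on with
      | zero => simp
      | tmul x y => exact ⟨W g x ⊗ₜ ⟨U g y, hS g _ y.2⟩, by simp⟩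
      | add s t hs ht => rw [map_add, map_add]; exact Submodule.add_mem _ hs ht
    rcases h.2 (LinearMap.range (S.subtype.lTensor X)) hinv with h' | h'
    · left
      refine (Submodule.eq_bot_iff _).2 fun y hy => ?_
      have : w ⊗ₜ y ∈ LinearMap.range (S.subtype.lTensor X) := ⟨w ⊗ₜ ⟨y, hy⟩, by simp⟩
      rw [h', Submodule.mem_bot] at this
      simpa [hl] using congrArg (slice Y l) this
    · right
      refine Submodule.eq_top_iff'.2 fun y => ?_
      have : w ⊗ₜ y ∈ LinearMap.range (S.subtype.lTensor X) := by rw [h']; trivial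
      obtain ⟨t, ht⟩ := this
      have h2 := congrArg (slice Y l) ht
      rw [slice_map, slice_tmul, hl, one_smul] at h2
      rw [← h2]
      exact (slice S l t).2

variable [IsAlgClosed k] [FiniteDimensional k X]

/-- An invariant subspace is `X ⊗ Y₀` because `N` moves only the first factor; here `Y₀` is cut out
by a fixed vector `w`, and it is invariant under `U`. -/
theorem isIrreducible_tprod
    (hW : Representation.IsIrreducible (W.comp c)) (hU : ∀ n, U (c n) = 1)
    (h : U.IsIrreducible) : (W.tprod U).IsIrreducible := by
  have hX := nontrivial_of_isIrreducible hW
  have hY := nontrivial_of_isIrreducible h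
  obtain ⟨w, hw⟩ := exists_ne (0 : X)
  obtain ⟨l, hl⟩ := Projective.exists_dual_eq_one k hw
  rw [isIrreducible_iff] at h ⊢
  refine ⟨?_, fun S hS => ?_⟩
  · obtain ⟨y, hy⟩ := exists_ne (0 : Y)
    refine ⟨w ⊗ₜ y, 0, fun h0 => hy ?_⟩
    simpa [hl] using congrArg (slice Y l) h0
  have hmem := fun (l : Dual k X) (x : X) (s : X ⊗[k] Y) (hs : s ∈ S) =>
    tmul_slice_mem hW S (fun n s hs => by
      have := hS (c n) s hs
      rwa [tprod_apply_of_eq_one hU] at this) l x hs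
  have hall : ∀ y, w ⊗ₜ y ∈ S → ∀ x : X, x ⊗ₜ y ∈ S := fun y hy x => by
    have := hmem l x _ hy
    rwa [slice_tmul, hl, one_smul] at this
  -- The first factor is taken to be `W g⁻¹ w`, which `g` carries back to `w`.
  have hinv : ∀ g, ∀ y ∈ S.comap (TensorProduct.mk k X Y w),
      U g y ∈ S.comap (TensorProduct.mk k X Y w) := fun g y hy => by
    have := hS g _ (hall y hy (W g⁻¹ w))
    rwa [Representation.tprod_apply, TensorProduct.map_tmul, Representation.self_inv_apply] at this
  rcases h.2 (S.comap (TensorProduct.mk k X Y w)) hinv with h' | h'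
  · left
    refine (Submodule.eq_bot_iff _).2 fun s hs => eq_zero_of_slice_eq_zero fun l' => ?_
    have : slice Y l' s ∈ S.comap (TensorProduct.mk k X Y w) := hmem l' w s hs
    rwa [h', Submodule.mem_bot] at this
  · right
    refine Submodule.eq_top_iff'.2 fun s => ?_
    induction s using TensorProduct.induction_on with
    | zero => exact S.zero_mem
    | tmul x y =>
      exact hall y (show y ∈ S.comap (TensorProduct.mk k X Y w) by rw [h']; trivial) x
    | add s t hs ht => exact S.add_mem hs ht

/-- An irreducible tensor product determines the second factor. -/
theorem nonempty_equiv_of_tprod_equiv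
    (hW : Representation.IsIrreducible (W.comp c)) (hU : ∀ n, U (c n) = 1)
    (hU' : ∀ n, U' (c n) = 1) (h : U.IsIrreducible) (h' : U'.IsIrreducible)
    (e : (W.tprod U).Equiv (W.tprod U')) : Nonempty (U.Equiv U') := by
  have hX := nontrivial_of_isIrreducible hW
  have hY := nontrivial_of_isIrreducible h
  obtain ⟨w, hw⟩ := exists_ne (0 : X)
  obtain ⟨l, hl⟩ := Projective.exists_dual_eq_one k hw
  let f : X ⊗[k] Y →ₗ[k] X ⊗[k] Y' := e.toLinearEquiv.toLinearMap
  have hf : ∀ g s, f ((W.tprod U) g s) = (W.tprod U') g (f s) := fun g s =>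
    LinearMap.congr_fun (e.toIntertwiningMap.isIntertwining' g) s
  have hcomm := rTensor_comm hW f fun n s => by
    have := hf (c n) s
    rwa [tprod_apply_of_eq_one hU, tprod_apply_of_eq_one hU'] at this
  let q : Y →ₗ[k] Y' := slice Y' l ∘ₗ f ∘ₗ TensorProduct.mk k X Y w
  -- The isomorphism commutes with all endomorphisms of `X`, so it is the identity of `X` tensored
  -- with a map `q`.
  have hq : ∀ x y, f (x ⊗ₜ y) = x ⊗ₜ q y := fun x y => by
    have := hcomm (l.smulRight x) (w ⊗ₜ y)
    rwa [rTensor_smulRight, rTensor_smulRight, slice_tmul, hl, one_smul] at this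
  have hqU : ∀ g y, q (U g y) = U' g (q y) := fun g y => by
    have h1 := hf g (W g⁻¹ w ⊗ₜ y)
    rw [Representation.tprod_apply, TensorProduct.map_tmul, Representation.self_inv_apply, hq, hq,
      Representation.tprod_apply, TensorProduct.map_tmul, Representation.self_inv_apply] at h1
    simpa [hl] using congrArg (slice Y' l) h1
  let F : U.IntertwiningMap U' := ⟨q, fun g => LinearMap.ext fun y => hqU g y⟩
  rcases IsIrreducible.bijective_or_eq_zero F with hb | h0
  · exact ⟨F.ofBijective hb⟩
  · exfalso
    obtain ⟨y, hy⟩ := exists_ne (0 : Y)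
    have hq0 : q y = 0 := congrArg (fun F : U.IntertwiningMap U' => F y) h0
    have h2 : f (w ⊗ₜ y) = 0 := by rw [hq, hq0, TensorProduct.tmul_zero]
    have h3 : w ⊗ₜ[k] y = 0 := e.toLinearEquiv.injective (h2.trans (map_zero f).symm)
    exact hy (by simpa [hl] using congrArg (slice Y l) h3)

end TensorIrreducible

end CharTriple

end

noncomputable section

namespace CharTriple

open Module Representation

open scoped TensorProduct

/-! ### Brauer characters over a fixed Brauer character -/

section Over

variable {k : Type} [Field k] {p : ℕ} {N H : Type*} [Group N] [Group H]

/-- The restriction of `φ` along `i` is a multiple of `θ`. -/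
def IsOver (i : N →* H) (θ : PReg p N → ℂ) (φ : PReg p H → ℂ) : Prop :=
  ∃ e : ℕ, ∀ n : PReg p N, φ (PReg.map i n) = e * θ n

theorem IsOver.add {i : N →* H} {θ : PReg p N → ℂ} {φ ψ : PReg p H → ℂ} (h : IsOver i θ φ)
    (h' : IsOver i θ ψ) : IsOver i θ (φ + ψ) := by
  obtain ⟨e, h⟩ := h
  obtain ⟨e', h'⟩ := h'
  exact ⟨e + e', fun n => by rw [Pi.add_apply, h, h']; push_cast; ring⟩

theorem IsOver.multiset_sum {i : N →* H} {θ : PReg p N → ℂ} (s : Multiset (PReg p H → ℂ))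
    (h : ∀ φ ∈ s, IsOver i θ φ) : IsOver i θ s.sum := by
  induction s using Multiset.induction_on with
  | empty => exact ⟨0, by simp⟩
  | cons a s ih =>
    rw [Multiset.sum_cons]
    exact (h a (by simp)).add (ih fun φ hφ => h φ (Multiset.mem_cons_of_mem hφ))

variable [IsAlgClosed k] [CharP k p] [Finite N] {Λ : CharLift k}

theorem ne_one_of_charP (k : Type) [Field k] (p : ℕ) [CharP k p] : p ≠ 1 := by
  rcases CharP.char_is_prime_or_zero k p with h | h
  · exact h.ne_one
  · rw [h]; exact zero_ne_one

theorem eq_replicate_of_sum_eq {θ : PReg p N → ℂ} (hθ : Λ.IsIrrBrauer p θ)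
    {s : Multiset (PReg p N → ℂ)} (hs : ∀ φ ∈ s, Λ.IsIrrBrauer p φ) {e : ℕ}
    (h : s.sum = e • θ) : ∀ φ ∈ s, φ = θ := by
  have : s = Multiset.replicate e θ := by
    refine CharLift.IsIrrBrauer.multiset_eq hs (fun φ hφ => ?_) ?_
    · rw [Multiset.eq_of_mem_replicate hφ]; exact hθ
    · rw [h, Multiset.sum_replicate]
  intro φ hφ
  rw [this] at hφ
  exact Multiset.eq_of_mem_replicate hφ

/-- The restriction of the sum decomposes into copies of `θ`. Such a decomposition is unique, so the
restriction of each summand decomposes into copies of `θ` too. -/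
theorem isOver_of_mem {i : N →* H} {θ : PReg p N → ℂ} (hθ : Λ.IsIrrBrauer p θ)
    {s : Multiset (PReg p H → ℂ)} (hs : ∀ φ ∈ s, Λ.IsIrrBrauer p φ) (h : IsOver i θ s.sum) :
    ∀ φ ∈ s, IsOver i θ φ := by
  have hp := ne_one_of_charP k p
  obtain ⟨e, he⟩ := h
  have hex : ∀ φ : PReg p H → ℂ, ∃ t : Multiset (PReg p N → ℂ), φ ∈ s →
      (∀ ψ ∈ t, Λ.IsIrrBrauer p ψ) ∧ t.sum = φ ∘ PReg.map i := fun φ => by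
    by_cases hφ : φ ∈ s
    · obtain ⟨t, ht, hsum, -⟩ := ((hs φ hφ).isBrauer.comp i).exists_multiset hp
      exact ⟨t, fun _ => ⟨ht, hsum⟩⟩
    · exact ⟨0, fun h => absurd h hφ⟩
  choose t ht using hex
  have hres : ∀ s' : Multiset (PReg p H → ℂ), s' ≤ s →
      (s'.bind t).sum = s'.sum ∘ PReg.map i := fun s' hs' => by
    rw [Multiset.sum_bind, Multiset.map_congr rfl
      fun φ hφ => (ht φ (Multiset.mem_of_le hs' hφ)).2]
    induction s' using Multiset.induction_on with
    | empty => rfl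
    | cons a s' ih =>
      rw [Multiset.map_cons, Multiset.sum_cons, Multiset.sum_cons,
        ih ((Multiset.le_cons_self _ _).trans hs')]
      rfl
  have hall := eq_replicate_of_sum_eq hθ (s := s.bind t) (e := e) (fun ψ hψ => by
      obtain ⟨φ, hφ, hψ⟩ := Multiset.mem_bind.1 hψ
      exact (ht φ hφ).1 ψ hψ) (by
      rw [hres s le_rfl]
      funext n
      simpa using he n)
  intro φ hφ
  refine ⟨Multiset.card (t φ), fun n => ?_⟩
  have h1 : t φ = Multiset.replicate (Multiset.card (t φ)) θ :=
    Multiset.eq_replicate.2 ⟨rfl, fun ψ hψ => hall ψ (Multiset.mem_bind.2 ⟨φ, hφ, hψ⟩)⟩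
  have h2 := congrFun (ht φ hφ).2 n
  rw [h1, Multiset.sum_replicate] at h2
  simpa using h2.symm

/-- Every representation whose Brauer character is a multiple of an irreducible one contains the
corresponding irreducible representation. -/
theorem exists_injective_intertwining {X V : Type} [AddCommGroup X] [Module k X]
    [FiniteDimensional k X] [AddCommGroup V] [Module k V] [FiniteDimensional k V] [Nontrivial V]
    {ρ : Representation k N X} (hρ : ρ.IsIrreducible) (σ : Representation k N V) {e : ℕ}
    (h : Λ.brauer p σ = e • Λ.brauer p ρ) :
    ∃ f : X →ₗ[k] V, Function.Injective f ∧ ∀ n x, f (ρ n x) = σ n (f x) := by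
  obtain ⟨S, hS, hirr⟩ := exists_irreducible_subrepresentation σ
  obtain ⟨t, ht, hsum⟩ := Λ.exists_multiset (p := p) (σ.quotient S hS)
  have := eq_replicate_of_sum_eq (Λ.isIrrBrauer_brauer (p := p) hρ)
    (s := Λ.brauer p (σ.subrepresentation S hS) ::ₘ t) (e := e) (fun φ hφ => by
      rcases Multiset.mem_cons.1 hφ with rfl | hφ
      · exact Λ.isIrrBrauer_brauer hirr
      · exact ht φ hφ) (by rw [Multiset.sum_cons, hsum, ← Λ.brauer_eq_add, h])
    _ (Multiset.mem_cons_self _ _)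
  -- An irreducible subrepresentation of `σ` contributes a constituent of a multiple of the
  -- character of `ρ`, so it has that character and is isomorphic to `ρ`.
  obtain ⟨E⟩ := Λ.nonempty_equiv_of_brauer_eq hρ hirr this.symm
  refine ⟨S.subtype ∘ₗ E.toLinearEquiv.toLinearMap,
    S.injective_subtype.comp E.toLinearEquiv.injective, fun n x => ?_⟩
  exact congrArg Subtype.val (LinearMap.congr_fun (E.toIntertwiningMap.isIntertwining' n) x)

end Over

/-! ### Representations of a quotient, and linear characters -/

section Descent

variable {k : Type} [Field k] {X : Type} [AddCommGroup X] [Module k X]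
  {E : Type v} {H : Type w} [Group E] [Group H]

theorem exists_descent {f : E →* H} (hf : Function.Surjective f) (ρ : Representation k E X)
    (h : ∀ x, f x = 1 → ρ x = 1) : ∃ ρ' : Representation k H X, ρ'.comp f = ρ := by
  have key : ∀ x y, f x = f y → ρ x = ρ y := fun x y hxy => by
    have h1 := h (x * y⁻¹) (by rw [map_mul, map_inv, hxy, mul_inv_cancel])
    rw [← inv_mul_cancel_right x y, map_mul, h1, one_mul]
  refine ⟨⟨⟨fun x => ρ (Function.surjInv hf x), ?_⟩, fun x y => ?_⟩, MonoidHom.ext fun x => ?_⟩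
  · exact h _ (Function.surjInv_eq hf 1)
  · rw [← map_mul]
    apply key
    rw [map_mul, Function.surjInv_eq hf, Function.surjInv_eq hf, Function.surjInv_eq hf]
  · exact key _ _ (Function.surjInv_eq hf _)

theorem isIrreducible_comp_iff {f : E →* H} (hf : Function.Surjective f)
    (ρ : Representation k H X) :
    Representation.IsIrreducible (ρ.comp f) ↔ ρ.IsIrreducible := by
  rw [isIrreducible_iff, isIrreducible_iff]
  refine and_congr_right fun _ => forall_congr' fun S => ?_
  refine imp_congr_left ⟨fun h g v hv => ?_, fun h x v hv => h (f x) v hv⟩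
  obtain ⟨x, rfl⟩ := hf g
  exact h x v hv

/-- The one-dimensional representation afforded by a linear character. -/
def scalarRep (lam : H →* k) : Representation k H k :=
  (algebraMap k (End k k) : k →* End k k).comp lam

theorem scalarRep_apply (lam : H →* k) (h : H) (c : k) : scalarRep lam h c = lam h * c := rfl

theorem isIrreducible_scalarRep (lam : H →* k) : (scalarRep lam).IsIrreducible := by
  rw [isIrreducible_iff]
  exact ⟨inferInstance, fun S _ => eq_bot_or_eq_top S⟩

end Descent

/-! ### The correspondence of characters -/

/-- Two groups `H` and `H'` that are quotients of a group `E` by a normal subgroup of scalars and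
by a normal subgroup `N`, with respect to a representation `W` of `E` that is irreducible
on `N`. -/
structure Bridge (k : Type) [Field k] (N : Type*) (N' : Type*) (H : Type*) (H' : Type*)
    (E : Type*) [Group N] [Group N'] [Group H] [Group H'] [Group E]
    (X : Type) [AddCommGroup X] [Module k X] where
  i : N →* H
  i' : N' →* H'
  a : E →* H
  b : E →* H'
  c : N →* E
  W : Representation k E X
  lam : N' →* k
  a_surj : Function.Surjective a
  b_surj : Function.Surjective b
  a_c : ∀ n, a (c n) = i n
  b_c : ∀ n, b (c n) = 1
  ker_b : ∀ x, b x = 1 → ∃ n, c n = x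
  irr : Representation.IsIrreducible (MonoidHom.comp W c)
  central : ∀ z h, i' z * h = h * i' z
  -- The inverse makes scalars cancel: where `W` acts by `lam z⁻¹`, a representation of `H'` over
  -- `θ'` acts by `lam z`, so `W ⊗ U` is trivial on the kernel of `a`.
  ker_a : ∀ x, a x = 1 → ∃ z, b x = i' z ∧ W x = lam z⁻¹ • (1 : End k X)
  scalar : ∀ z, ∃ x, a x = 1 ∧ b x = i' z ∧ W x = lam z⁻¹ • (1 : End k X)

namespace Bridge

variable {k : Type} [Field k] {N N' H H' E : Type*}
  [Group N] [Group N'] [Group H] [Group H'] [Group E] {X : Type} [AddCommGroup X] [Module k X]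
  (B : Bridge k N N' H H' E X) (Λ : CharLift k) {p : ℕ}

theorem lam_mul_lam_inv (z : N') : B.lam z * B.lam z⁻¹ = 1 := by
  rw [← map_mul, mul_inv_cancel, map_one]

variable (p) in
/-- The linear Brauer character of the central subgroup `N'`. -/
def theta' : PReg p N' → ℂ := Λ.brauer p (scalarRep B.lam)

variable (p) in
theorem isIrrBrauer_theta' : Λ.IsIrrBrauer p (B.theta' Λ p) :=
  Λ.isIrrBrauer_brauer (isIrreducible_scalarRep _)

variable {Λ B} in
/-- The central subgroup `N'` acts by scalars on an irreducible representation over `θ'`. -/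
theorem apply_central [IsAlgClosed k] [CharP k p] [Finite N'] {V : Type} [AddCommGroup V]
    [Module k V] [FiniteDimensional k V]
    {U : Representation k H' V} (hU : U.IsIrreducible)
    (h : IsOver B.i' (B.theta' Λ p) (Λ.brauer p U)) (z : N') :
    U (B.i' z) = B.lam z • (1 : End k V) := by
  have := nontrivial_of_isIrreducible hU
  obtain ⟨e, he⟩ := h
  -- By Schur's lemma the central element acts as some scalar; an eigenvector of `N'` with
  -- eigencharacter `lam` tells which one.
  obtain ⟨f, hf, hfU⟩ := exists_injective_intertwining (p := p) (Λ := Λ)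
    (isIrreducible_scalarRep B.lam) (MonoidHom.comp U B.i') (e := e)
    (by funext n; rw [Pi.smul_apply, nsmul_eq_mul]; exact he n)
  let F : U.IntertwiningMap U := ⟨U (B.i' z), fun g => by
    rw [← Module.End.mul_eq_comp, ← Module.End.mul_eq_comp, ← map_mul, ← map_mul, B.central]⟩
  obtain ⟨s, hs⟩ := (IsIrreducible.algebraMap_intertwiningMap_bijective_of_isAlgClosed
    (ρ := U)).2 F
  have hs' : ∀ v, U (B.i' z) v = s • v := fun v =>
    (congrArg (fun F : U.IntertwiningMap U => F v) hs).symm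
  have h1 := hfU z 1
  rw [scalarRep_apply, MonoidHom.comp_apply, hs', ← smul_eq_mul, map_smul] at h1
  have hf1 : f 1 ≠ 0 := fun h0 => one_ne_zero (hf (h0.trans (map_zero f).symm))
  have h2 : B.lam z = s := smul_left_injective k hf1 h1
  ext v
  rw [hs', h2]
  rfl

variable [FiniteDimensional k X]

/-- `u` corresponds to `χ`: the inflation of `χ` is the product of the inflation of `u` with the
Brauer character of `W`. -/
def Rel (u : PReg p H' → ℂ) (χ : PReg p H → ℂ) : Prop :=
  ∀ x : PReg p E, χ (PReg.map B.a x) = Λ.brauer p B.W x * u (PReg.map B.b x)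

variable (p) in
/-- The Brauer character of the normal subgroup `N`. -/
def theta : PReg p N → ℂ := Λ.brauer p (MonoidHom.comp B.W B.c)

variable (p) in
theorem isIrrBrauer_theta : Λ.IsIrrBrauer p (B.theta Λ p) := Λ.isIrrBrauer_brauer B.irr

variable {Λ B}

theorem Rel.add {u v : PReg p H' → ℂ} {χ ψ : PReg p H → ℂ} (h : B.Rel Λ u χ) (h' : B.Rel Λ v ψ) :
    B.Rel Λ (u + v) (χ + ψ) := fun x => by
  rw [Pi.add_apply, Pi.add_apply, h, h', mul_add]

theorem Rel.multiset_sum {ι : Type*} (s : Multiset ι) (u : ι → PReg p H' → ℂ)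
    (χ : ι → PReg p H → ℂ) (h : ∀ j ∈ s, B.Rel Λ (u j) (χ j)) :
    B.Rel Λ (s.map u).sum (s.map χ).sum := by
  induction s using Multiset.induction_on with
  | empty => intro x; simp
  | cons j s ih =>
    rw [Multiset.map_cons, Multiset.map_cons, Multiset.sum_cons, Multiset.sum_cons]
    exact (h j (by simp)).add (ih fun j hj => h j (Multiset.mem_cons_of_mem hj))

/-- The `p`-regular elements of `H` lift to `E`, so `u` determines `χ`. The converse is deeper,
since the character of `W` may vanish. -/
theorem Rel.unique [CharP k p] [Finite E] {u : PReg p H' → ℂ} {χ ψ : PReg p H → ℂ}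
    (hχ : B.Rel Λ u χ) (hψ : B.Rel Λ u ψ) : χ = ψ := by
  funext y
  obtain ⟨x, rfl⟩ := PReg.map_surjective (CharP.char_is_prime_or_zero k p).symm B.a_surj y
  rw [hχ, hψ]

/-- The representation of `H'` on the maps from `W` to `V` that commute with `N`. -/
theorem exists_hom_representation {Z : Type} [AddCommGroup Z] [Module k Z] [FiniteDimensional k Z]
    (V : Representation k H Z) :
    ∃ (d : ℕ) (U : Representation k H' (Fin d → k))
      (ι : (Fin d → k) →ₗ[k] X →ₗ[k] Z), Function.Injective ι ∧
      (∀ x y, ι (U (B.b x) y) = V (B.a x) ∘ₗ ι y ∘ₗ B.W x⁻¹) ∧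
      ∀ f : X →ₗ[k] Z, (∃ y, ι y = f) ↔ ∀ m, f ∘ₗ B.W (B.c m) = V (B.i m) ∘ₗ f := by
  let Y : Submodule k (X →ₗ[k] Z) :=
    { carrier := {f | ∀ m, f ∘ₗ B.W (B.c m) = V (B.i m) ∘ₗ f}
      add_mem' := fun {f g} hf hg m => by
        rw [LinearMap.add_comp, LinearMap.comp_add, hf, hg]
      zero_mem' := fun m => by rw [LinearMap.zero_comp, LinearMap.comp_zero]
      smul_mem' := fun c f hf m => by rw [LinearMap.smul_comp, LinearMap.comp_smul, hf] }
  have hW : ∀ x y v, B.W x (B.W y v) = B.W (x * y) v := fun x y v => by rw [map_mul]; rfl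
  have hVm : ∀ x y v, V x (V y v) = V (x * y) v := fun x y v => by rw [map_mul]; rfl
  -- The image of `c` is the kernel of `b`, hence normal in `E`, so `E` permutes the
  -- `N`-equivariance conditions.
  have hY : ∀ x, Y ≤ Y.comap ((B.W.linHom (MonoidHom.comp V B.a)) x) := fun x f hf m => by
    obtain ⟨m', hm'⟩ := B.ker_b (x⁻¹ * B.c m * x) (by simp [B.b_c])
    have h1 : x⁻¹ * B.c m = B.c m' * x⁻¹ := by rw [hm']; group
    have h2 : B.a x * B.i m' = B.i m * B.a x := by
      rw [← B.a_c, ← B.a_c, hm', ← map_mul, ← map_mul]; congr 1; group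
    ext1 v
    have h3 : f (B.W (B.c m') (B.W x⁻¹ v)) = V (B.i m') (f (B.W x⁻¹ v)) :=
      LinearMap.congr_fun (hf m') _
    simp only [linHom_apply, LinearMap.comp_apply, MonoidHom.comp_apply]
    rw [hW, h1, ← hW, h3, hVm, h2, ← hVm]
  let e := (finBasis k Y).equivFun
  let ι : (Fin (finrank k Y) → k) →ₗ[k] X →ₗ[k] Z := Y.subtype ∘ₗ e.symm.toLinearMap
  have hι : Function.Injective ι := Y.injective_subtype.comp e.symm.injective
  let T : E → End k (Fin (finrank k Y) → k) := fun x =>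
    e.toLinearMap ∘ₗ (((B.W.linHom (MonoidHom.comp V B.a)) x).restrict (hY x)) ∘ₗ e.symm.toLinearMap
  have hT : ∀ x y, ι (T x y) = V (B.a x) ∘ₗ ι y ∘ₗ B.W x⁻¹ := fun x y =>
    congrArg Subtype.val (e.symm_apply_apply _)
  let U₀ : Representation k E (Fin (finrank k Y) → k) :=
    { toFun := T
      map_one' := LinearMap.ext fun y => hι (by
        rw [hT, map_one, map_one, inv_one, map_one]; rfl)
      map_mul' := fun x x' => LinearMap.ext fun y => hι (by
        rw [hT, End.mul_apply, hT, hT, map_mul, map_mul, mul_inv_rev, map_mul]; rfl) }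
  have hU₀ : ∀ x y, ι (U₀ x y) = V (B.a x) ∘ₗ ι y ∘ₗ B.W x⁻¹ := hT
  -- On maps commuting with `N`, conjugation by elements of `N` is trivial, so the action factors
  -- through `b`.
  obtain ⟨U, hU⟩ := exists_descent B.b_surj U₀ fun x hx => by
    obtain ⟨m, rfl⟩ := B.ker_b x hx
    refine LinearMap.ext fun y => hι ?_
    have hy : ι y ∘ₗ B.W (B.c m) = V (B.i m) ∘ₗ ι y := (e.symm y).2 m
    rw [hU₀, B.a_c, ← LinearMap.comp_assoc, ← hy]
    ext1 v
    simp only [LinearMap.comp_apply]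
    rw [hW, mul_inv_cancel, map_one]
    rfl
  refine ⟨_, U, ι, hι, fun x y => ?_, fun f => ⟨?_, fun hf => ⟨e ⟨f, hf⟩, ?_⟩⟩⟩
  · rw [← hU₀, ← hU]
    rfl
  · rintro ⟨y, rfl⟩
    exact (e.symm y).2
  · exact congrArg Subtype.val (e.symm_apply_apply (⟨f, hf⟩ : Y))

variable [IsAlgClosed k] [CharP k p]

/-- The witness is the character of `W ⊗ U`: it is irreducible on `E`, and the scalars of the two
factors cancel on the kernel of `a`, so it descends to `H`. On `N` only `W` acts nontrivially, which
gives `dim U` copies of `θ`. -/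
theorem exists_rel_of_irr' [Finite N'] {u : PReg p H' → ℂ} (hu : Λ.IsIrrBrauer p u)
    (h : IsOver B.i' (B.theta' Λ p) u) :
    ∃ χ, Λ.IsIrrBrauer p χ ∧ IsOver B.i (B.theta Λ p) χ ∧ B.Rel Λ u χ := by
  obtain ⟨n, U, hU, rfl⟩ := hu
  have hUb : ∀ n, (MonoidHom.comp U B.b) (B.c n) = 1 := fun n => by
    rw [MonoidHom.comp_apply, B.b_c, map_one]
  have hT := isIrreducible_tprod B.irr hUb ((isIrreducible_comp_iff B.b_surj U).2 hU)
  obtain ⟨V, hV⟩ := exists_descent B.a_surj (B.W.tprod (MonoidHom.comp U B.b)) fun x hx => by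
    obtain ⟨z, hz, hWz⟩ := B.ker_a x hx
    rw [Representation.tprod_apply, MonoidHom.comp_apply, hz, apply_central hU h, hWz,
      TensorProduct.map_smul_left, TensorProduct.map_smul_right, smul_smul, mul_comm,
      lam_mul_lam_inv, one_smul]
    exact TensorProduct.map_id
  have hrel : B.Rel Λ (Λ.brauer p U) (Λ.brauer p V) := fun x => by
    have h1 : Λ.brauer p (MonoidHom.comp V B.a) x =
        Λ.brauer p (B.W.tprod (MonoidHom.comp U B.b)) x := by rw [hV]
    rw [CharLift.brauer_tprod] at h1
    exact h1
  refine ⟨Λ.brauer p V, Λ.isIrrBrauer_brauer ((isIrreducible_comp_iff B.a_surj V).1 ?_),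
    ⟨n, fun x => ?_⟩, hrel⟩
  · rw [hV]; exact hT
  · have h1 : PReg.map B.i x = PReg.map B.a (PReg.map B.c x) := Subtype.ext (B.a_c _).symm
    rw [h1, hrel, Λ.brauer_apply_one (g := PReg.map B.b (PReg.map B.c x)) (B.b_c _),
      finrank_fin_fun, mul_comm]
    rfl

/-- The isomorphism is the evaluation map `X ⊗ Hom_N(X, Z) → Z`. A kernel element has all its slices
zero by Burnside's theorem; the image is invariant, and nonzero because `V` lies over `θ`. -/
theorem nonempty_tprod_equiv [Finite N] {Z : Type} [AddCommGroup Z] [Module k Z]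
    [FiniteDimensional k Z] {d : ℕ} {V : Representation k H Z}
    (hV : V.IsIrreducible) (h : IsOver B.i (B.theta Λ p) (Λ.brauer p V))
    {U : Representation k H' (Fin d → k)} {ι : (Fin d → k) →ₗ[k] X →ₗ[k] Z}
    (hι : Function.Injective ι) (hU : ∀ x y, ι (U (B.b x) y) = V (B.a x) ∘ₗ ι y ∘ₗ B.W x⁻¹)
    (hrange : ∀ f : X →ₗ[k] Z,
      (∃ y, ι y = f) ↔ ∀ m, f ∘ₗ B.W (B.c m) = V (B.i m) ∘ₗ f) :
    Nonempty ((B.W.tprod (MonoidHom.comp U B.b)).Equiv (MonoidHom.comp V B.a)) := by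
  let ev : X ⊗[k] (Fin d → k) →ₗ[k] Z := TensorProduct.lift (LinearMap.flip ι)
  have hev : ∀ x y, ev (x ⊗ₜ y) = ι y x := fun x f => rfl
  have hevE : ∀ x s, ev ((B.W.tprod (MonoidHom.comp U B.b)) x s) = V (B.a x) (ev s) :=
    fun x s => by
      induction s using TensorProduct.induction_on with
      | zero => simp
      | tmul v f =>
        rw [Representation.tprod_apply, TensorProduct.map_tmul, hev, hev, MonoidHom.comp_apply, hU]
        simp only [LinearMap.comp_apply]
        rw [Representation.inv_self_apply]
      | add s t hs ht => simp only [map_add, hs, ht]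
  have hinj : Function.Injective ev := by
    rw [← LinearMap.ker_eq_bot]
    refine (Submodule.eq_bot_iff _).2 fun s hs => eq_zero_of_slice_eq_zero fun l => ?_
    refine hι (LinearMap.ext fun v => ?_)
    rw [map_zero]
    exact tmul_slice_mem B.irr (LinearMap.ker ev) (fun m s hs => by
      rw [LinearMap.mem_ker] at hs ⊢
      have := hevE (B.c m) s
      rw [hs, map_zero, tprod_apply_of_eq_one (c := B.c)
        (fun n => by rw [MonoidHom.comp_apply, B.b_c, map_one])] at this
      exact this) l v hs
  have hsurj : Function.Surjective ev := by
    rw [← LinearMap.range_eq_top]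
    rcases ((isIrreducible_iff V).1 hV).2 (LinearMap.range ev) (by
      rintro g _ ⟨s, rfl⟩
      obtain ⟨x, rfl⟩ := B.a_surj g
      exact ⟨_, hevE x s⟩) with h0 | h1
    · exfalso
      have := nontrivial_of_isIrreducible hV
      obtain ⟨e, he⟩ := h
      obtain ⟨f, hf, hfV⟩ := exists_injective_intertwining (p := p) (Λ := Λ) B.irr
        (MonoidHom.comp V B.i) (e := e)
        (by funext n; rw [Pi.smul_apply, nsmul_eq_mul]; exact he n)
      have := nontrivial_of_isIrreducible B.irr
      obtain ⟨w, hw⟩ := exists_ne (0 : X)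
      obtain ⟨y, rfl⟩ := (hrange f).2 fun m => LinearMap.ext fun v => hfV m v
      have h2 : ev (w ⊗ₜ y) ∈ LinearMap.range ev := ⟨_, rfl⟩
      rw [h0, Submodule.mem_bot, hev] at h2
      exact hw (hf (h2.trans (map_zero (ι y)).symm))
    · exact h1
  exact ⟨Representation.Equiv.mk (LinearEquiv.ofBijective ev ⟨hinj, hsurj⟩) fun x =>
    LinearMap.ext fun s => hevE x s⟩

theorem exists_rel_of_irr [Finite N] {χ : PReg p H → ℂ} (hχ : Λ.IsIrrBrauer p χ)
    (h : IsOver B.i (B.theta Λ p) χ) :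
    ∃ u, Λ.IsIrrBrauer p u ∧ IsOver B.i' (B.theta' Λ p) u ∧ B.Rel Λ u χ := by
  obtain ⟨n, V, hV, rfl⟩ := hχ
  obtain ⟨d, U, ι, hι, hU, hrange⟩ := exists_hom_representation (B := B) V
  obtain ⟨e⟩ := nonempty_tprod_equiv hV h hι hU hrange
  have hT := isIrreducible_of_equiv e.symm ((isIrreducible_comp_iff B.a_surj V).2 hV)
  have hT' : Representation.IsIrreducible (MonoidHom.comp U B.b) :=
    isIrreducible_of_tprod (nontrivial_of_isIrreducible B.irr) hT
  have hUirr := (isIrreducible_comp_iff B.b_surj U).1 hT'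
  refine ⟨Λ.brauer p U, Λ.isIrrBrauer_brauer hUirr, ⟨d, fun z => ?_⟩, fun x => ?_⟩
  -- The element `x` above `z` acts trivially through `V`, so on `Hom_N(X, Z)` only `W x⁻¹`, the
  -- scalar `lam z`, remains.
  · obtain ⟨x, hx, hx', hWx⟩ := B.scalar z
    have h1 : B.W x⁻¹ = B.lam z • (1 : End k X) := by
      have h2 : B.W x⁻¹ * B.W x = 1 := by rw [← map_mul, inv_mul_cancel, map_one]
      rw [hWx, mul_smul_comm, mul_one] at h2
      rw [← h2, smul_smul, lam_mul_lam_inv, one_smul]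
    have h2 : U (B.i' z) = B.lam z • (1 : End k (Fin d → k)) := by
      refine LinearMap.ext fun f => hι (LinearMap.ext fun v => ?_)
      rw [← hx', hU, hx, h1, map_one]
      simp
    have h3 : scalarRep B.lam z = B.lam z • (1 : End k k) :=
      LinearMap.ext fun v => by rw [scalarRep_apply]; rfl
    rw [CharLift.brauer, theta', CharLift.brauer, PReg.coe_map, h2, h3, CharLift.trLift_smul_one,
      CharLift.trLift_smul_one, finrank_self, finrank_fin_fun]
    push_cast
    ring
  · have h1 := congrFun (Λ.brauer_congr (p := p) e) x
    rw [CharLift.brauer_tprod] at h1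
    exact h1.symm

/-- Division by the character of `W` is impossible where it vanishes. Instead, equal characters of
`W ⊗ U` and `W ⊗ V` make these irreducible representations isomorphic, and the factor `W` cancels.
-/
theorem Rel.unique_of_irr [Finite E] {u v : PReg p H' → ℂ} {χ : PReg p H → ℂ}
    (hu : Λ.IsIrrBrauer p u)
    (hv : Λ.IsIrrBrauer p v) (h : B.Rel Λ u χ) (h' : B.Rel Λ v χ) : u = v := by
  obtain ⟨n, U, hU, rfl⟩ := hu
  obtain ⟨m, V, hV, rfl⟩ := hv
  have hb : ∀ {l : ℕ} (U : Representation k H' (Fin l → k)) n,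
      (MonoidHom.comp U B.b) (B.c n) = 1 := fun U n => by
    rw [MonoidHom.comp_apply, B.b_c, map_one]
  have hU' := (isIrreducible_comp_iff B.b_surj U).2 hU
  have hV' := (isIrreducible_comp_iff B.b_surj V).2 hV
  obtain ⟨e⟩ := Λ.nonempty_equiv_of_brauer_eq (p := p) (isIrreducible_tprod B.irr (hb U) hU')
    (isIrreducible_tprod B.irr (hb V) hV') (by
      funext x
      rw [CharLift.brauer_tprod, CharLift.brauer_tprod]
      exact (h x).symm.trans (h' x))
  obtain ⟨e'⟩ := nonempty_equiv_of_tprod_equiv B.irr (hb U) (hb V) hU' hV' e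
  have h1 := Λ.brauer_congr (p := p) e'
  funext y
  obtain ⟨x, rfl⟩ := PReg.map_surjective (CharP.char_is_prime_or_zero k p).symm B.b_surj y
  exact congrFun h1 x

theorem exists_rel [Finite N] {χ : PReg p H → ℂ} (hχ : Λ.IsBrauer p χ)
    (h : IsOver B.i (B.theta Λ p) χ) :
    ∃ u, Λ.IsBrauer p u ∧ IsOver B.i' (B.theta' Λ p) u ∧ B.Rel Λ u χ := by
  obtain ⟨s, hs, rfl, hne⟩ := hχ.exists_multiset (ne_one_of_charP k p)
  have hex : ∀ φ : PReg p H → ℂ, ∃ u, φ ∈ s →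
      Λ.IsIrrBrauer p u ∧ IsOver B.i' (B.theta' Λ p) u ∧ B.Rel Λ u φ := fun φ => by
    by_cases hφ : φ ∈ s
    · obtain ⟨u, hu⟩ := exists_rel_of_irr (hs φ hφ)
        (isOver_of_mem (B.isIrrBrauer_theta Λ p) hs h φ hφ)
      exact ⟨u, fun _ => hu⟩
    · exact ⟨0, fun h => absurd h hφ⟩
  choose τ hτ using hex
  refine ⟨(s.map τ).sum, CharLift.IsBrauer.multiset_sum _ (by simpa using hne) ?_,
    IsOver.multiset_sum _ ?_, ?_⟩
  · intro u hu
    obtain ⟨φ, hφ, rfl⟩ := Multiset.mem_map.1 hu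
    exact (hτ φ hφ).1.isBrauer
  · intro u hu
    obtain ⟨φ, hφ, rfl⟩ := Multiset.mem_map.1 hu
    exact (hτ φ hφ).2.1
  · exact Rel.multiset_sum s τ id (fun φ hφ => (hτ φ hφ).2.2) |> fun h => by
      rwa [Multiset.map_id] at h

/-- The correspondence is injective. -/
theorem Rel.injective [Finite N'] [Finite H] [Finite E] {u v : PReg p H' → ℂ}
    {χ : PReg p H → ℂ} (hu : Λ.IsBrauer p u) (hu' : IsOver B.i' (B.theta' Λ p) u)
    (hv : Λ.IsBrauer p v) (hv' : IsOver B.i' (B.theta' Λ p) v)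
    (h : B.Rel Λ u χ) (h' : B.Rel Λ v χ) : u = v := by
  have hp := ne_one_of_charP k p
  let T : Set (PReg p H' → ℂ) := {φ | Λ.IsIrrBrauer p φ ∧ IsOver B.i' (B.theta' Λ p) φ}
  have hex : ∀ φ : PReg p H' → ℂ, ∃ χ, φ ∈ T → Λ.IsIrrBrauer p χ ∧ B.Rel Λ φ χ := fun φ => by
    by_cases hφ : φ ∈ T
    · obtain ⟨χ, hχ, -, hr⟩ := exists_rel_of_irr' hφ.1 hφ.2
      exact ⟨χ, fun _ => ⟨hχ, hr⟩⟩
    · exact ⟨0, fun h => absurd h hφ⟩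
  choose τ hτ using hex
  have hinj : Set.InjOn τ T := fun φ hφ ψ hψ he =>
    Rel.unique_of_irr hφ.1 hψ.1 (hτ φ hφ).2 (he ▸ (hτ ψ hψ).2)
  obtain ⟨s, hs, rfl, -⟩ := hu.exists_multiset hp
  obtain ⟨t, ht, rfl, -⟩ := hv.exists_multiset hp
  have hsT : ∀ φ ∈ s, φ ∈ T := fun φ hφ =>
    ⟨hs φ hφ, isOver_of_mem (B.isIrrBrauer_theta' Λ p) hs hu' φ hφ⟩
  have htT : ∀ φ ∈ t, φ ∈ T := fun φ hφ =>
    ⟨ht φ hφ, isOver_of_mem (B.isIrrBrauer_theta' Λ p) ht hv' φ hφ⟩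
  have hirr : ∀ r : Multiset (PReg p H' → ℂ), (∀ φ ∈ r, φ ∈ T) →
      ∀ χ ∈ r.map τ, Λ.IsIrrBrauer p χ := fun r hr χ hχ => by
    obtain ⟨φ, hφ, rfl⟩ := Multiset.mem_map.1 hχ
    exact (hτ φ (hr φ hφ)).1
  have hrel : ∀ r : Multiset (PReg p H' → ℂ), (∀ φ ∈ r, φ ∈ T) →
      B.Rel Λ r.sum (r.map τ).sum := fun r hr => by
    have := Rel.multiset_sum r id τ fun φ hφ => (hτ φ (hr φ hφ)).2
    rwa [Multiset.map_id] at this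
  -- Both images sum to `χ`, so they agree by independence of irreducible characters of `H`; as `τ`
  -- is injective on irreducibles over `θ'`, the original multisets agree.
  have hmap : s.map τ = t.map τ := CharLift.IsIrrBrauer.multiset_eq (hirr s hsT) (hirr t htT)
    (((hrel s hsT).unique h).trans ((hrel t htT).unique h').symm)
  have hinv : ∀ r : Multiset (PReg p H' → ℂ), (∀ φ ∈ r, φ ∈ T) →
      (r.map τ).map (Function.invFunOn τ T) = r := fun r hr => by
    rw [Multiset.map_map]
    conv_rhs => rw [← Multiset.map_id r]
    exact Multiset.map_congr rfl fun φ hφ => hinj.leftInvOn_invFunOn (hr φ hφ)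
  rw [← hinv s hsT, hmap, hinv t htT]

end Bridge

end CharTriple

end

noncomputable section

namespace CharTriple

open Module Representation

/-! ### The covering group of an invariant representation -/

section Schur

variable {k : Type} [Field k] {X : Type} [AddCommGroup X] [Module k X]

theorem exists_smul_one_of_commute [IsAlgClosed k] [FiniteDimensional k X] {H : Type*} [Group H]
    {ρ : Representation k H X} (hρ : ρ.IsIrreducible) {P : End k X}
    (h : ∀ n, P * ρ n = ρ n * P) : ∃ s : k, P = s • (1 : End k X) := by
  let F : ρ.IntertwiningMap ρ := ⟨P, h⟩
  obtain ⟨s, hs⟩ := (IsIrreducible.algebraMap_intertwiningMap_bijective_of_isAlgClosed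
    (ρ := ρ)).2 F
  exact ⟨s, LinearMap.ext fun v => (congrArg (fun F : ρ.IntertwiningMap ρ => F v) hs).symm⟩

/-- By Schur's lemma `P` and `P'` differ by a scalar, which conjugation does not see. -/
theorem conj_eq_of_commute [IsAlgClosed k] [FiniteDimensional k X] {H : Type*} [Group H]
    {ρ : Representation k H X} (hρ : ρ.IsIrreducible) {P P' : (End k X)ˣ}
    (h : ∀ n, ((P⁻¹ * P' : (End k X)ˣ) : End k X) * ρ n =
      ρ n * ((P⁻¹ * P' : (End k X)ˣ) : End k X)) (R : End k X) :
    (P' : End k X) * R * (P'⁻¹ : (End k X)ˣ) = P * R * (P⁻¹ : (End k X)ˣ) := by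
  obtain ⟨s, hs⟩ := exists_smul_one_of_commute hρ h
  have h1 : (P' : End k X) = s • (P : End k X) := by
    have : P' = P * (P⁻¹ * P') := by group
    rw [this, Units.val_mul, hs, mul_smul_comm, mul_one]
  rw [Units.mul_inv_eq_iff_eq_mul, h1, mul_assoc, mul_smul_comm, Units.inv_mul, smul_mul_assoc,
    mul_smul_comm, mul_one]

/-- Invariance of the character is turned into an operator: the twist of `ρ` by `f` has the same
character, hence is isomorphic to `ρ`. -/
theorem exists_unit_intertwining [IsAlgClosed k] [FiniteDimensional k X] {p : ℕ} [CharP k p]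
    {Λ : CharLift k} {H : Type*} [Group H] [Finite H] {ρ : Representation k H X}
    (hρ : ρ.IsIrreducible) (f : H ≃* H)
    (h : Λ.brauer p ρ ∘ PReg.map f.toMonoidHom = Λ.brauer p ρ) :
    ∃ P : (End k X)ˣ, ∀ n, (P : End k X) * ρ n = ρ (f n) * P := by
  obtain ⟨e⟩ := Λ.nonempty_equiv_of_brauer_eq (p := p) hρ
    ((isIrreducible_comp_iff (f := f.toMonoidHom) f.surjective ρ).2 hρ) h.symm
  refine ⟨⟨e.toLinearEquiv.toLinearMap, e.toLinearEquiv.symm.toLinearMap, ?_, ?_⟩, fun n => ?_⟩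
  · exact LinearMap.ext fun v => e.toLinearEquiv.apply_symm_apply v
  · exact LinearMap.ext fun v => e.toLinearEquiv.symm_apply_apply v
  · exact e.toIntertwiningMap.isIntertwining' n

end Schur

section Cover

variable {k : Type} [Field k] {G : Type u} [Group G] {N : Subgroup G} [N.Normal]
  {X : Type} [AddCommGroup X] [Module k X]

/-- The pairs `(g, P)` such that `P` intertwines `ρ` and its conjugate by `g`, with a bound on
the order of the determinant of `P`. -/
def cover (ρ : Representation k N X) : Subgroup (G × (End k X)ˣ) where
  carrier := {x | (∀ n, (x.2 : End k X) * ρ n = ρ (MulAut.conjNormal x.1 n) * x.2) ∧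
    LinearMap.det (x.2 : End k X) ^ Nat.card N = 1}
  mul_mem' := by
    rintro ⟨g, P⟩ ⟨h, Q⟩ ⟨h1, h2⟩ ⟨h3, h4⟩
    refine ⟨fun n => ?_, ?_⟩
    · have e1 := h1 (MulAut.conjNormal h n)
      have e2 := h3 n
      simp only at e1 e2
      simp only [Prod.mk_mul_mk, Units.val_mul, map_mul, MulAut.mul_apply]
      rw [mul_assoc, e2, ← mul_assoc, e1, mul_assoc]
    · simp only [Prod.mk_mul_mk, Units.val_mul, map_mul, mul_pow]
      simp only at h2 h4
      rw [h2, h4, one_mul]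
  one_mem' := ⟨fun n => by simp, by simp⟩
  inv_mem' := by
    rintro ⟨g, P⟩ ⟨h1, h2⟩
    refine ⟨fun n => ?_, ?_⟩
    · have e1 := h1 (MulAut.conjNormal g⁻¹ n)
      simp only at e1
      rw [← MulAut.mul_apply, ← map_mul, mul_inv_cancel, map_one, MulAut.one_apply] at e1
      simp only [Prod.inv_mk]
      rw [Units.inv_mul_eq_iff_eq_mul, ← mul_assoc, e1, mul_assoc, Units.mul_inv, mul_one]
    · have h3 : LinearMap.det (P : End k X) * LinearMap.det ((P⁻¹ : (End k X)ˣ) : End k X) = 1 := by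
        rw [← map_mul, Units.mul_inv, map_one]
      simp only [Prod.inv_mk] at h2 ⊢
      rw [← one_mul (_ ^ _), ← h2, ← mul_pow, h3, one_pow, h2]

variable (ρ : Representation k N X)

/-- The projection of the covering group to `G`. -/
def coverProj : cover ρ →* G := (MonoidHom.fst G (End k X)ˣ).comp (cover ρ).subtype

/-- The tautological representation of the covering group. -/
def coverRep : Representation k (cover ρ) X :=
  (Units.coeHom (End k X)).comp ((MonoidHom.snd G (End k X)ˣ).comp (cover ρ).subtype)

theorem coverRep_mul (x : cover ρ) (n : N) :
    coverRep ρ x * ρ n = ρ (MulAut.conjNormal (coverProj ρ x) n) * coverRep ρ x := x.2.1 n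

theorem cover_ext {x y : cover ρ} (hg : coverProj ρ x = coverProj ρ y)
    (hP : coverRep ρ x = coverRep ρ y) : x = y :=
  Subtype.ext (Prod.ext hg (Units.ext hP))

/-- The canonical embedding of `N` into the covering group. -/
def coverEmb : N →* cover ρ :=
  MonoidHom.codRestrict (N.subtype.prod (MonoidHom.toHomUnits (ρ : N →* End k X))) (cover ρ)
    fun n => by
      refine ⟨fun m => ?_, ?_⟩
      · change ρ n * ρ m = ρ _ * ρ n
        rw [← map_mul, ← map_mul]
        congr 1
        ext
        simp
      · change LinearMap.det (ρ n) ^ Nat.card N = 1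
        rw [← map_pow, ← map_pow, pow_card_eq_one', map_one, map_one]

@[simp] theorem coverProj_coverEmb (n : N) : coverProj ρ (coverEmb ρ n) = n := rfl

@[simp] theorem coverRep_coverEmb (n : N) : coverRep ρ (coverEmb ρ n) = ρ n := rfl

theorem coverEmb_conj (x : cover ρ) (n : N) :
    x * coverEmb ρ n * x⁻¹ = coverEmb ρ (MulAut.conjNormal (coverProj ρ x) n) := by
  rw [mul_inv_eq_iff_eq_mul]
  refine cover_ext ρ ?_ ?_
  · rw [map_mul, map_mul, coverProj_coverEmb, coverProj_coverEmb, MulAut.conjNormal_apply]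
    group
  · rw [map_mul, map_mul]
    exact coverRep_mul ρ x n

instance : (coverEmb ρ).range.Normal :=
  ⟨by
    rintro _ ⟨n, rfl⟩ x
    exact ⟨_, (coverEmb_conj ρ x n).symm⟩⟩

variable {ρ}

theorem exists_scalar_hom (hρ : ρ.IsIrreducible) [IsAlgClosed k] [FiniteDimensional k X] :
    ∃ s : (coverProj ρ).ker →* k, ∀ x : (coverProj ρ).ker,
      coverRep ρ x.1 = s x • (1 : End k X) := by
  have := nontrivial_of_isIrreducible hρ
  have h1 : ∀ x : (coverProj ρ).ker, ∃ s : k, coverRep ρ x.1 = s • (1 : End k X) := fun x =>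
    exists_smul_one_of_commute hρ fun n => by
      have := coverRep_mul ρ x.1 n
      rwa [x.2, map_one, MulAut.one_apply] at this
  choose s hs using h1
  have hinj : Function.Injective fun c : k => c • (1 : End k X) :=
    smul_left_injective k one_ne_zero
  refine ⟨⟨⟨s, hinj ?_⟩, fun x y => hinj ?_⟩, hs⟩
  · change s 1 • (1 : End k X) = (1 : k) • 1
    rw [← hs, one_smul]
    exact map_one (coverRep ρ)
  · change s (x * y) • (1 : End k X) = (s x * s y) • 1
    rw [← hs, Subgroup.coe_mul, map_mul, hs, hs, smul_mul_smul_comm, one_mul]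

/-- A scalar `s` in the kernel satisfies `s ^ (dim X * |N|) = 1` by the determinant condition, and
the quotient by the kernel embeds in `G`. -/
theorem finite_cover (hρ : ρ.IsIrreducible) [IsAlgClosed k] [FiniteDimensional k X] [Finite G] :
    Finite (cover ρ) := by
  have hX := nontrivial_of_isIrreducible hρ
  obtain ⟨s, hs⟩ := exists_scalar_hom hρ
  have hpos : 0 < finrank k X * Nat.card N := Nat.mul_pos finrank_pos Nat.card_pos
  have hinj : Function.Injective fun x : (coverProj ρ).ker =>
      (⟨s x, by
        have h1 := x.1.2.2
        have h2 : (x.1.1.2 : End k X) = s x • 1 := hs x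
        rw [h2, LinearMap.det_smul, map_one, mul_one, ← pow_mul] at h1
        exact (Polynomial.mem_nthRootsFinset hpos (1 : k)).2 h1⟩ :
        Polynomial.nthRootsFinset (finrank k X * Nat.card N) (1 : k)) := by
    intro x y hxy
    have h : s x = s y := congrArg Subtype.val hxy
    refine Subtype.ext (cover_ext ρ (x.2.trans y.2.symm) ?_)
    rw [hs, hs, h]
  have : Finite (coverProj ρ).ker := Finite.of_injective _ hinj
  have : Finite (cover ρ ⧸ (coverProj ρ).ker) :=
    Finite.of_injective _ (QuotientGroup.kerLift_injective (coverProj ρ))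
  exact Finite.of_subgroup_quotient (coverProj ρ).ker

theorem coverProj_surjective (hρ : ρ.IsIrreducible) [IsAlgClosed k] [FiniteDimensional k X]
    [Finite G]
    (h : ∀ g : G, ∃ P : (End k X)ˣ, ∀ n, (P : End k X) * ρ n = ρ (MulAut.conjNormal g n) * P) :
    Function.Surjective (coverProj ρ) := by
  intro g
  have hX := nontrivial_of_isIrreducible hρ
  obtain ⟨P, hP⟩ := h g
  have hdet : LinearMap.det (P : End k X) ≠ 0 := fun h0 => by
    have h3 : LinearMap.det (P : End k X) * LinearMap.det ((P⁻¹ : (End k X)ˣ) : End k X) = 1 := by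
      rw [← map_mul, Units.mul_inv, map_one]
    rw [h0, zero_mul] at h3
    exact zero_ne_one h3
  -- Rescaling by a `dim X`-th root of the inverse determinant makes the determinant of the
  -- intertwiner equal to one.
  obtain ⟨z, hz⟩ := IsAlgClosed.exists_pow_nat_eq (LinearMap.det (P : End k X))⁻¹
    (finrank_pos (R := k) (M := X))
  have hz0 : z ≠ 0 := fun h0 => by
    rw [h0, zero_pow finrank_pos.ne'] at hz
    exact inv_ne_zero hdet hz.symm
  refine ⟨⟨(g, Units.mk0 z hz0 • P), fun n => ?_, ?_⟩, rfl⟩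
  · change (z • (P : End k X)) * ρ n = ρ (MulAut.conjNormal g n) * (z • (P : End k X))
    rw [smul_mul_assoc, hP, mul_smul_comm]
  · change LinearMap.det (z • (P : End k X)) ^ _ = 1
    rw [LinearMap.det_smul, hz, inv_mul_cancel₀ hdet, one_pow]

/-! ### The action on the covering group -/

variable {A : Type v} [Group A] [MulDistribMulAction A G]
  {hN : ∀ (a : A), ∀ n ∈ N, a • n ∈ N} {Q : A → (End k X)ˣ}

theorem conj_mem_cover
    (hQ : ∀ a n, (Q a : End k X) * ρ n = ρ (actHom N hN a n) * Q a)
    (a : A) (x : cover ρ) :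
    ((a • x.1.1, Q a * x.1.2 * (Q a)⁻¹) : G × (End k X)ˣ) ∈ cover ρ := by
  refine ⟨fun n => ?_, ?_⟩
  · have h0 : ∀ m : N, actHom N hN a (actHom N hN a⁻¹ m) = m := fun m => by
      ext; exact smul_inv_smul a (m : G)
    have h1 : ((Q a)⁻¹ : (End k X)ˣ) * ρ n = ρ (actHom N hN a⁻¹ n) * ((Q a)⁻¹ : (End k X)ˣ) := by
      rw [Units.inv_mul_eq_iff_eq_mul, ← mul_assoc, hQ, h0, mul_assoc, Units.mul_inv, mul_one]
    have h2 := x.2.1 (actHom N hN a⁻¹ n)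
    have h3 := hQ a (MulAut.conjNormal x.1.1 (actHom N hN a⁻¹ n))
    have h4 : actHom N hN a (MulAut.conjNormal x.1.1 (actHom N hN a⁻¹ n)) =
        MulAut.conjNormal (a • x.1.1) n := by
      ext
      change a • (x.1.1 * (a⁻¹ • (n : G)) * x.1.1⁻¹) = a • x.1.1 * n * (a • x.1.1)⁻¹
      rw [smul_mul', smul_mul', smul_inv_smul, smul_inv']
    rw [h4] at h3
    simp only [Units.val_mul]
    rw [mul_assoc, h1, mul_assoc, ← mul_assoc (x.1.2 : End k X), h2, ← mul_assoc, ← mul_assoc, h3]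
    simp only [mul_assoc]
  · have h3 : LinearMap.det (Q a : End k X) *
        LinearMap.det (((Q a)⁻¹ : (End k X)ˣ) : End k X) = 1 := by
      rw [← map_mul, Units.mul_inv, map_one]
    simp only [Units.val_mul, map_mul]
    rw [mul_right_comm, h3, one_mul]
    exact x.2.2

variable (hQ : ∀ a n, (Q a : End k X) * ρ n = ρ (actHom N hN a n) * Q a)

/-- The automorphism `(g, P) ↦ (a • g, Q a * P * (Q a)⁻¹)` of the covering group. -/
def coverAct (a : A) : cover ρ →* cover ρ where
  toFun x := ⟨_, conj_mem_cover hQ a x⟩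
  map_one' := Subtype.ext (Prod.ext (smul_one a) (by simp))
  map_mul' x y := Subtype.ext (Prod.ext (smul_mul' a _ _) (by simp [mul_assoc]))

theorem coverProj_coverAct (a : A) (x : cover ρ) :
    coverProj ρ (coverAct hQ a x) = a • coverProj ρ x := rfl

theorem coverRep_coverAct (a : A) (x : cover ρ) :
    coverRep ρ (coverAct hQ a x) = Q a * coverRep ρ x * ((Q a)⁻¹ : (End k X)ˣ) := rfl

theorem coverAct_coverEmb (a : A) (n : N) :
    coverAct hQ a (coverEmb ρ n) = coverEmb ρ (actHom N hN a n) := by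
  refine cover_ext ρ rfl ?_
  rw [coverRep_coverAct, coverRep_coverEmb, coverRep_coverEmb, hQ, mul_assoc, Units.mul_inv,
    mul_one]

theorem coverAct_of_mem_ker (hρ : ρ.IsIrreducible) [IsAlgClosed k] [FiniteDimensional k X]
    (a : A) {x : cover ρ} (hx : x ∈ (coverProj ρ).ker) : coverAct hQ a x = x := by
  obtain ⟨s, hs⟩ := exists_scalar_hom hρ
  have h1 : coverRep ρ x = _ := hs ⟨x, hx⟩
  refine cover_ext ρ ?_ ?_
  · rw [coverProj_coverAct, MonoidHom.mem_ker.1 hx, smul_one]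
  · rw [coverRep_coverAct, h1, mul_smul_comm, smul_mul_assoc, mul_one, Units.mul_inv]

/-- The chosen operators `Q a` need not be multiplicative in `a`. But `Q 1` and `1`, and likewise `Q
(a * b)` and `Q a * Q b`, intertwine the same representations, so they conjugate alike. -/
theorem coverAct_one (hρ : ρ.IsIrreducible) [IsAlgClosed k] [FiniteDimensional k X] (x : cover ρ) :
    coverAct hQ 1 x = x := by
  refine cover_ext ρ (one_smul A _) ?_
  rw [coverRep_coverAct, conj_eq_of_commute hρ (P := 1) (P' := Q 1)]
  · simp
  · intro n
    rw [inv_one, one_mul, hQ]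
    congr 2
    ext
    exact one_smul A _

theorem coverAct_mul (hρ : ρ.IsIrreducible) [IsAlgClosed k] [FiniteDimensional k X] (a b : A)
    (x : cover ρ) :
    coverAct hQ (a * b) x = coverAct hQ a (coverAct hQ b x) := by
  refine cover_ext ρ (mul_smul a b _) ?_
  rw [coverRep_coverAct, coverRep_coverAct, coverRep_coverAct,
    conj_eq_of_commute hρ (P := Q a * Q b) (P' := Q (a * b))]
  · simp [mul_assoc]
  · intro n
    have h1 : ((Q (a * b) : (End k X)ˣ) : End k X) * ρ n =
        ρ (actHom N hN a (actHom N hN b n)) * Q (a * b) := by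
      rw [hQ]
      congr 2
      ext
      exact mul_smul a b _
    rw [Units.val_mul, mul_assoc, h1, Units.inv_mul_eq_iff_eq_mul, Units.val_mul]
    have h2 := hQ a (actHom N hN b n)
    have h3 := hQ b n
    have h4 : ((Q b : (End k X)ˣ) : End k X) * (ρ n * (((Q a * Q b)⁻¹ : (End k X)ˣ) *
        (Q (a * b) : End k X))) = ρ (actHom N hN b n) * (((Q a)⁻¹ : (End k X)ˣ) *
        (Q (a * b) : End k X)) := by
      rw [← mul_assoc, h3, mul_inv_rev, Units.val_mul, mul_assoc, mul_assoc,
        ← mul_assoc (Q b : End k X), Units.mul_inv, one_mul]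
    rw [mul_assoc, h4, ← mul_assoc, h2, mul_assoc, ← mul_assoc (Q a : End k X), Units.mul_inv,
      one_mul]

end Cover

end CharTriple

end

noncomputable section

namespace CharTriple

open Module Representation

/-! ### The map on characters of a bridge -/

namespace Bridge

variable {k : Type} [Field k] {N N' H H' E : Type*}
  [Group N] [Group N'] [Group H] [Group H'] [Group E] {X : Type} [AddCommGroup X] [Module k X]
  [FiniteDimensional k X] (B : Bridge k N N' H H' E X) (Λ : CharLift k) {p : ℕ}

/-- The character of `H'` over `θ'` that corresponds to a character of `H` over `θ`. -/
def sigma (χ : PReg p H → ℂ) : PReg p H' → ℂ :=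
  -- Where no such `u` exists, off the characters over `θ`, the value is arbitrary.
  Classical.epsilon fun u => Λ.IsBrauer p u ∧ IsOver B.i' (B.theta' Λ p) u ∧ B.Rel Λ u χ

variable {B Λ} [IsAlgClosed k] [CharP k p]

theorem sigma_spec [Finite N] {χ : PReg p H → ℂ} (hχ : Λ.IsBrauer p χ)
    (h : IsOver B.i (B.theta Λ p) χ) :
    Λ.IsBrauer p (B.sigma Λ χ) ∧ IsOver B.i' (B.theta' Λ p) (B.sigma Λ χ) ∧
      B.Rel Λ (B.sigma Λ χ) χ :=
  Classical.epsilon_spec (p := fun u => Λ.IsBrauer p u ∧ IsOver B.i' (B.theta' Λ p) u ∧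
    B.Rel Λ u χ) (exists_rel hχ h)

/-- The values of `sigma` are identified through this uniqueness, without unfolding the choice. -/
theorem sigma_eq [Finite N'] [Finite H] [Finite E] {χ : PReg p H → ℂ} {u : PReg p H' → ℂ}
    (hu : Λ.IsBrauer p u) (hu' : IsOver B.i' (B.theta' Λ p) u) (h : B.Rel Λ u χ) :
    B.sigma Λ χ = u := by
  have := Classical.epsilon_spec (p := fun u => Λ.IsBrauer p u ∧ IsOver B.i' (B.theta' Λ p) u ∧
    B.Rel Λ u χ) ⟨u, hu, hu', h⟩
  exact Rel.injective this.1 this.2.1 hu hu' this.2.2 h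

theorem bijOn_sigma [Finite N] [Finite N'] [Finite H] [Finite E] :
    Set.BijOn (B.sigma Λ) {χ : PReg p H → ℂ | Λ.IsIrrBrauer p χ ∧ IsOver B.i (B.theta Λ p) χ}
      {u | Λ.IsIrrBrauer p u ∧ IsOver B.i' (B.theta' Λ p) u} := by
  refine ⟨fun χ hχ => ?_, fun χ hχ ψ hψ he => ?_, fun u hu => ?_⟩
  · obtain ⟨u, hu, hu', hr⟩ := exists_rel_of_irr hχ.1 hχ.2
    rw [sigma_eq hu.isBrauer hu' hr]
    exact ⟨hu, hu'⟩
  · have h1 := (sigma_spec hχ.1.isBrauer hχ.2).2.2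
    rw [he] at h1
    exact h1.unique (sigma_spec hψ.1.isBrauer hψ.2).2.2
  · obtain ⟨χ, hχ, hχ', hr⟩ := exists_rel_of_irr' hu.1 hu.2
    exact ⟨χ, ⟨hχ, hχ'⟩, sigma_eq hu.1.isBrauer hu.2 hr⟩

end Bridge

/-! ### The quotient of the covering group -/

section Star

variable {k : Type} [Field k] {G : Type u} [Group G] {N : Subgroup G} [N.Normal]
  {X : Type} [AddCommGroup X] [Module k X] (ρ : Representation k N X)

/-- The quotient of the covering group by `N`. -/
abbrev StarGroup : Type u := cover ρ ⧸ (coverEmb ρ).range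

/-- The image of the scalars in the quotient of the covering group. -/
def starCenter : Subgroup (StarGroup ρ) :=
  (coverProj ρ).ker.map (QuotientGroup.mk' (coverEmb ρ).range)

instance : (starCenter ρ).Normal :=
  Subgroup.Normal.map inferInstance _ (QuotientGroup.mk'_surjective _)

theorem mk_eq_one_iff {x : cover ρ} :
    (x : StarGroup ρ) = 1 ↔ ∃ n, coverEmb ρ n = x :=
  QuotientGroup.eq_one_iff x

/-- The isomorphism between the scalars in the covering group and their image. -/
def starEquiv : (coverProj ρ).ker ≃* starCenter ρ :=
  MulEquiv.ofBijective ((QuotientGroup.mk' (coverEmb ρ).range).subgroupMap (coverProj ρ).ker) <| by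
    -- The copy of `N` meets the scalars trivially, since it projects injectively to `G`.
    refine ⟨(injective_iff_map_eq_one _).2 fun x hx => ?_, MonoidHom.subgroupMap_surjective _ _⟩
    obtain ⟨n, hn⟩ := (mk_eq_one_iff ρ).1 (congrArg Subtype.val hx)
    have h1 := x.2
    rw [← hn, MonoidHom.mem_ker, coverProj_coverEmb] at h1
    refine Subtype.ext ?_
    rw [← hn, show n = 1 from Subtype.ext h1, map_one]
    rfl

variable {ρ}

/-- Both groups are the quotient of the cover by the product of the scalars and the copy of `N`. -/
theorem exists_quotient_equiv (h : Function.Surjective (coverProj ρ)) :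
    ∃ ι : G ⧸ N ≃* StarGroup ρ ⧸ starCenter ρ, ∀ x : cover ρ,
      ι (coverProj ρ x : G) = ((x : StarGroup ρ) : StarGroup ρ ⧸ starCenter ρ) := by
  let f₁ : cover ρ →* G ⧸ N := (QuotientGroup.mk' N).comp (coverProj ρ)
  let f₂ : cover ρ →* StarGroup ρ ⧸ starCenter ρ :=
    (QuotientGroup.mk' (starCenter ρ)).comp (QuotientGroup.mk' (coverEmb ρ).range)
  have hf₁ : Function.Surjective f₁ := (QuotientGroup.mk'_surjective _).comp h
  have hf₂ : Function.Surjective f₂ :=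
    (QuotientGroup.mk'_surjective _).comp (QuotientGroup.mk'_surjective _)
  have hker : f₁.ker = f₂.ker := by
    ext x
    have h1 : x ∈ f₁.ker ↔ coverProj ρ x ∈ N := QuotientGroup.eq_one_iff _
    have h2 : x ∈ f₂.ker ↔ (x : StarGroup ρ) ∈ starCenter ρ := QuotientGroup.eq_one_iff _
    rw [h1, h2]
    constructor
    · intro hx
      refine ⟨x * (coverEmb ρ ⟨_, hx⟩)⁻¹, ?_, ?_⟩
      · change coverProj ρ _ = 1
        rw [map_mul, map_inv, coverProj_coverEmb, mul_inv_cancel]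
      · rw [map_mul, map_inv]
        have : QuotientGroup.mk' (coverEmb ρ).range (coverEmb ρ ⟨_, hx⟩) = 1 :=
          (mk_eq_one_iff ρ).2 ⟨_, rfl⟩
        rw [this, inv_one, mul_one]
        rfl
    · rintro ⟨z, hz, hzx⟩
      obtain ⟨n, hn⟩ := QuotientGroup.eq.1 hzx
      have h3 : x = z * coverEmb ρ n := by rw [hn]; group
      rw [h3, map_mul, MonoidHom.mem_ker.1 hz, one_mul]
      exact n.2
  refine ⟨((QuotientGroup.quotientKerEquivOfSurjective f₁ hf₁).symm.trans
    (QuotientGroup.quotientMulEquivOfEq hker)).trans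
    (QuotientGroup.quotientKerEquivOfSurjective f₂ hf₂), fun x => ?_⟩
  have h1 : (QuotientGroup.quotientKerEquivOfSurjective f₁ hf₁).symm ((coverProj ρ x : G) : G ⧸ N) =
      (x : cover ρ ⧸ f₁.ker) := by
    rw [MulEquiv.symm_apply_eq]
    rfl
  rw [MulEquiv.trans_apply, MulEquiv.trans_apply, h1]
  rfl

/-- The linear character `lam` is the inverse of the scalar by which the cover acts, as the bridge
requires. -/
theorem exists_star_hom [IsAlgClosed k] [FiniteDimensional k X] (hρ : ρ.IsIrreducible) :
    ∃ lam : starCenter ρ →* k, ∀ x : (coverProj ρ).ker,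
      coverRep ρ x.1 = lam (starEquiv ρ x)⁻¹ • (1 : End k X) := by
  obtain ⟨s, hs⟩ := exists_scalar_hom hρ
  refine ⟨(invMonoidWithZeroHom : k →*₀ k).toMonoidHom.comp (s.comp (starEquiv ρ).symm.toMonoidHom),
    fun x => ?_⟩
  rw [hs]
  congr 1
  change s x = (s ((starEquiv ρ).symm (starEquiv ρ x)⁻¹))⁻¹
  rw [map_inv, MulEquiv.symm_apply_apply]
  have h1 : s x * s x⁻¹ = 1 := by rw [← map_mul, mul_inv_cancel, map_one]
  exact eq_inv_of_mul_eq_one_left h1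

theorem starCenter_le_center [IsAlgClosed k] [FiniteDimensional k X] (hρ : ρ.IsIrreducible) :
    starCenter ρ ≤ Subgroup.center (StarGroup ρ) := by
  obtain ⟨s, hs⟩ := exists_scalar_hom hρ
  rintro _ ⟨x, hx, rfl⟩
  rw [Subgroup.mem_center_iff]
  intro g
  obtain ⟨y, rfl⟩ := QuotientGroup.mk_surjective g
  change ((y * x : cover ρ) : StarGroup ρ) = ((x * y : cover ρ) : StarGroup ρ)
  congr 1
  refine cover_ext ρ ?_ ?_
  · rw [map_mul, map_mul, MonoidHom.mem_ker.1 hx, one_mul, mul_one]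
  · have h1 : coverRep ρ x = _ := hs ⟨x, hx⟩
    rw [map_mul, map_mul, h1, smul_one_mul, mul_smul_one]

/-- The scalars embed in the multiplicative group of `k`, where injectivity of Frobenius excludes
elements of order `p`; Cauchy's theorem concludes. -/
theorem not_dvd_card_starCenter [IsAlgClosed k] [FiniteDimensional k X] [Finite G] {p : ℕ}
    [CharP k p] (hρ : ρ.IsIrreducible) : ¬ p ∣ Nat.card (starCenter ρ) := by
  have := finite_cover hρ
  rcases CharP.char_is_prime_or_zero k p with hp | rfl
  · have : Fact p.Prime := ⟨hp⟩
    intro hdvd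
    rw [← Nat.card_congr (starEquiv ρ).toEquiv] at hdvd
    obtain ⟨x, hx⟩ := exists_prime_orderOf_dvd_card' p hdvd
    obtain ⟨s, hs⟩ := exists_scalar_hom hρ
    have h1 : s x ^ p = 1 := by rw [← map_pow, ← hx, pow_orderOf_eq_one, map_one]
    have h2 : s x = 1 := frobenius_inj k p (by rw [frobenius_def, frobenius_def, h1, one_pow])
    have h3 : x = 1 := Subtype.ext (cover_ext ρ (x.2.trans (map_one _).symm) (by
      rw [hs, h2, one_smul]; exact (map_one _).symm))
    rw [h3, orderOf_one] at hx
    exact hp.one_lt.ne hx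
  · rw [zero_dvd_iff]
    exact Nat.card_pos.ne'

theorem mk_mem_corr {ι : G ⧸ N ≃* StarGroup ρ ⧸ starCenter ρ}
    (hι : ∀ x : cover ρ, ι (coverProj ρ x : G) = ((x : StarGroup ρ) : StarGroup ρ ⧸ starCenter ρ))
    {H : Subgroup G} (hH : N ≤ H) (x : cover ρ) :
    (x : StarGroup ρ) ∈ corr ι H ↔ coverProj ρ x ∈ H := by
  change ι.symm ((x : StarGroup ρ) : StarGroup ρ ⧸ starCenter ρ) ∈ quot N H ↔ _
  rw [← hι, MulEquiv.symm_apply_apply]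
  constructor
  · rintro ⟨h, hh, hhx⟩
    have h1 := hH (QuotientGroup.eq.1 hhx)
    simpa using H.mul_mem hh h1
  · exact fun h => ⟨_, h, rfl⟩

/-- The bridge between a subgroup `H` over `N` and the corresponding subgroup of the quotient of
the covering group. -/
def coverBridge (hρ : ρ.IsIrreducible) [IsAlgClosed k] [FiniteDimensional k X]
    (hsurj : Function.Surjective (coverProj ρ)) {ι : G ⧸ N ≃* StarGroup ρ ⧸ starCenter ρ}
    (hι : ∀ x : cover ρ, ι (coverProj ρ x : G) = ((x : StarGroup ρ) : StarGroup ρ ⧸ starCenter ρ))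
    {lam : starCenter ρ →* k} (hlam : ∀ x : (coverProj ρ).ker,
      coverRep ρ x.1 = lam (starEquiv ρ x)⁻¹ • (1 : End k X)) (H : Subgroup G) (hH : N ≤ H) :
    Bridge k N (starCenter ρ) H (corr ι H) (H.comap (coverProj ρ)) X where
  i := Subgroup.inclusion hH
  i' := Subgroup.inclusion (le_corr ι H)
  a := (coverProj ρ).subgroupComap H
  b := MonoidHom.codRestrict ((QuotientGroup.mk' (coverEmb ρ).range).comp (Subgroup.subtype _))
    (corr ι H) fun x => (mk_mem_corr hι hH x.1).2 x.2
  c := MonoidHom.codRestrict (coverEmb ρ) (H.comap (coverProj ρ)) fun n => hH n.2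
  W := (coverRep ρ).comp (Subgroup.subtype _)
  lam := lam
  a_surj := by
    rintro ⟨h, hh⟩
    obtain ⟨x, rfl⟩ := hsurj h
    exact ⟨⟨x, hh⟩, rfl⟩
  b_surj := by
    rintro ⟨y, hy⟩
    obtain ⟨x, rfl⟩ := QuotientGroup.mk_surjective y
    exact ⟨⟨x, (mk_mem_corr hι hH x).1 hy⟩, rfl⟩
  a_c n := rfl
  b_c n := Subtype.ext ((mk_eq_one_iff ρ).2 ⟨n, rfl⟩)
  ker_b x hx := by
    obtain ⟨n, hn⟩ := (mk_eq_one_iff ρ).1 (congrArg Subtype.val hx)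
    exact ⟨n, Subtype.ext hn⟩
  irr := hρ
  central z h := Subtype.ext
    (Subgroup.mem_center_iff.1 (starCenter_le_center hρ z.2) h.1).symm
  ker_a x hx :=
    ⟨starEquiv ρ ⟨x.1, congrArg Subtype.val hx⟩, rfl, hlam ⟨x.1, congrArg Subtype.val hx⟩⟩
  scalar z := by
    obtain ⟨x, rfl⟩ := (starEquiv ρ).surjective z
    exact ⟨⟨x.1, by rw [Subgroup.mem_comap, x.2]; exact one_mem _⟩, Subtype.ext x.2, rfl, hlam x⟩

end Star

end CharTriple

end

noncomputable section

namespace CharTriple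

open Module Representation

/-! ### Isomorphisms of triples with respect to a lift -/

section LiftTriple

variable {k : Type} [Field k] (Λ : CharLift k) (p : ℕ) {G : Type u} [Group G]

/-- The Brauer characters of `H` over `θ`. -/
def LiftChOver {N H : Subgroup G} (hNH : N ≤ H) (θ : PReg p N → ℂ) : Set (PReg p H → ℂ) :=
  {χ | Λ.IsBrauer p χ ∧ IsOver (Subgroup.inclusion hNH) θ χ}

/-- The irreducible Brauer characters of `H` over `θ`. -/
def LiftIrrOver {N H : Subgroup G} (hNH : N ≤ H) (θ : PReg p N → ℂ) : Set (PReg p H → ℂ) :=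
  {χ | Λ.IsIrrBrauer p χ ∧ IsOver (Subgroup.inclusion hNH) θ χ}

/-- An isomorphism of triples for the Brauer characters with respect to a lift. -/
structure LiftTripleIso {G' : Type w} [Group G'] (N : Subgroup G) [N.Normal] (θ : PReg p N → ℂ)
    (N' : Subgroup G') [N'.Normal] (θ' : PReg p N' → ℂ) where
  ι : G ⧸ N ≃* G' ⧸ N'
  σ : ∀ H : Subgroup G, N ≤ H → (PReg p H → ℂ) → (PReg p (corr ι H) → ℂ)
  mapsTo : ∀ (H : Subgroup G) (hH : N ≤ H),
    Set.MapsTo (σ H hH) (LiftChOver Λ p hH θ) (LiftChOver Λ p (le_corr ι H) θ')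
  bijOn_irr : ∀ (H : Subgroup G) (hH : N ≤ H),
    Set.BijOn (σ H hH) (LiftIrrOver Λ p hH θ) (LiftIrrOver Λ p (le_corr ι H) θ')
  add : ∀ (H : Subgroup G) (hH : N ≤ H), ∀ χ ∈ LiftChOver Λ p hH θ, ∀ ψ ∈ LiftChOver Λ p hH θ,
    σ H hH (χ + ψ) = σ H hH χ + σ H hH ψ
  res : ∀ (K H : Subgroup G) (hK : N ≤ K) (hKH : K ≤ H), ∀ χ ∈ LiftChOver Λ p (hK.trans hKH) θ,
    σ K hK (χ ∘ PReg.map (Subgroup.inclusion hKH)) =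
      σ H (hK.trans hKH) χ ∘ PReg.map (Subgroup.inclusion (corr_mono ι hKH))
  mul : ∀ (H : Subgroup G) (hH : N ≤ H), ∀ χ ∈ LiftChOver Λ p hH θ,
    ∀ β : PReg p (quot N H) → ℂ, Λ.IsIrrBrauer p β →
      σ H hH (χ * (β ∘ PReg.map (toQuot N H))) = σ H hH χ * (β ∘ PReg.map (corrToQuot ι H))

end LiftTriple

section Main

variable {k : Type} [Field k] [IsAlgClosed k] {Λ : CharLift k} {p : ℕ} [CharP k p]
  {G : Type u} [Group G] [Finite G] {N : Subgroup G} [N.Normal]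
  {X : Type} [AddCommGroup X] [Module k X] [FiniteDimensional k X] {ρ : Representation k N X}

variable (Λ p) in
/-- The isomorphism of triples given by the covering group. -/
def coverTripleIso (hρ : ρ.IsIrreducible)
    (hsurj : Function.Surjective (coverProj ρ)) {ι : G ⧸ N ≃* StarGroup ρ ⧸ starCenter ρ}
    (hι : ∀ x : cover ρ, ι (coverProj ρ x : G) = ((x : StarGroup ρ) : StarGroup ρ ⧸ starCenter ρ))
    {lam : starCenter ρ →* k} (hlam : ∀ x : (coverProj ρ).ker,
      coverRep ρ x.1 = lam (starEquiv ρ x)⁻¹ • (1 : End k X)) :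
    LiftTripleIso Λ p N (Λ.brauer p ρ) (starCenter ρ) (Λ.brauer p (scalarRep lam)) :=
  have := finite_cover hρ
  { ι := ι
    σ := fun H hH => (coverBridge hρ hsurj hι hlam H hH).sigma Λ
    mapsTo := fun H hH χ hχ => by
      have := Bridge.sigma_spec (B := coverBridge hρ hsurj hι hlam H hH) hχ.1 hχ.2
      exact ⟨this.1, this.2.1⟩
    bijOn_irr := fun H hH => Bridge.bijOn_sigma (B := coverBridge hρ hsurj hι hlam H hH)
    add := fun H hH χ hχ ψ hψ => by
      have h1 := Bridge.sigma_spec (B := coverBridge hρ hsurj hι hlam H hH) hχ.1 hχ.2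
      have h2 := Bridge.sigma_spec (B := coverBridge hρ hsurj hι hlam H hH) hψ.1 hψ.2
      exact Bridge.sigma_eq (h1.1.add h2.1) (h1.2.1.add h2.2.1) (h1.2.2.add h2.2.2)
    res := fun K H hK hKH χ hχ => by
      have h1 := Bridge.sigma_spec
        (B := coverBridge hρ hsurj hι hlam H (hK.trans hKH)) hχ.1 hχ.2
      refine Bridge.sigma_eq (B := coverBridge hρ hsurj hι hlam K hK) (h1.1.comp _) ?_ ?_
      · obtain ⟨e, he⟩ := h1.2.1
        exact ⟨e, he⟩
      · exact fun x => h1.2.2 (PReg.map (Subgroup.inclusion (Subgroup.comap_mono hKH)) x)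
    mul := fun H hH χ hχ β hβ => by
      have h1 := Bridge.sigma_spec (B := coverBridge hρ hsurj hι hlam H hH) hχ.1 hχ.2
      refine Bridge.sigma_eq (B := coverBridge hρ hsurj hι hlam H hH)
        (h1.1.mul (hβ.isBrauer.comp _)) ?_ ?_
      · obtain ⟨e, he⟩ := h1.2.1
        obtain ⟨n, σ, hσ, rfl⟩ := hβ
        -- The inflation of `β` is constant on `N'`, equal to its degree `n`.
        refine ⟨e * n, fun z => ?_⟩
        rw [Pi.mul_apply, Function.comp_apply, Λ.brauer_apply_one, finrank_fin_fun]
        · have := he z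
          rw [show (coverBridge hρ hsurj hι hlam H hH).i' =
            Subgroup.inclusion (le_corr ι H) from rfl] at this ⊢
          rw [this]
          push_cast
          ring
        · refine Subtype.ext ?_
          change ι.symm ((z.1 : StarGroup ρ) : StarGroup ρ ⧸ starCenter ρ) = 1
          rw [(QuotientGroup.eq_one_iff _).2 z.1.2, map_one]
      · intro x
        rw [Pi.mul_apply, Pi.mul_apply, h1.2.2, mul_assoc]
        congr 2
        simp only [Function.comp_apply]
        congr 1
        -- The two routes from the cover to `G/N`, directly and through `ι`, agree.
        refine Subtype.ext (Subtype.ext ?_)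
        change ((coverProj ρ x.1.1 : G) : G ⧸ N) =
          ι.symm ((x.1.1 : StarGroup ρ) : StarGroup ρ ⧸ starCenter ρ)
        rw [← hι, MulEquiv.symm_apply_apply] }

variable {A : Type v} [Group A] [MulDistribMulAction A G]

/-- The action on the quotient of the covering group. -/
@[reducible] def starAction (hρ : ρ.IsIrreducible) {hN : ∀ (a : A), ∀ n ∈ N, a • n ∈ N}
    {Q : A → (End k X)ˣ}
    (hQ : ∀ a n, (Q a : End k X) * ρ n = ρ (actHom N hN a n) * Q a) :
    MulDistribMulAction A (StarGroup ρ) where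
  smul a := QuotientGroup.map (coverEmb ρ).range (coverEmb ρ).range (coverAct hQ a) (by
    rintro _ ⟨n, rfl⟩
    exact ⟨_, (coverAct_coverEmb hQ a n).symm⟩)
  one_smul y := by
    obtain ⟨x, rfl⟩ := QuotientGroup.mk_surjective y
    exact congrArg _ (coverAct_one hQ hρ x)
  mul_smul a b y := by
    obtain ⟨x, rfl⟩ := QuotientGroup.mk_surjective y
    exact congrArg _ (coverAct_mul hQ hρ a b x)
  smul_mul a y y' := map_mul _ y y'
  smul_one a := map_one _

/-- The common form of both parts. The triple is the quotient of the cover with conjugation by the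
operators `Q a` as action; `θ'` is invariant because this action is trivial on the scalars. -/
theorem exists_liftTripleIso {hN : ∀ (a : A), ∀ n ∈ N, a • n ∈ N} {θ : PReg p N → ℂ}
    (hθ : Λ.IsIrrBrauer p θ)
    (hinv : ∀ (g : G) (n : PReg p N),
      θ (PReg.map (MulAut.conjNormal g : N ≃* N).toMonoidHom n) = θ n)
    (hact : ∀ a : A, θ ∘ PReg.map (actHom N hN a) = θ) :
    ∃ (G' : Type u) (_ : Group G') (_ : Finite G') (_ : MulDistribMulAction A G')
      (N' : Subgroup G') (_ : N'.Normal) (θ' : PReg p N' → ℂ)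
      (hN' : ∀ (a : A), ∀ n ∈ N', a • n ∈ N'),
      Λ.IsIrrBrauer p θ' ∧
      (∀ (g : G') (n : PReg p N'),
        θ' (PReg.map (MulAut.conjNormal g : N' ≃* N').toMonoidHom n) = θ' n) ∧
      (∀ a : A, θ' ∘ PReg.map (actHom N' hN' a) = θ') ∧
      N' ≤ Subgroup.center G' ∧ ¬ p ∣ Nat.card N' ∧
      ∃ I : LiftTripleIso Λ p N θ N' θ',
        (∀ (a : A) (x : G ⧸ N), I.ι (quotAct N hN a x) = quotAct N' hN' a (I.ι x)) ∧
        (∀ (a : A), ∀ χ ∈ LiftChOver Λ p (le_top : N ≤ ⊤) θ,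
          I.σ ⊤ le_top (χ ∘ PReg.map (actHom ⊤ (fun _ _ _ => Subgroup.mem_top _) a)) =
            I.σ ⊤ le_top χ ∘ PReg.map (actHom _ (fun _ _ _ => mem_corr_top I.ι _) a)) := by
  obtain ⟨d, ρ, hρ, rfl⟩ := hθ
  have hsurj : Function.Surjective (coverProj ρ) := coverProj_surjective hρ fun g =>
    exists_unit_intertwining (p := p) (Λ := Λ) hρ (MulAut.conjNormal g) (funext (hinv g))
  have hQex : ∀ a : A, ∃ P : (End k (Fin d → k))ˣ,
      ∀ n, (P : End k (Fin d → k)) * ρ n = ρ (actHom N hN a n) * P := fun a => by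
    let f : N ≃* N := MonoidHom.toMulEquiv (actHom N hN a) (actHom N hN a⁻¹)
      (MonoidHom.ext fun x => Subtype.ext (inv_smul_smul a (x : G)))
      (MonoidHom.ext fun x => Subtype.ext (smul_inv_smul a (x : G)))
    exact exists_unit_intertwining (p := p) (Λ := Λ) hρ f (hact a)
  choose Q hQ using hQex
  obtain ⟨ι, hι⟩ := exists_quotient_equiv hsurj
  obtain ⟨lam, hlam⟩ := exists_star_hom hρ
  have hfin := finite_cover hρ
  let inst := starAction hρ hQ
  have hsmul : ∀ (a : A) (x : cover ρ),
      a • (x : StarGroup ρ) = (coverAct hQ a x : StarGroup ρ) := fun a x => rfl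
  have htriv : ∀ (a : A), ∀ z ∈ starCenter ρ, a • z = z := by
    rintro a _ ⟨x, hx, rfl⟩
    exact congrArg _ (coverAct_of_mem_ker hQ hρ a hx)
  have hN' : ∀ (a : A), ∀ n ∈ starCenter ρ, a • n ∈ starCenter ρ := fun a z hz => by
    rwa [htriv a z hz]
  have hcen := starCenter_le_center hρ
  have hact' : ∀ a : A, actHom (starCenter ρ) hN' a = MonoidHom.id _ := fun a =>
    MonoidHom.ext fun z => Subtype.ext (htriv a z z.2)
  have hconj : ∀ g : StarGroup ρ, (MulAut.conjNormal g : starCenter ρ ≃* starCenter ρ).toMonoidHom =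
      MonoidHom.id _ := fun g => MonoidHom.ext fun z => Subtype.ext (by
    change g * z * g⁻¹ = z
    rw [Subgroup.mem_center_iff.1 (hcen z.2) g, mul_inv_cancel_right])
  refine ⟨StarGroup ρ, inferInstance, inferInstance, inst, starCenter ρ, inferInstance,
    Λ.brauer p (scalarRep lam), hN', Λ.isIrrBrauer_brauer (isIrreducible_scalarRep lam), ?_, ?_,
    hcen, not_dvd_card_starCenter hρ, coverTripleIso Λ p hρ hsurj hι hlam, ?_, ?_⟩
  · intro g z
    rw [hconj]
    rfl
  · intro a
    rw [hact']
    rfl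
  · intro a y
    obtain ⟨g, rfl⟩ := QuotientGroup.mk_surjective y
    obtain ⟨x, rfl⟩ := hsurj g
    change ι ((a • coverProj ρ x : G) : G ⧸ N) = quotAct _ hN' a (ι ((coverProj ρ x : G) : G ⧸ N))
    rw [hι, ← coverProj_coverAct hQ, hι]
    rfl
  · intro a χ hχ
    have h1 := Bridge.sigma_spec (B := coverBridge hρ hsurj hι hlam ⊤ le_top) hχ.1 hχ.2
    refine Bridge.sigma_eq (B := coverBridge hρ hsurj hι hlam ⊤ le_top) (h1.1.comp _) ?_ ?_
    · obtain ⟨e, he⟩ := h1.2.1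
      refine ⟨e, fun z => ?_⟩
      rw [← he z]
      exact congrArg ((coverBridge hρ hsurj hι hlam ⊤ le_top).sigma Λ χ)
        (Subtype.ext (Subtype.ext (htriv a z.1 z.1.2)))
    · intro x
      let α : (⊤ : Subgroup G).comap (coverProj ρ) →* (⊤ : Subgroup G).comap (coverProj ρ) :=
        MonoidHom.codRestrict ((coverAct hQ a).comp (Subgroup.subtype _)) _
          fun _ => Subgroup.mem_top _
      have h2 := h1.2.2 (PReg.map α x)
      -- The automorphism induced by `a` changes `W` only by conjugation with `Q a`, so its
      -- character is unchanged and the product formula for `χ` pulls back to the twisted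
      -- characters.
      have h3 : Λ.brauer p (coverBridge hρ hsurj hι hlam ⊤ le_top).W (PReg.map α x) =
          Λ.brauer p (coverBridge hρ hsurj hι hlam ⊤ le_top).W x := by
        rw [CharLift.brauer, CharLift.brauer]
        refine congrArg _ (Λ.trLift_conj (LinearMap.GeneralLinearGroup.generalLinearEquiv k _ (Q a))
          _ _ fun v => ?_).symm
        change (Q a : End k (Fin d → k)) (coverRep ρ x.1.1 v) =
          ((Q a : End k (Fin d → k)) * coverRep ρ x.1.1 *
            (((Q a)⁻¹ : (End k (Fin d → k))ˣ) : End k (Fin d → k)) : End k (Fin d → k))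
            ((Q a : End k (Fin d → k)) v)
        rw [← Module.End.mul_apply, ← Module.End.mul_apply, mul_assoc, Units.inv_mul, mul_one]
      rw [h3] at h2
      exact h2

end Main

end CharTriple

end

noncomputable section

namespace CharTriple

open Module Representation

/-! ### Ordinary characters -/

section Ordinary

/-- The trivial lift, for ordinary characters. -/
def ordLift : CharLift ℂ where
  ring := ⊤
  red := Subring.subtype ⊤
  lift :=
    { toFun := fun x => ⟨x, trivial⟩
      map_one' := rfl
      map_mul' := fun _ _ => rfl }
  red_lift _ := rfl

instance : CharP ℂ 0 := CharP.ofCharZero ℂ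

/-- Every element of a finite group is `0`-regular. -/
def toPReg {G : Type u} [Group G] [Finite G] (g : G) : PReg 0 G :=
  ⟨g, by rw [zero_dvd_iff]; exact (orderOf_pos g).ne'⟩

variable {G : Type u} [Group G]

theorem ordLift_trLift {V : Type} [AddCommGroup V] [Module ℂ V] [FiniteDimensional ℂ V]
    (f : End ℂ V) : (ordLift.trLift f : ℂ) = LinearMap.trace ℂ V f :=
  ordLift.red_trLift f

theorem ordLift_brauer {V : Type} [AddCommGroup V] [Module ℂ V] [FiniteDimensional ℂ V]
    (ρ : Representation ℂ G V) : ordLift.brauer 0 ρ = fun g : PReg 0 G => ρ.character (g : G) :=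
  funext fun _ => ordLift_trLift _

theorem IsChar.isBrauer {χ : G → ℂ} (h : IsChar χ) :
    ordLift.IsBrauer 0 (fun g : PReg 0 G => χ g) := by
  obtain ⟨n, ρ, hn, rfl⟩ := h
  exact ⟨n, ρ, hn, (ordLift_brauer ρ).symm⟩

theorem IsIrr.isIrrBrauer {χ : G → ℂ} (h : IsIrr χ) :
    ordLift.IsIrrBrauer 0 (fun g : PReg 0 G => χ g) := by
  obtain ⟨n, ρ, hn, rfl⟩ := h
  exact ⟨n, ρ, hn, (ordLift_brauer ρ).symm⟩

theorem charInner_eq_sum [Fintype G] (χ ψ : G → ℂ) :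
    charInner χ ψ = (Nat.card G : ℂ)⁻¹ * ∑ g : G, χ g * star (ψ g) := by
  rw [charInner, finsum_eq_sum_of_fintype]

variable [Finite G]

theorem isChar_of_isBrauer {φ : PReg 0 G → ℂ} (h : ordLift.IsBrauer 0 φ) :
    IsChar (φ ∘ toPReg) := by
  obtain ⟨n, ρ, hn, rfl⟩ := h
  refine ⟨n, ρ, hn, ?_⟩
  rw [ordLift_brauer]
  rfl

theorem isIrr_of_isIrrBrauer {φ : PReg 0 G → ℂ} (h : ordLift.IsIrrBrauer 0 φ) :
    IsIrr (φ ∘ toPReg) := by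
  obtain ⟨n, ρ, hn, rfl⟩ := h
  refine ⟨n, ρ, hn, ?_⟩
  rw [ordLift_brauer]
  rfl

theorem charInner_add_left (χ χ' ψ : G → ℂ) :
    charInner (χ + χ') ψ = charInner χ ψ + charInner χ' ψ := by
  have := Fintype.ofFinite G
  simp only [charInner_eq_sum, Pi.add_apply, add_mul, Finset.sum_add_distrib, mul_add]

theorem charInner_add_right (χ ψ ψ' : G → ℂ) :
    charInner χ (ψ + ψ') = charInner χ ψ + charInner χ ψ' := by
  have := Fintype.ofFinite G
  simp only [charInner_eq_sum, Pi.add_apply, star_add, mul_add, Finset.sum_add_distrib]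

theorem charInner_zero_left (ψ : G → ℂ) : charInner 0 ψ = 0 := by
  have := Fintype.ofFinite G
  simp [charInner_eq_sum]

theorem charInner_zero_right (χ : G → ℂ) : charInner χ 0 = 0 := by
  have := Fintype.ofFinite G
  simp [charInner_eq_sum]

theorem charInner_multiset_sum_left (s : Multiset (PReg 0 G → ℂ)) (ψ : G → ℂ) :
    charInner (s.sum ∘ toPReg) ψ = (s.map fun χ => charInner (χ ∘ toPReg) ψ).sum := by
  induction s using Multiset.induction_on with
  | empty => exact charInner_zero_left _
  | cons χ s ih =>
    rw [Multiset.sum_cons, Multiset.map_cons, Multiset.sum_cons, ← ih]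
    exact charInner_add_left _ _ _

theorem charInner_multiset_sum_right (χ : G → ℂ) (t : Multiset (PReg 0 G → ℂ)) :
    charInner χ (t.sum ∘ toPReg) = (t.map fun ψ => charInner χ (ψ ∘ toPReg)).sum := by
  induction t using Multiset.induction_on with
  | empty => exact charInner_zero_right _
  | cons ψ t ih =>
    rw [Multiset.sum_cons, Multiset.map_cons, Multiset.sum_cons, ← ih]
    exact charInner_add_right _ _ _

theorem charInner_multiset_sum (s t : Multiset (PReg 0 G → ℂ)) :
    charInner (s.sum ∘ toPReg) (t.sum ∘ toPReg) =
      (s.map fun χ => (t.map fun ψ => charInner (χ ∘ toPReg) (ψ ∘ toPReg)).sum).sum := by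
  rw [charInner_multiset_sum_left]
  exact congrArg _ (Multiset.map_congr rfl fun χ _ => charInner_multiset_sum_right _ t)

/-- The eigenvalues of `ρ g` are roots of unity, whose inverses are their conjugates. -/
theorem character_inv {n : ℕ} (ρ : Representation ℂ G (Fin n → ℂ)) (g : G) :
    ρ.character g⁻¹ = star (ρ.character g) := by
  have hm : (orderOf g : ℂ) ≠ 0 := by exact_mod_cast (orderOf_pos g).ne'
  have hpow : ρ g ^ orderOf g = 1 := by rw [← map_pow, pow_orderOf_eq_one, map_one]
  obtain ⟨ι, _, b, μ, hμ⟩ := exists_eigenbasis (ρ g) hm hpow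
  have hμ1 : ∀ i, μ i ^ orderOf g = 1 := fun i => by
    have h1 : ∀ l : ℕ, (ρ g ^ l) (b i) = μ i ^ l • b i := fun l => by
      induction l with
      | zero => simp
      | succ l ih => rw [pow_succ', Module.End.mul_apply, ih, map_smul, hμ, smul_smul, pow_succ]
    have h2 := h1 (orderOf g)
    rw [hpow, Module.End.one_apply] at h2
    exact (smul_left_injective ℂ (b.ne_zero i) ((one_smul ℂ _).trans h2)).symm
  have hinv : ∀ i, ρ g⁻¹ (b i) = star (μ i) • b i := fun i => by
    have h3 : star (μ i) * μ i = 1 := by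
      have h4 : ‖μ i‖ = 1 := Complex.norm_eq_one_of_pow_eq_one (hμ1 i) (orderOf_pos g).ne'
      have := Complex.normSq_eq_conj_mul_self (z := μ i)
      rw [Complex.normSq_eq_norm_sq, h4] at this
      simpa using this.symm
    have h4 : ρ g⁻¹ (ρ g (b i)) = b i := Representation.inv_self_apply ρ g _
    rw [hμ, map_smul] at h4
    rw [← one_smul ℂ (ρ g⁻¹ (b i)), ← h3, mul_smul, h4]
  have h5 : ∀ (f : End ℂ (Fin n → ℂ)) (ν : ι → ℂ), (∀ i, f (b i) = ν i • b i) →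
      LinearMap.trace ℂ _ f = ∑ i, ν i := fun f ν hν => by
    rw [← ordLift_trLift, ordLift.trLift_of_eigenbasis f b ν hν]
    exact map_sum (Subring.subtype (⊤ : Subring ℂ)) _ _
  rw [Representation.character, h5 _ _ hinv, Representation.character, h5 _ _ hμ, star_sum]

theorem charInner_of_irr {χ ψ : PReg 0 G → ℂ} (hχ : ordLift.IsIrrBrauer 0 χ)
    (hψ : ordLift.IsIrrBrauer 0 ψ) [Decidable (χ = ψ)] :
    charInner (χ ∘ toPReg) (ψ ∘ toPReg) = if χ = ψ then 1 else 0 := by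
  classical
  have := Fintype.ofFinite G
  obtain ⟨n, ρ, hρ, rfl⟩ := hχ
  obtain ⟨m, σ, hσ, rfl⟩ := hψ
  have : Invertible (Nat.card G : ℂ) := invertibleOfNonzero (by exact_mod_cast Nat.card_pos.ne')
  have h1 := Representation.char_orthonormal ρ σ
  have h2 : Nonempty (σ.Equiv ρ) ↔ ordLift.brauer 0 ρ = ordLift.brauer 0 σ :=
    ⟨fun ⟨e⟩ => (ordLift.brauer_congr e).symm,
      fun h => ordLift.nonempty_equiv_of_brauer_eq hσ hρ h.symm⟩
  rw [charInner_eq_sum]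
  simp only [h2, character_inv] at h1
  have h3 : ∀ {l : ℕ} (τ : Representation ℂ G (Fin l → ℂ)) (g : G),
      (ordLift.brauer 0 τ ∘ toPReg) g = τ.character g := fun τ g => by
    rw [ordLift_brauer]
    rfl
  simp only [h3]
  rw [h1]

end Ordinary

/-! ### Isomorphisms of ordinary character triples -/

section OrdinaryIso

variable {G : Type u} [Group G]

theorem mem_liftChOver_of_mem_chOver {N H : Subgroup G} {hNH : N ≤ H} {θ : N → ℂ} {χ : H → ℂ}
    (h : χ ∈ ChOver hNH θ) :
    (fun x : PReg 0 H => χ x) ∈ LiftChOver ordLift 0 hNH (fun x : PReg 0 N => θ x) :=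
  ⟨h.1.isBrauer, h.2.imp fun _ he n => he n⟩

theorem mem_liftIrrOver_of_mem_irrOver {N H : Subgroup G} {hNH : N ≤ H} {θ : N → ℂ} {χ : H → ℂ}
    (h : χ ∈ IrrOver hNH θ) :
    (fun x : PReg 0 H => χ x) ∈ LiftIrrOver ordLift 0 hNH (fun x : PReg 0 N => θ x) :=
  ⟨h.1.isIrrBrauer, h.2.2.imp fun _ he n => he n⟩

variable {G' : Type w} [Group G'] {N : Subgroup G} [N.Normal] {θ : PReg 0 N → ℂ}
  {N' : Subgroup G'} [N'.Normal] {θ' : PReg 0 N' → ℂ}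

/-- The empty sum is excluded because zero is not a character and `σ` is unconstrained there. -/
theorem LiftTripleIso.σ_multiset_sum (I : LiftTripleIso ordLift 0 N θ N' θ') {H : Subgroup G}
    (hH : N ≤ H) (s : Multiset (PReg 0 H → ℂ)) (hs : s ≠ 0)
    (h : ∀ φ ∈ s, φ ∈ LiftChOver ordLift 0 hH θ) :
    I.σ H hH s.sum = (s.map (I.σ H hH)).sum := by
  induction s using Multiset.induction_on with
  | empty => exact absurd rfl hs
  | cons a s ih =>
    rw [Multiset.sum_cons, Multiset.map_cons, Multiset.sum_cons]
    rcases eq_or_ne s 0 with rfl | hs'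
    · simp
    · have h' := fun φ hφ => h φ (Multiset.mem_cons_of_mem hφ)
      rw [I.add H hH a (h a (by simp)) s.sum
        ⟨CharLift.IsBrauer.multiset_sum s hs' fun φ hφ => (h' φ hφ).1,
          IsOver.multiset_sum s fun φ hφ => (h' φ hφ).2⟩, ih hs' h']

variable [Finite G]

theorem mem_chOver_of_mem_liftChOver {N H : Subgroup G} {hNH : N ≤ H} {θ : PReg 0 N → ℂ}
    {χ : PReg 0 H → ℂ} (h : χ ∈ LiftChOver ordLift 0 hNH θ) :
    χ ∘ toPReg ∈ ChOver hNH (θ ∘ toPReg) :=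
  ⟨isChar_of_isBrauer h.1, h.2.imp fun _ he n => he (toPReg n)⟩

theorem mem_irrOver_of_mem_liftIrrOver {N H : Subgroup G} {hNH : N ≤ H} {θ : PReg 0 N → ℂ}
    {χ : PReg 0 H → ℂ} (h : χ ∈ LiftIrrOver ordLift 0 hNH θ) :
    χ ∘ toPReg ∈ IrrOver hNH (θ ∘ toPReg) :=
  ⟨isIrr_of_isIrrBrauer h.1, mem_chOver_of_mem_liftChOver ⟨h.1.isBrauer, h.2⟩⟩

variable [Finite G']

/-- Irreducible characters are orthonormal, and `σ` is additive and injective on those over `θ`, so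
the inner products agree after decomposition. -/
theorem LiftTripleIso.charInner_σ (I : LiftTripleIso ordLift 0 N θ N' θ')
    (hθ : ordLift.IsIrrBrauer 0 θ) {H : Subgroup G} (hH : N ≤ H) {χ ψ : PReg 0 H → ℂ}
    (hχ : χ ∈ LiftChOver ordLift 0 hH θ) (hψ : ψ ∈ LiftChOver ordLift 0 hH θ) :
    charInner (I.σ H hH χ ∘ toPReg) (I.σ H hH ψ ∘ toPReg) =
      charInner (χ ∘ toPReg) (ψ ∘ toPReg) := by
  classical
  have key : ∀ {χ : PReg 0 H → ℂ}, χ ∈ LiftChOver ordLift 0 hH θ →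
      ∃ s : Multiset (PReg 0 H → ℂ), (∀ φ ∈ s, φ ∈ LiftIrrOver ordLift 0 hH θ) ∧ s.sum = χ ∧
        I.σ H hH χ = (s.map (I.σ H hH)).sum := fun {χ} hχ => by
    obtain ⟨s, hs, rfl, hs0⟩ := hχ.1.exists_multiset zero_ne_one
    have hover := isOver_of_mem hθ hs hχ.2
    exact ⟨s, fun φ hφ => ⟨hs φ hφ, hover φ hφ⟩, rfl,
      I.σ_multiset_sum hH s hs0 fun φ hφ => ⟨(hs φ hφ).isBrauer, hover φ hφ⟩⟩
  obtain ⟨s, hs, rfl, hσs⟩ := key hχ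
  obtain ⟨t, ht, rfl, hσt⟩ := key hψ
  rw [hσs, hσt, charInner_multiset_sum, charInner_multiset_sum, Multiset.map_map]
  refine congrArg _ (Multiset.map_congr rfl fun φ hφ => ?_)
  rw [Function.comp_apply, Multiset.map_map]
  refine congrArg _ (Multiset.map_congr rfl fun φ' hφ' => ?_)
  have hb := I.bijOn_irr H hH
  rw [Function.comp_apply, charInner_of_irr (hb.mapsTo (hs φ hφ)).1 (hb.mapsTo (ht φ' hφ')).1,
    charInner_of_irr (hs φ hφ).1 (ht φ' hφ').1]
  exact if_congr (hb.injOn.eq_iff (hs φ hφ) (ht φ' hφ')) rfl rfl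

/-- The isomorphism of character triples given by an isomorphism with respect to the trivial
lift. -/
def LiftTripleIso.toTripleIso (I : LiftTripleIso ordLift 0 N θ N' θ')
    (hθ : ordLift.IsIrrBrauer 0 θ) : TripleIso N (θ ∘ toPReg) N' (θ' ∘ toPReg) where
  ι := I.ι
  σ H hH χ := I.σ H hH (fun x : PReg 0 H => χ x) ∘ toPReg
  mapsTo H hH _ hχ :=
    mem_chOver_of_mem_liftChOver (I.mapsTo H hH (mem_liftChOver_of_mem_chOver hχ))
  bijOn_irr H hH := by
    have hb := I.bijOn_irr H hH
    refine ⟨fun χ hχ =>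
      mem_irrOver_of_mem_liftIrrOver (hb.mapsTo (mem_liftIrrOver_of_mem_irrOver hχ)),
      fun χ hχ ψ hψ h => ?_, fun ψ hψ => ?_⟩
    · have h' := hb.injOn (mem_liftIrrOver_of_mem_irrOver hχ) (mem_liftIrrOver_of_mem_irrOver hψ)
        (funext fun x => congrFun h x.1)
      exact funext fun x => congrFun h' (toPReg x)
    · obtain ⟨χ, hχ, h⟩ := hb.surjOn (mem_liftIrrOver_of_mem_irrOver hψ)
      exact ⟨χ ∘ toPReg, mem_irrOver_of_mem_liftIrrOver hχ,
        funext fun x => congrFun h (toPReg x)⟩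
  add H hH χ hχ ψ hψ := congrArg (· ∘ toPReg)
    (I.add H hH _ (mem_liftChOver_of_mem_chOver hχ) _ (mem_liftChOver_of_mem_chOver hψ))
  inner H hH χ hχ ψ hψ :=
    I.charInner_σ hθ hH (mem_liftChOver_of_mem_chOver hχ) (mem_liftChOver_of_mem_chOver hψ)
  res K H hK hKH χ hχ :=
    congrArg (· ∘ toPReg) (I.res K H hK hKH _ (mem_liftChOver_of_mem_chOver hχ))
  mul H hH χ hχ β hβ := congrArg (· ∘ toPReg)
    (I.mul H hH _ (mem_liftChOver_of_mem_chOver hχ) _ hβ.isIrrBrauer)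

end OrdinaryIso

end CharTriple

end

noncomputable section

namespace CharTriple

open Module Representation Polynomial

theorem ne_zero_of_mem_roots_charpoly {k : Type v} {V : Type w} {G : Type u} [Field k]
    [AddCommGroup V] [Module k V] [FiniteDimensional k V] [Group G] (ρ : Representation k G V)
    (g : G) {x : k} (hx : x ∈ (ρ g).charpoly.roots) : x ≠ 0 := by
  rintro rfl
  obtain ⟨v, hv, hv0⟩ := ((Module.End.hasEigenvalue_iff_isRoot_charpoly _ _).2
    (isRoot_of_mem_roots hx)).exists_hasEigenvector
  rw [Module.End.mem_eigenspace_iff, zero_smul] at hv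
  have h1 := Representation.inv_self_apply ρ g v
  rw [hv, map_zero] at h1
  exact hv0 h1.symm

/-! ### The residue field of the ring of algebraic integers -/

section Residue

variable (p : ℕ) (M : Ideal AlgInt) [M.IsMaximal]

attribute [local instance] Ideal.Quotient.field

theorem charP_residue (hp : p.Prime) (hM : (p : AlgInt) ∈ M) : CharP (AlgInt ⧸ M) p := by
  refine (CharP.charP_iff_prime_eq_zero hp).2 ?_
  rw [← map_natCast (Ideal.Quotient.mk M)]
  exact Ideal.Quotient.eq_zero_iff_mem.2 hM

/-- A complex root of a monic polynomial over the algebraic integers is integral over `ℤ` by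
transitivity. -/
theorem exists_root_algInt {f : AlgInt[X]} (hf : f.Monic) (hd : f.natDegree ≠ 0) :
    ∃ x, f.eval x = 0 := by
  obtain ⟨z, hz⟩ := IsAlgClosed.exists_root (f.map (algebraMap AlgInt ℂ))
    (by rw [hf.degree_map, degree_eq_natDegree hf.ne_zero]; exact_mod_cast hd)
  have hz' : eval₂ (algebraMap AlgInt ℂ) z f = 0 := by rwa [IsRoot, eval_map] at hz
  have hint : IsIntegral ℤ z := isIntegral_trans z ⟨f, hf, hz'⟩
  refine ⟨⟨z, hint⟩, Subtype.coe_injective ?_⟩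
  have := hom_eval₂ f (RingHom.id _) (algebraMap AlgInt ℂ) ⟨z, hint⟩
  rw [RingHom.comp_id] at this
  exact this.trans hz'

/-- A monic polynomial over the residue field lifts to a monic one of the same degree, which has a
root. -/
theorem isAlgClosed_residue : IsAlgClosed (AlgInt ⧸ M) := by
  refine IsAlgClosed.of_exists_root _ fun f hf hirr => ?_
  obtain ⟨q, hq, hdeg, hmon⟩ := lifts_and_natDegree_eq_and_monic
    (f := Ideal.Quotient.mk M) (p := f) (map_surjective _ Ideal.Quotient.mk_surjective f) hf
  obtain ⟨x, hx⟩ := exists_root_algInt hmon (by rw [hdeg]; exact hirr.natDegree_pos.ne')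
  exact ⟨Ideal.Quotient.mk M x, by rw [← hq, eval_map, eval₂_hom, hx, map_zero]⟩

variable {p M}

/-- `x` is integral over the prime field, so it generates a finite ring and has finite
multiplicative order; Frobenius injectivity keeps `p` out of that order. -/
theorem exists_pow_eq_one_residue [CharP (AlgInt ⧸ M) p] (hp : p.Prime) {x : AlgInt ⧸ M}
    (hx : x ≠ 0) : ∃ m : ℕ, 0 < m ∧ ¬ p ∣ m ∧ x ^ m = 1 := by
  have : Fact p.Prime := ⟨hp⟩
  let _ : Algebra (ZMod p) (AlgInt ⧸ M) := ZMod.algebra _ p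
  have hint : IsIntegral (ZMod p) x := by
    obtain ⟨y, rfl⟩ := Ideal.Quotient.mk_surjective x
    obtain ⟨f, hf, hfy⟩ := (integralClosure.isIntegral y : IsIntegral ℤ y)
    refine ⟨f.map (Int.castRingHom _), hf.map _, ?_⟩
    rw [eval₂_map, ← map_zero (Ideal.Quotient.mk M), ← hfy, hom_eval₂]
    congr 1
    exact RingHom.ext_int _ _
  have : Module.Finite (ZMod p) (Algebra.adjoin (ZMod p) {x}) :=
    Module.Finite.iff_fg.2 hint.fg_adjoin_singleton
  have : Finite (Algebra.adjoin (ZMod p) {x}) := Module.finite_of_finite (ZMod p)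
  obtain ⟨i, j, hij, h⟩ := Finite.exists_ne_map_eq_of_infinite
    fun n : ℕ => (⟨x, Algebra.self_mem_adjoin_singleton _ x⟩ : Algebra.adjoin (ZMod p) {x}) ^ n
  have h : x ^ i = x ^ j := congrArg Subtype.val h
  have hfin : IsOfFinOrder x := by
    rw [isOfFinOrder_iff_pow_eq_one]
    rcases hij.lt_or_gt with hlt | hlt
    · exact ⟨j - i, by omega, by rw [pow_sub₀ x hx hlt.le, ← h, mul_inv_cancel₀ (pow_ne_zero _ hx)]⟩
    · exact ⟨i - j, by omega, by rw [pow_sub₀ x hx hlt.le, h, mul_inv_cancel₀ (pow_ne_zero _ hx)]⟩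
  refine ⟨orderOf x, hfin.orderOf_pos, fun ⟨m, hm⟩ => ?_, pow_orderOf_eq_one x⟩
  have h1 : x ^ m = 1 := by
    apply frobenius_inj (AlgInt ⧸ M) p
    rw [frobenius_def, ← pow_mul, mul_comm m, ← hm, pow_orderOf_eq_one, map_one]
  have hm0 : 0 < m := Nat.pos_of_ne_zero fun h0 => by
    rw [h0, mul_zero] at hm; exact hfin.orderOf_pos.ne' hm
  have := Nat.le_of_dvd hm0 (orderOf_dvd_of_pow_eq_one h1)
  nlinarith [hp.two_le]

/-- The roots of unity of order prime to `p`. -/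
def IsPrimeToRoot (p : ℕ) (ξ : AlgInt) : Prop := ∃ m : ℕ, 0 < m ∧ ¬ p ∣ m ∧ ξ ^ m = 1

theorem IsPrimeToRoot.mul (hp : p.Prime) {ξ η : AlgInt} (h : IsPrimeToRoot p ξ)
    (h' : IsPrimeToRoot p η) : IsPrimeToRoot p (ξ * η) := by
  obtain ⟨m, hm, hpm, h⟩ := h
  obtain ⟨n, hn, hpn, h'⟩ := h'
  exact ⟨m * n, Nat.mul_pos hm hn, hp.not_dvd_mul hpm hpn, by
    rw [mul_pow, pow_mul, h, mul_comm m, pow_mul, h', one_pow, one_pow, one_mul]⟩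

theorem isPrimeToRoot_one (hp : p.Prime) : IsPrimeToRoot p 1 :=
  ⟨1, one_pos, hp.not_dvd_one, one_pow 1⟩

/-- Over the algebraic integers `X ^ m - 1` splits into factors `X - ξ`. Reducing and evaluating at
`x` makes the product zero, so one factor vanishes. -/
theorem exists_isPrimeToRoot [CharP (AlgInt ⧸ M) p] (hp : p.Prime) {x : AlgInt ⧸ M}
    (hx : x ≠ 0) : ∃ ξ : AlgInt, IsPrimeToRoot p ξ ∧ Ideal.Quotient.mk M ξ = x := by
  obtain ⟨m, hm, hpm, hxm⟩ := exists_pow_eq_one_residue hp hx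
  have hζ := Complex.isPrimitiveRoot_exp m hm.ne'
  let ζ : AlgInt := ⟨_, hζ.isIntegral hm⟩
  have hζ' : IsPrimitiveRoot ζ m :=
    IsPrimitiveRoot.of_map_of_injective (f := algebraMap AlgInt ℂ) hζ Subtype.coe_injective
  have h := congrArg (eval₂ (Ideal.Quotient.mk M) x) (X_pow_sub_one_eq_prod hm hζ')
  rw [eval₂_finsetProd] at h
  simp only [eval₂_sub, eval₂_pow, eval₂_X, eval₂_one, eval₂_C, hxm, sub_self] at h
  obtain ⟨ξ, hξ, h0⟩ := Finset.prod_eq_zero_iff.1 h.symm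
  exact ⟨ξ, ⟨m, hm, hpm, (mem_nthRootsFinset hm (1 : AlgInt)).1 hξ⟩, (sub_eq_zero.1 h0).symm⟩

/-- If `ζ = ξ / η` were not `1`, then `1 + ζ + ... + ζ ^ (mn - 1)` would vanish, yet it reduces to
`mn`, which is nonzero modulo `p`. -/
theorem IsPrimeToRoot.eq_of_mk_eq {I : Ideal AlgInt} [CharP (AlgInt ⧸ I) p] (hp : p.Prime)
    {ξ η : AlgInt} (h : IsPrimeToRoot p ξ) (h' : IsPrimeToRoot p η)
    (he : Ideal.Quotient.mk I ξ = Ideal.Quotient.mk I η) : ξ = η := by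
  obtain ⟨m, hm, hpm, h⟩ := h
  obtain ⟨n, hn, hpn, h'⟩ := h'
  have hl : 0 < m * n := Nat.mul_pos hm hn
  have hξ : ξ ^ (m * n) = 1 := by rw [pow_mul, h, one_pow]
  have hη : η ^ (m * n) = 1 := by rw [mul_comm, pow_mul, h', one_pow]
  have hη' : η ^ (m * n - 1) * η = 1 := by rw [← pow_succ, Nat.sub_add_cancel hl, hη]
  set ζ := ξ * η ^ (m * n - 1) with hζ
  have hζ1 : ζ ^ (m * n) = 1 := by
    rw [hζ, mul_pow, hξ, ← pow_mul, mul_comm (m * n - 1), pow_mul, hη, one_pow, one_mul]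
  have hζ2 : Ideal.Quotient.mk I ζ = 1 := by
    rw [hζ, map_mul, he, ← map_mul, mul_comm, hη', map_one]
  have hζ3 : ζ = 1 := by
    by_contra hne
    have h1 : (∑ i ∈ Finset.range (m * n), ζ ^ i) * (ζ - 1) = 0 := by
      rw [geom_sum_mul, hζ1, sub_self]
    have h2 := (mul_eq_zero.1 h1).resolve_right (sub_ne_zero.2 hne)
    have h3 := congrArg (Ideal.Quotient.mk I) h2
    simp only [map_sum, map_pow, hζ2, one_pow, Finset.sum_const, Finset.card_range, nsmul_eq_mul,
      mul_one, map_zero] at h3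
    exact hp.not_dvd_mul hpm hpn ((CharP.cast_eq_zero_iff (AlgInt ⧸ I) p _).1 h3)
  calc ξ = ξ * (η ^ (m * n - 1) * η) := by rw [hη', mul_one]
    _ = ζ * η := by rw [hζ, mul_assoc]
    _ = η := by rw [hζ3, one_mul]

open Classical in
/-- The lift of an element of the residue field to a root of unity of order prime to `p`, or to
zero. -/
def teichmuller (hp : p.Prime) [CharP (AlgInt ⧸ M) p] (x : AlgInt ⧸ M) : AlgInt :=
  if h : x = 0 then 0 else (exists_isPrimeToRoot hp h).choose

theorem isPrimeToRoot_teichmuller (hp : p.Prime) [CharP (AlgInt ⧸ M) p] {x : AlgInt ⧸ M}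
    (hx : x ≠ 0) : IsPrimeToRoot p (teichmuller hp x) := by
  rw [teichmuller, dif_neg hx]
  exact (exists_isPrimeToRoot hp hx).choose_spec.1

theorem mk_teichmuller (hp : p.Prime) [CharP (AlgInt ⧸ M) p] (x : AlgInt ⧸ M) :
    Ideal.Quotient.mk M (teichmuller hp x) = x := by
  rw [teichmuller]
  split_ifs with hx
  · rw [hx, map_zero]
  · exact (exists_isPrimeToRoot hp hx).choose_spec.2

theorem teichmuller_mk (hp : p.Prime) [CharP (AlgInt ⧸ M) p] {ξ : AlgInt}
    (h : IsPrimeToRoot p ξ) : teichmuller hp (Ideal.Quotient.mk M ξ) = ξ := by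
  refine (isPrimeToRoot_teichmuller hp fun h0 => ?_).eq_of_mk_eq hp h (mk_teichmuller hp _)
  obtain ⟨m, hm, -, h⟩ := h
  have := congrArg (Ideal.Quotient.mk M) h
  rw [map_pow, h0, zero_pow hm.ne', map_one] at this
  exact zero_ne_one this

theorem teichmuller_mul (hp : p.Prime) [CharP (AlgInt ⧸ M) p] (x y : AlgInt ⧸ M) :
    teichmuller hp (x * y) = teichmuller hp x * teichmuller hp y := by
  have h0 : teichmuller hp (0 : AlgInt ⧸ M) = 0 := dif_pos rfl
  rcases eq_or_ne x 0 with rfl | hx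
  · rw [zero_mul, h0, zero_mul]
  rcases eq_or_ne y 0 with rfl | hy
  · rw [mul_zero, h0, mul_zero]
  have h := teichmuller_mk (M := M) hp
    ((isPrimeToRoot_teichmuller hp hx).mul hp (isPrimeToRoot_teichmuller hp hy))
  rwa [map_mul, mk_teichmuller, mk_teichmuller] at h

/-- The lift of the residue field that defines Brauer characters. -/
def modLift (M : Ideal AlgInt) [M.IsMaximal] (hp : p.Prime) [CharP (AlgInt ⧸ M) p] :
    CharLift (AlgInt ⧸ M) where
  ring := (integralClosure ℤ ℂ).toSubring
  red := Ideal.Quotient.mk M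
  lift :=
    { toFun := teichmuller hp
      map_one' := by
        have := teichmuller_mk (M := M) hp (isPrimeToRoot_one hp)
        rwa [map_one] at this
      map_mul' := teichmuller_mul hp }
  red_lift := mk_teichmuller hp

variable {G : Type u} [Group G]

theorem modLift_brauer_apply (hp : p.Prime) [CharP (AlgInt ⧸ M) p] {n : ℕ}
    (ρ : Representation (AlgInt ⧸ M) G (Fin n → AlgInt ⧸ M)) (g : PReg p G) :
    (modLift M hp).brauer p ρ g =
      ((ρ g).charpoly.roots.map fun x => (teichmuller hp x : ℂ)).sum := by
  have := map_multiset_sum (Subring.subtype (integralClosure ℤ ℂ).toSubring)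
    ((ρ g).charpoly.roots.map (modLift M hp).lift)
  rw [Multiset.map_map] at this
  exact this

/-- On the left the coercion acts on the multiset itself, as a bind of singletons, and the mapped
function is the identity of `ℂ`. -/
theorem sum_map_coe_algInt (s : Multiset AlgInt) :
    (Multiset.map (fun ξ => (ξ : ℂ)) s).sum = (s.map (Subtype.val : AlgInt → ℂ)).sum := by
  rw [Multiset.map_id']
  exact congrArg _ (Multiset.bind_singleton s (Subtype.val : AlgInt → ℂ))

/-- A root of unity of order prime to `p` is determined by its reduction, so the multiset in
`Affords` must be the image of the eigenvalues under `teichmuller`. -/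
theorem affords_iff (hp : p.Prime) [CharP (AlgInt ⧸ M) p] {n : ℕ}
    (ρ : Representation (AlgInt ⧸ M) G (Fin n → AlgInt ⧸ M)) (φ : PReg p G → ℂ) :
    Affords p M ρ φ ↔ φ = (modLift M hp).brauer p ρ := by
  constructor
  · intro h
    funext g
    obtain ⟨s, hs, hroots, hφ⟩ := h g
    rw [modLift_brauer_apply, ← hroots, Multiset.map_map, hφ, sum_map_coe_algInt]
    exact congrArg _ (Multiset.map_congr rfl fun ξ hξ => by
      rw [Function.comp_apply, teichmuller_mk hp (hs ξ hξ)])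
  · rintro rfl g
    refine ⟨(ρ g).charpoly.roots.map (teichmuller hp), fun ξ hξ => ?_, ?_, ?_⟩
    · obtain ⟨x, hx, rfl⟩ := Multiset.mem_map.1 hξ
      exact isPrimeToRoot_teichmuller hp (ne_zero_of_mem_roots_charpoly ρ (g : G) hx)
    · rw [Multiset.map_map]
      refine (Multiset.map_congr rfl fun x _ => ?_).trans (Multiset.map_id _)
      exact mk_teichmuller hp x
    · rw [modLift_brauer_apply, sum_map_coe_algInt, Multiset.map_map]
      rfl

theorem isBrauerChar_iff (hp : p.Prime) [CharP (AlgInt ⧸ M) p] (φ : PReg p G → ℂ) :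
    IsBrauerChar p M φ ↔ (modLift M hp).IsBrauer p φ :=
  exists_congr fun _ => exists_congr fun ρ => and_congr_right fun _ => affords_iff hp ρ φ

theorem isIBr_iff (hp : p.Prime) [CharP (AlgInt ⧸ M) p] (φ : PReg p G → ℂ) :
    IsIBr p M φ ↔ (modLift M hp).IsIrrBrauer p φ :=
  exists_congr fun _ => exists_congr fun ρ => and_congr_right fun _ => affords_iff hp ρ φ

theorem bChOver_eq (hp : p.Prime) [CharP (AlgInt ⧸ M) p] {N H : Subgroup G} (hNH : N ≤ H)
    (θ : PReg p N → ℂ) : BChOver p M hNH θ = LiftChOver (modLift M hp) p hNH θ :=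
  Set.ext fun χ => and_congr_left fun _ => isBrauerChar_iff hp χ

theorem iBrOver_eq (hp : p.Prime) [CharP (AlgInt ⧸ M) p] {N H : Subgroup G} (hNH : N ≤ H)
    (θ : PReg p N → ℂ) : IBrOver p M hNH θ = LiftIrrOver (modLift M hp) p hNH θ := by
  ext χ
  rw [IBrOver, bChOver_eq hp]
  exact ⟨fun h => ⟨(isIBr_iff hp χ).1 h.1, h.2.2⟩,
    fun h => ⟨(isIBr_iff hp χ).2 h.1, h.1.isBrauer, h.2⟩⟩

/-- The isomorphism of modular character triples given by an isomorphism with respect to the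
lift `modLift`. -/
def LiftTripleIso.toModTripleIso {hp : p.Prime} [CharP (AlgInt ⧸ M) p] {G' : Type w} [Group G']
    {N : Subgroup G} [N.Normal] {θ : PReg p N → ℂ} {N' : Subgroup G'} [N'.Normal]
    {θ' : PReg p N' → ℂ} (I : LiftTripleIso (modLift M hp) p N θ N' θ') :
    ModTripleIso p M N θ N' θ' where
  ι := I.ι
  σ := I.σ
  mapsTo H hH := by
    rw [bChOver_eq hp, bChOver_eq hp]
    exact I.mapsTo H hH
  bijOn_irr H hH := by
    rw [iBrOver_eq hp, iBrOver_eq hp]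
    exact I.bijOn_irr H hH
  add H hH := by
    rw [bChOver_eq hp]
    exact I.add H hH
  res K H hK hKH := by
    rw [bChOver_eq hp]
    exact I.res K H hK hKH
  mul H hH χ hχ β hβ := by
    rw [bChOver_eq hp] at hχ
    exact I.mul H hH χ hχ β ((isIBr_iff hp β).1 hβ)

end Residue

end CharTriple

end

/-! ### The ordinary case (`p = 0`) and the modular case -/

theorem proposition5p1 {G : Type u} [Group G] [Finite G] {A : Type v} [Group A] [Finite A]
    [MulDistribMulAction A G] (hcop : Nat.Coprime (Nat.card G) (Nat.card A))
    (N : Subgroup G) [N.Normal] (hN : ∀ (a : A), ∀ n ∈ N, a • n ∈ N) :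
    -- ordinary characters
    (∀ θ : N → ℂ, CharTriple.IsTriple N θ →
      (∀ a : A, θ ∘ CharTriple.actHom N hN a = θ) →
      ∃ (G' : Type u) (_ : Group G') (_ : Finite G') (_ : MulDistribMulAction A G')
        (N' : Subgroup G') (_ : N'.Normal) (θ' : N' → ℂ)
        (hN' : ∀ (a : A), ∀ n ∈ N', a • n ∈ N'),
        CharTriple.IsTriple N' θ' ∧
        (∀ a : A, θ' ∘ CharTriple.actHom N' hN' a = θ') ∧
        N' ≤ Subgroup.center G' ∧
        ∃ I : CharTriple.TripleIso N θ N' θ',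
          (∀ (a : A) (x : G ⧸ N),
            I.ι (CharTriple.quotAct N hN a x) = CharTriple.quotAct N' hN' a (I.ι x)) ∧
          (∀ (a : A), ∀ χ ∈ CharTriple.ChOver (le_top : N ≤ ⊤) θ,
            I.σ ⊤ le_top (χ ∘ CharTriple.actHom ⊤ (fun _ _ _ => Subgroup.mem_top _) a⁻¹) =
              I.σ ⊤ le_top χ ∘
                CharTriple.actHom _ (fun _ _ _ => CharTriple.mem_corr_top I.ι _) a⁻¹)) ∧
    -- Brauer characters, defined by a maximal ideal of the ring of algebraic integers over `p`
    (∀ (p : ℕ), p.Prime → ∀ (M : Ideal CharTriple.AlgInt) [M.IsMaximal],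
      (p : CharTriple.AlgInt) ∈ M →
      ∀ θ : CharTriple.PReg p N → ℂ, CharTriple.IsModTriple p M N θ →
      (∀ a : A, θ ∘ CharTriple.PReg.map (CharTriple.actHom N hN a) = θ) →
      ∃ (G' : Type u) (_ : Group G') (_ : Finite G') (_ : MulDistribMulAction A G')
        (N' : Subgroup G') (_ : N'.Normal) (θ' : CharTriple.PReg p N' → ℂ)
        (hN' : ∀ (a : A), ∀ n ∈ N', a • n ∈ N'),
        CharTriple.IsModTriple p M N' θ' ∧
        (∀ a : A, θ' ∘ CharTriple.PReg.map (CharTriple.actHom N' hN' a) = θ') ∧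
        N' ≤ Subgroup.center G' ∧ ¬ p ∣ Nat.card N' ∧
        ∃ I : CharTriple.ModTripleIso p M N θ N' θ',
          (∀ (a : A) (x : G ⧸ N),
            I.ι (CharTriple.quotAct N hN a x) = CharTriple.quotAct N' hN' a (I.ι x)) ∧
          (∀ (a : A), ∀ χ ∈ CharTriple.BChOver p M (le_top : N ≤ ⊤) θ,
            I.σ ⊤ le_top
                (χ ∘ CharTriple.PReg.map
                  (CharTriple.actHom ⊤ (fun _ _ _ => Subgroup.mem_top _) a⁻¹)) =
              I.σ ⊤ le_top χ ∘ CharTriple.PReg.map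
                (CharTriple.actHom _ (fun _ _ _ => CharTriple.mem_corr_top I.ι _) a⁻¹))) := by
  refine ⟨fun θ hθ hact => ?_, fun p hp M _ hM θ hθ hact => ?_⟩
  · have hinv : ∀ (g : G) (n : CharTriple.PReg 0 N),
        θ (CharTriple.PReg.map (MulAut.conjNormal g : N ≃* N).toMonoidHom n) = θ n :=
      fun g n => hθ.inv g n
    obtain ⟨G', iG, iF, iA, N', iN, θ', hN', hirr, hinv', hact', hcen, -, I, hι, hσ⟩ :=
      CharTriple.exists_liftTripleIso (hN := hN) hθ.irr.isIrrBrauer hinv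
        (fun a => funext fun n => congrFun (hact a) n)
    refine ⟨G', iG, iF, iA, N', iN, θ' ∘ CharTriple.toPReg, hN',
      ⟨CharTriple.isIrr_of_isIrrBrauer hirr, fun g n => hinv' g (CharTriple.toPReg n)⟩,
      fun a => funext fun n => congrFun (hact' a) (CharTriple.toPReg n), hcen,
      I.toTripleIso hθ.irr.isIrrBrauer, hι, fun a χ hχ => ?_⟩
    -- The action of `a` on characters is composition with `a⁻¹`, while the common form is stated
    -- with composition by an arbitrary element of `A`.
    exact congrArg (· ∘ CharTriple.toPReg)
      (hσ a⁻¹ _ (CharTriple.mem_liftChOver_of_mem_chOver hχ))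
  · let _ := Ideal.Quotient.field M
    have hchar := CharTriple.charP_residue p M hp hM
    have hclosed := CharTriple.isAlgClosed_residue M
    obtain ⟨G', iG, iF, iA, N', iN, θ', hN', hirr, hinv', hact', hcen, hcard, I, hι, hσ⟩ :=
      CharTriple.exists_liftTripleIso (hN := hN) ((CharTriple.isIBr_iff hp θ).1 hθ.irr)
        hθ.inv hact
    refine ⟨G', iG, iF, iA, N', iN, θ', hN', ⟨(CharTriple.isIBr_iff hp θ').2 hirr, hinv'⟩,
      hact', hcen, hcard, I.toModTripleIso, hι, fun a χ hχ => ?_⟩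
    rw [CharTriple.bChOver_eq hp] at hχ
    exact hσ a⁻¹ χ hχ
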